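/- Let $q>0$ be real, $q\neq 1$, $[x]=\frac{q^{x/2}-q^{-x/2}}{q^{1/2}-q^{-1/2}}$, and $N\ge 0$. Let $\mathcal F$ be the algebraic Fock space, over $\mathbb R$ or $\mathbb C$, of $N$ pairs $(a_i,b_i)$, $1\le i\le N$, of independent $q$-oscillators: each oscillator acts by $\alpha|n\rangle=\sqrt{[n]}\,|n-1\rangle$ and $\alpha^\dagger|n\rangle=\sqrt{[n+1]}\,|n+1\rangle$, with number operator $N_\alpha$. *Intertwiners.* On the leg $i$ put $J_z=\frac12(N_{a_i}-N_{b_i})$, $J_+=a_i^\dagger b_i$, $J_-=b_i^\dagger a_i$. Let $U_q(su(2))$ act on $\mathcal F$ through the iterated coproduct $\Delta J_z=J_z\otimes 1+1\otimes J_z$, $\Delta J_\pm=J_\pm\otimes q^{J_z/2}+q^{-J_z/2}\otimes J_\pm$. The space $\mathcal I\subset\mathcal F$ of $N$-valent intertwiners (of all spins) consists of the vectors annihilated by the total $J_z,J_+,J_-$. An operator $O$ on $\mathcal F$ is *invariant* if, for the total generators, $[J_z,O]=0$ and $J_\pm\, O\, q^{-J_z/2}=q^{\pm1/2}q^{-J_z/2}\,O\,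 J_\pm$. *Braided spinor operators.* Let $$\mathcal R=q^{J_z\otimes J_z}\sum_{r\ge0}\frac{(1-q^{-1})^r}{[r]!}\,q^{r(r-1)/4}\,(q^{J_z/2}J_+)^r\otimes(q^{-J_z/2}J_-)^r ,$$ and let $\mathcal R_{ms}$ be $\mathcal R$ with its first factor on the leg $m$ and its second factor on the leg $s$. For an operator $t$ acting on the leg $i$ put $${}^{(i)}t=\mathcal R_{i,i-1}\cdots\mathcal R_{i,1}\;t\;\mathcal R_{i,1}^{-1}\cdots\mathcal R_{i,i-1}^{-1}.$$ Apply this to the components $(+\frac12,-\frac12)$ of $T=(a^\dagger q^{N_a/4},\ b^\dagger q^{(2N_a+N_b)/4})$ and $\tilde T=(q^{(2N_a+N_b+1)/4}b,\ -q^{(N_a-1)/4}a)$, and set $$\mathcal E_{ij}=-\,{}^{(i)}T\cdot{}^{(j)}\tilde T,\qquad t\cdot t'=q^{1/4}t_+t'_- -q^{-1/4}t_-t'_+ .$$ *Oscillator operators.* Let $\mathfrak E_{ii}=N_{a_i}+N_{b_i}$ and, for $i<j$ (sums over $l$ run over the indices strictly between the stated bounds), $$\begin{aligned}\mathfrak E_{ij}={}&a_i^\dagger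 a_j\,q^{\frac14(N_{b_i}+2\sum_{i<l<j}N_{b_l}-N_{b_j})}+q^{\frac14(-N_{a_i}+2\sum_{i<l<j}N_{a_l}+N_{a_j})}\,b_i^\dagger b_j\\&+(q^{-1/4}-q^{3/4})\sum_{i<k<j}q^{\frac14(N_{a_k}+2\sum_{k<l<j}N_{a_l}+N_{a_j})}a_i^\dagger a_k\;q^{\frac14(N_{b_i}+2\sum_{i<l<k}N_{b_l}+N_{b_k})}b_k^\dagger b_j,\\ \mathfrak E_{ji}={}&a_i a_j^\dagger\,q^{\frac14(N_{b_i}-2\sum_{i<l<j}N_{b_l}-N_{b_j})}+q^{\frac14(-N_{a_i}-2\sum_{i<l<j}N_{a_l}+N_{a_j})}\,b_i b_j^\dagger\\&+(q^{1/4}-q^{-3/4})\sum_{i<k<j}q^{\frac14(-N_{a_i}-2\sum_{i<l<k}N_{a_l}-N_{a_k})}a_j^\dagger a_k\;q^{\frac14(-N_{b_k}-2\sum_{k<l<j}N_{b_l}-N_{b_j})}b_k^\dagger b_i .\end{aligned}$$ *The algebra $U_q(u(N))$* is generated by $\mathfrak E_{ij}$ $(1\le i,j\le N)$ and $q^{\pm\mathfrak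 E_{ii}/4}$ with the following relations. The $\mathfrak E_{ii}$ and $q^{\pm\mathfrak E_{ii}/4}$ commute with one another, and $q^{\mathfrak E_{ii}/4}$ and $q^{-\mathfrak E_{ii}/4}$ are mutually inverse. For $|j-k|=1$, $[\mathfrak E_{ii},\mathfrak E_{jk}]=(\delta_{ij}-\delta_{ik})\mathfrak E_{jk}$ and $q^{\mathfrak E_{ii}/4}\mathfrak E_{jk}=q^{(\delta_{ij}-\delta_{ik})/4}\mathfrak E_{jk}\,q^{\mathfrak E_{ii}/4}$. Moreover $[\mathfrak E_{i,i+1},\mathfrak E_{j+1,j}]=\delta_{ij}[\mathfrak E_{ii}-\mathfrak E_{i+1,i+1}]$, the right-hand bracket being the $q$-number. With $e_i=\mathfrak E_{i,i+1}$, $[e_i,e_j]=0$ for $|i-j|>1$ and $e_i^2e_j-[2]e_ie_je_i+e_je_i^2=0$ for $|i-j|=1$, and the same holds for $e_i=\mathfrak E_{i+1,i}$. Finally, for $j>i+1$, $$\mathfrak E_{ij}=q^{\frac12\mathfrak E_{j-1,j-1}}(\mathfrak E_{i,j-1}\mathfrak E_{j-1,j}-q^{1/2}\mathfrak E_{j-1,j}\mathfrak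 E_{i,j-1}),\quad \mathfrak E_{ji}=q^{-\frac12\mathfrak E_{j-1,j-1}}(\mathfrak E_{j,j-1}\mathfrak E_{j-1,i}-q^{-1/2}\mathfrak E_{j-1,i}\mathfrak E_{j,j-1}).$$ **Statement.** 1. The operators $\mathcal R_{ms}$ $(s<m)$ on $\mathcal F$ are invertible; all $\mathcal E_{ij}$ are $U_q(su(2))$-invariant and map $\mathcal I$ into itself. 2. On $\mathcal F$, for all $i$, respectively all $i<j$, $$\mathcal E_{ii}=q^{-\frac12}q^{\frac{\mathfrak E_{ii}}2}[\mathfrak E_{ii}],\qquad \mathcal E_{ij}=q^{\frac14\left(-\sum_{i<l<j}\mathfrak E_{ll}+\mathfrak E_{jj}\right)}\mathfrak E_{ij},\qquad \mathcal E_{ji}=q^{\frac14\left(2\mathfrak E_{ii}+\sum_{i<l<j}\mathfrak E_{ll}\right)}\,\mathfrak E_{ji}\,q^{\frac14\mathfrak E_{jj}} .$$ 3. There is a representation of $U_q(u(N))$ on $\mathcal F$ in which the generators $\mathfrak E_{ij}$ act by the above oscillator operators and $q^{\mathfrak E_{ii}/4}$ acts by $q^{(N_{a_i}+N_{b_i})/4}$.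 These operators preserve $\mathcal I$, and their restrictions define a representation of $U_q(u(N))$ on $\mathcal I$. -/

import Mathlib

noncomputable section

namespace QIntertwiner

/-! ### `q`-numbers and the Fock space of `N` pairs of `q`-oscillators -/

/-- The `q`-number `[x] = (q^{x/2} - q^{-x/2}) / (q^{1/2} - q^{-1/2})`. -/
def qNum (q x : ℝ) : ℝ :=
  (q ^ (x / 2) - q ^ (-x / 2)) / (q ^ (1 / 2 : ℝ) - q ^ (-1 / 2 : ℝ))

/-- The `q`-factorial `[n]! = [1][2]⋯[n]`. -/
def qFact (q : ℝ) (n : ℕ) : ℝ := ∏ k ∈ Finset.range n, qNum q ((k : ℝ) + 1)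

/-- Occupation numbers of the `2 N` oscillators: `(i, true)` is the mode `a_i` and `(i, false)` is
the mode `b_i` of the leg `i`. -/
abbrev Occ (N : ℕ) : Type := Fin N × Bool → ℕ

/-- The (algebraic) Fock space, with basis the occupation number states. As
`V^j` is spanned by the states of one leg with `n_a + n_b = 2 j`, it is the direct sum of all
`V^{j_1} ⊗ ⋯ ⊗ V^{j_N}`. -/
abbrev Fock (𝕜 : Type*) [RCLike 𝕜] (N : ℕ) : Type _ := Occ N →₀ 𝕜

/-- Linear operators on the Fock space. -/
abbrev Op (𝕜 : Type*) [RCLike 𝕜] (N : ℕ) : Type _ := Module.End 𝕜 (Fock 𝕜 N)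

variable {𝕜 : Type*} [RCLike 𝕜] {N : ℕ}

/-- The linear operator with prescribed values on the occupation number states. -/
def ofBasis (f : Occ N → Fock 𝕜 N) : Op 𝕜 N := Finsupp.linearCombination 𝕜 f

/-- The operator that is diagonal on the occupation number states, with eigenvalues `g`. -/
def diag (g : Occ N → ℝ) : Op 𝕜 N := ofBasis fun n => Finsupp.single n ((g n : ℝ) : 𝕜)

/-- The operator `q^g`, for a function `g` of the (commuting) number operators. -/
def qPow (q : ℝ) (g : Occ N → ℝ) : Op 𝕜 N := diag fun n => q ^ g n

/-- The creation operator of the mode `μ`: `α† |n⟩ = √[n+1] |n+1⟩`. -/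
def create (q : ℝ) (μ : Fin N × Bool) : Op 𝕜 N := ofBasis fun n =>
  Finsupp.single (Function.update n μ (n μ + 1)) ((√(qNum q ((n μ : ℝ) + 1)) : ℝ) : 𝕜)

/-- The annihilation operator of the mode `μ`: `α |n⟩ = √[n] |n-1⟩`; the coefficient vanishes
for `n = 0`. -/
def annihilate (q : ℝ) (μ : Fin N × Bool) : Op 𝕜 N := ofBasis fun n =>
  Finsupp.single (Function.update n μ (n μ - 1)) ((√(qNum q (n μ : ℝ)) : ℝ) : 𝕜)

/-- The creation operator `a_i†`. -/
def aDag (q : ℝ) (i : Fin N) : Op 𝕜 N := create q (i, true)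

/-- The annihilation operator `a_i`. -/
def aOp (q : ℝ) (i : Fin N) : Op 𝕜 N := annihilate q (i, true)

/-- The creation operator `b_i†`. -/
def bDag (q : ℝ) (i : Fin N) : Op 𝕜 N := create q (i, false)

/-- The annihilation operator `b_i`. -/
def bOp (q : ℝ) (i : Fin N) : Op 𝕜 N := annihilate q (i, false)

/-- The eigenvalue of the number operator `N_{a_i}`. -/
def nA (i : Fin N) (n : Occ N) : ℝ := (n (i, true) : ℝ)

/-- The eigenvalue of the number operator `N_{b_i}`. -/
def nB (i : Fin N) (n : Occ N) : ℝ := (n (i, false) : ℝ)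

/-- The eigenvalue of `N_{a_i} + N_{b_i}`, that is `2 j_i`. -/
def nLeg (i : Fin N) (n : Occ N) : ℝ := nA i n + nB i n

/-- The eigenvalue of `J_z = (N_a - N_b) / 2` on the leg `i`. -/
def jz (i : Fin N) (n : Occ N) : ℝ := (nA i n - nB i n) / 2

/-! ### The action of `U_q(su(2))` and intertwiners -/

/-- `J_+ = a† b` on the leg `i`. -/
def legJp (q : ℝ) (i : Fin N) : Op 𝕜 N := aDag q i * bOp q i

/-- `J_- = b† a` on the leg `i`. -/
def legJm (q : ℝ) (i : Fin N) : Op 𝕜 N := bDag q i * aOp q i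

/-- `J_z` acting through the iterated coproduct. -/
def totJz : Op 𝕜 N := diag fun n => ∑ l, jz l n

/-- `J_+` acting through the iterated coproduct of `Δ J_+ = J_+ ⊗ q^{J_z/2} + q^{-J_z/2} ⊗ J_+`. -/
def totJp (q : ℝ) : Op 𝕜 N := ∑ l : Fin N,
  qPow q (fun n => -(∑ k ∈ Finset.Iio l, jz k n) / 2) * legJp q l *
    qPow q (fun n => (∑ k ∈ Finset.Ioi l, jz k n) / 2)

/-- `J_-` acting through the iterated coproduct of `Δ J_- = J_- ⊗ q^{J_z/2} + q^{-J_z/2} ⊗ J_-`. -/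
def totJm (q : ℝ) : Op 𝕜 N := ∑ l : Fin N,
  qPow q (fun n => -(∑ k ∈ Finset.Iio l, jz k n) / 2) * legJm q l *
    qPow q (fun n => (∑ k ∈ Finset.Ioi l, jz k n) / 2)

/-- The operator `q^{-J_z/2}` for the total `J_z`. -/
def totKinv (q : ℝ) : Op 𝕜 N := qPow q fun n => -(∑ l, jz l n) / 2

/-- The space of `N`-valent intertwiners (of all spins): the vectors annihilated by
`J_z`, `J_+`, `J_-`. -/
def intertwiners (𝕜 : Type*) [RCLike 𝕜] (q : ℝ) (N : ℕ) : Submodule 𝕜 (Fock 𝕜 N) :=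
  LinearMap.ker (totJz : Op 𝕜 N) ⊓ LinearMap.ker (totJp q : Op 𝕜 N) ⊓
    LinearMap.ker (totJm q : Op 𝕜 N)

/-- Invariance of an operator under the adjoint action
`J_z ▷ O = [J_z, O]`, `J_± ▷ O = J_± O q^{-J_z/2} - q^{±1/2} q^{-J_z/2} O J_±`. -/
def IsInvariant (q : ℝ) (O : Op 𝕜 N) : Prop :=
  totJz * O - O * totJz = 0 ∧
  totJp q * O * totKinv q - ((q ^ (1 / 2 : ℝ) : ℝ) : 𝕜) • (totKinv q * O * totJp q) = 0 ∧
  totJm q * O * totKinv q - ((q ^ (-1 / 2 : ℝ) : ℝ) : 𝕜) • (totKinv q * O * totJm q) = 0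

/-! ### The `R`-matrix, braided spinor operators and the operators `E_{ij}` -/

/-- The `R`-matrix with its first factor on the leg `m` and its second factor on the leg `s`,
`q^{J_z ⊗ J_z} ∑_r (1 - q⁻¹)^r / [r]! q^{r(r-1)/4} (q^{J_z/2} J_+)^r ⊗ (q^{-J_z/2} J_-)^r`.
On a state with `n_b` quanta `b_m` the terms with `r > n_b` vanish, as `J_+^r` does. -/
def rMatrix (q : ℝ) (m s : Fin N) : Op 𝕜 N :=
  qPow q (fun n => jz m n * jz s n) *
    ofBasis fun n => ∑ r ∈ Finset.range (n (m, false) + 1),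
      (((1 - q⁻¹) ^ r / qFact q r * q ^ ((r : ℝ) * ((r : ℝ) - 1) / 4) : ℝ) : 𝕜) •
        ((qPow q (fun n => jz m n / 2) * legJp q m) ^ r *
          (qPow q (fun n => -jz s n / 2) * legJm q s) ^ r : Op 𝕜 N) (Finsupp.single n 1)

/-- The product `R_{i,s-1} ⋯ R_{i,1} R_{i,0}` (legs are numbered from `0`). -/
def braidUpTo (q : ℝ) (i : Fin N) : (s : ℕ) → s ≤ i.val → Op 𝕜 N
  | 0, _ => 1
  | s + 1, h => rMatrix q i ⟨s, lt_of_lt_of_le h i.isLt.le⟩ *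
      braidUpTo q i s (Nat.le_of_succ_le h)

/-- The product of the `R_{i,k}` over all legs `k` before `i`, with `k` decreasing from left to
right. -/
def braid (q : ℝ) (i : Fin N) : Op 𝕜 N := braidUpTo q i i.val le_rfl

/-- The braided operator `⁽ⁱ⁾t = R_{i,i-1} ⋯ R_{i,1} t R_{i,1}⁻¹ ⋯ R_{i,i-1}⁻¹` of an operator `t`
that acts on the leg `i`. -/
def braided (q : ℝ) (i : Fin N) (t : Op 𝕜 N) : Op 𝕜 N :=
  braid q i * t * Ring.inverse (braid q i)

/-- The spinor operator `T = (a† q^{N_a/4}, b† q^{(2 N_a + N_b)/4})` on the leg `i`; `true` and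
`false` stand for the components `m = 1/2` and `m = -1/2`. -/
def spinorT (q : ℝ) (i : Fin N) : Bool → Op 𝕜 N
  | true => aDag q i * qPow q (fun n => nA i n / 4)
  | false => bDag q i * qPow q (fun n => (2 * nA i n + nB i n) / 4)

/-- The spinor operator `T̃ = (q^{(2 N_a + N_b + 1)/4} b, -q^{(N_a - 1)/4} a)` on the leg `i`. -/
def spinorTt (q : ℝ) (i : Fin N) : Bool → Op 𝕜 N
  | true => qPow q (fun n => (2 * nA i n + nB i n + 1) / 4) * bOp q i
  | false => -(qPow q (fun n => (nA i n - 1) / 4) * aOp q i)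

/-- The scalar product `t · t' = ∑_m (-1)^{1/2 - m} q^{m/2} t_m t'_{-m}` of two families of
operators of rank `1/2`. -/
def spinorDot (q : ℝ) (t t' : Bool → Op 𝕜 N) : Op 𝕜 N :=
  ((q ^ (1 / 4 : ℝ) : ℝ) : 𝕜) • (t true * t' false) -
    ((q ^ (-1 / 4 : ℝ) : ℝ) : 𝕜) • (t false * t' true)

/-- The operator `E_{ij} = - ⁽ⁱ⁾T · ⁽ʲ⁾T̃`. -/
def scriptE (q : ℝ) (i j : Fin N) : Op 𝕜 N :=
  -(spinorDot q (fun m => braided q i (spinorT q i m))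
    (fun m => braided q j (spinorTt q j m)) : Op 𝕜 N)

/-! ### The oscillator realization of the Cartan-Weyl generators -/

/-- The oscillator expression of `𝔈_{ij}` for `i < j`. -/
def frakUp (q : ℝ) (i j : Fin N) : Op 𝕜 N :=
  aDag q i * aOp q j *
      qPow q (fun n => (nB i n + 2 * (∑ l ∈ Finset.Ioo i j, nB l n) - nB j n) / 4) +
    qPow q (fun n => (-nA i n + 2 * (∑ l ∈ Finset.Ioo i j, nA l n) + nA j n) / 4) *
      (bDag q i * bOp q j) +
    ((q ^ (-1 / 4 : ℝ) - q ^ (3 / 4 : ℝ) : ℝ) : 𝕜) • ∑ k ∈ Finset.Ioo i j,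
      qPow q (fun n => (nA k n + 2 * (∑ l ∈ Finset.Ioo k j, nA l n) + nA j n) / 4) *
        (aDag q i * aOp q k) *
        qPow q (fun n => (nB i n + 2 * (∑ l ∈ Finset.Ioo i k, nB l n) + nB k n) / 4) *
        (bDag q k * bOp q j)

/-- The oscillator expression of `𝔈_{ji}` for `i < j`. -/
def frakDown (q : ℝ) (i j : Fin N) : Op 𝕜 N :=
  aOp q i * aDag q j *
      qPow q (fun n => (nB i n - 2 * (∑ l ∈ Finset.Ioo i j, nB l n) - nB j n) / 4) +
    qPow q (fun n => (-nA i n - 2 * (∑ l ∈ Finset.Ioo i j, nA l n) + nA j n) / 4) *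
      (bOp q i * bDag q j) +
    ((q ^ (1 / 4 : ℝ) - q ^ (-3 / 4 : ℝ) : ℝ) : 𝕜) • ∑ k ∈ Finset.Ioo i j,
      qPow q (fun n => (-nA i n - 2 * (∑ l ∈ Finset.Ioo i k, nA l n) - nA k n) / 4) *
        (aDag q j * aOp q k) *
        qPow q (fun n => (-nB k n - 2 * (∑ l ∈ Finset.Ioo k j, nB l n) - nB j n) / 4) *
        (bDag q k * bOp q i)

/-- The operators `𝔈_{ij}`, realized with `N` pairs of `q`-oscillators. -/
def frakE (q : ℝ) (i j : Fin N) : Op 𝕜 N :=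
  if i < j then frakUp q i j else if j < i then frakDown q j i else diag (nLeg i)

/-! ### The quantum group `U_q(u(N))` as an algebra -/

/-- The generators of `U_q(u(N))`: the Cartan-Weyl generators `𝔈_{ij}` and the elements
`q^{𝔈_{ii}/4}`, `q^{-𝔈_{ii}/4}`. -/
inductive UqGen (N : ℕ) : Type
  | E (i j : Fin N)
  | K (i : Fin N)
  | Kinv (i : Fin N)

/-- The generator `𝔈_{ij}` in the free algebra. -/
def fE (i j : Fin N) : FreeAlgebra 𝕜 (UqGen N) := FreeAlgebra.ι 𝕜 (UqGen.E i j)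

/-- The generator `q^{𝔈_{ii}/4}` in the free algebra. -/
def fK (i : Fin N) : FreeAlgebra 𝕜 (UqGen N) := FreeAlgebra.ι 𝕜 (UqGen.K i)

/-- The generator `q^{-𝔈_{ii}/4}` in the free algebra. -/
def fKinv (i : Fin N) : FreeAlgebra 𝕜 (UqGen N) := FreeAlgebra.ι 𝕜 (UqGen.Kinv i)

/-- The weight `δ_{ij} - δ_{ik}` of `𝔈_{jk}` with respect to `𝔈_{ii}`. -/
def weight (i j k : Fin N) : ℝ := (if i = j then 1 else 0) - (if i = k then 1 else 0)

/-- The `q`-number `[𝔈_{ii} - 𝔈_{jj}]` in the free algebra, where `q^{𝔈_{ii}/2}` is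
the square of `q^{𝔈_{ii}/4}`. -/
def fBracket (q : ℝ) (i j : Fin N) : FreeAlgebra 𝕜 (UqGen N) :=
  (((q ^ (1 / 2 : ℝ) - q ^ (-1 / 2 : ℝ))⁻¹ : ℝ) : 𝕜) •
    (fK i ^ 2 * fKinv j ^ 2 - fKinv i ^ 2 * fK j ^ 2)

/-- The defining relations of `U_q(u(N))`: the relations of the Cartan elements, the weights and
commutators of the simple generators `𝔈_{i,i+1}`, `𝔈_{i+1,i}`, the `q`-Serre relations, and the
inductive definition of the other `𝔈_{ij}`. -/
inductive UqRel (𝕜 : Type*) [RCLike 𝕜] (q : ℝ) (N : ℕ) :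
    FreeAlgebra 𝕜 (UqGen N) → FreeAlgebra 𝕜 (UqGen N) → Prop
  | cartan_comm (i j : Fin N) : UqRel 𝕜 q N (fE i i * fE j j - fE j j * fE i i) 0
  | cartan_K_comm (i j : Fin N) : UqRel 𝕜 q N (fE i i * fK j - fK j * fE i i) 0
  | K_comm (i j : Fin N) : UqRel 𝕜 q N (fK i * fK j - fK j * fK i) 0
  | K_Kinv (i : Fin N) : UqRel 𝕜 q N (fK i * fKinv i) 1
  | Kinv_K (i : Fin N) : UqRel 𝕜 q N (fKinv i * fK i) 1
  | cartan_raise (i j k : Fin N) (h : j.val + 1 = k.val) :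
      UqRel 𝕜 q N (fE i i * fE j k - fE j k * fE i i) (((weight i j k : ℝ) : 𝕜) • fE j k)
  | cartan_lower (i j k : Fin N) (h : j.val + 1 = k.val) :
      UqRel 𝕜 q N (fE i i * fE k j - fE k j * fE i i) (((weight i k j : ℝ) : 𝕜) • fE k j)
  | K_raise (i j k : Fin N) (h : j.val + 1 = k.val) :
      UqRel 𝕜 q N (fK i * fE j k) (((q ^ (weight i j k / 4) : ℝ) : 𝕜) • (fE j k * fK i))
  | K_lower (i j k : Fin N) (h : j.val + 1 = k.val) :
      UqRel 𝕜 q N (fK i * fE k j) (((q ^ (weight i k j / 4) : ℝ) : 𝕜) • (fE k j * fK i))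
  | raise_lower (i i' : Fin N) (h : i.val + 1 = i'.val) :
      UqRel 𝕜 q N (fE i i' * fE i' i - fE i' i * fE i i') (fBracket q i i')
  | raise_lower_ne (i i' j j' : Fin N) (hi : i.val + 1 = i'.val) (hj : j.val + 1 = j'.val)
      (hij : i ≠ j) : UqRel 𝕜 q N (fE i i' * fE j' j - fE j' j * fE i i') 0
  | raise_far (i i' j j' : Fin N) (hi : i.val + 1 = i'.val) (hj : j.val + 1 = j'.val)
      (hij : i' < j) : UqRel 𝕜 q N (fE i i' * fE j j' - fE j j' * fE i i') 0
  | lower_far (i i' j j' : Fin N) (hi : i.val + 1 = i'.val) (hj : j.val + 1 = j'.val)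
      (hij : i' < j) : UqRel 𝕜 q N (fE i' i * fE j' j - fE j' j * fE i' i) 0
  | serre_raise (i i' j j' : Fin N) (hi : i.val + 1 = i'.val) (hj : j.val + 1 = j'.val)
      (hij : i' = j ∨ j' = i) :
      UqRel 𝕜 q N (fE i i' ^ 2 * fE j j' - ((qNum q 2 : ℝ) : 𝕜) • (fE i i' * fE j j' * fE i i') +
        fE j j' * fE i i' ^ 2) 0
  | serre_lower (i i' j j' : Fin N) (hi : i.val + 1 = i'.val) (hj : j.val + 1 = j'.val)
      (hij : i' = j ∨ j' = i) :
      UqRel 𝕜 q N (fE i' i ^ 2 * fE j' j - ((qNum q 2 : ℝ) : 𝕜) • (fE i' i * fE j' j * fE i' i) +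
        fE j' j * fE i' i ^ 2) 0
  | raise_step (i k j : Fin N) (hik : i < k) (hkj : k.val + 1 = j.val) :
      UqRel 𝕜 q N (fE i j)
        (fK k ^ 2 * (fE i k * fE k j - ((q ^ (1 / 2 : ℝ) : ℝ) : 𝕜) • (fE k j * fE i k)))
  | lower_step (i k j : Fin N) (hik : i < k) (hkj : k.val + 1 = j.val) :
      UqRel 𝕜 q N (fE j i)
        (fKinv k ^ 2 * (fE j k * fE k i - ((q ^ (-1 / 2 : ℝ) : ℝ) : 𝕜) • (fE k i * fE j k)))

/-- The algebra `U_q(u(N))` over `𝕜`. -/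
abbrev Uq (𝕜 : Type*) [RCLike 𝕜] (q : ℝ) (N : ℕ) : Type _ := RingQuot (UqRel 𝕜 q N)

/-- The Cartan-Weyl generator `𝔈_{ij}` of `U_q(u(N))`. -/
def uqE (𝕜 : Type*) [RCLike 𝕜] (q : ℝ) {N : ℕ} (i j : Fin N) : Uq 𝕜 q N :=
  RingQuot.mkAlgHom 𝕜 (UqRel 𝕜 q N) (fE i j)

/-- The element `q^{𝔈_{ii}/4}` of `U_q(u(N))`. -/
def uqK (𝕜 : Type*) [RCLike 𝕜] (q : ℝ) {N : ℕ} (i : Fin N) : Uq 𝕜 q N :=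
  RingQuot.mkAlgHom 𝕜 (UqRel 𝕜 q N) (fK i)

end QIntertwiner

end

open QIntertwiner

noncomputable section

namespace QIntertwiner

variable {𝕜 : Type*} [RCLike 𝕜] {N : ℕ}

/-! ### Monomial operators

The occupation numbers are embedded into the real vectors, and the states are rescaled, so that
creation operators become translations and annihilation operators translations with a coefficient
that is a `q`-number. -/

/-! Every operator involved is built from monomials, which shift the occupation numbers and multiply
by a coefficient. When |n⟩ is written as ∏ ([n_μ]!)^{-1/2} times a new basis vector, a creation
operator becomes a pure shift and an annihilation operator a shift with coefficient [n]. An identity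
between monomials is then an identity between functions of real variables (`IsMono.ext`,
`IsMono.ext_add`), settled by collecting exponentials and using the recursions for [x + 1].

Invariance. Put p = q^{1/4} and K = q^{J_z/2}. The key is a closed form of the braiding: it sends a
spinor operator (t_+, t_-) on the leg i to (t_+ K, t_- K⁻¹ + (p - p⁻³) t_+ J_-), with K and J_- the
coproduct generators of the legs below i (`braided_true`, `braided_false`). It holds because the sum
in R is a q-exponential of (K J_+) ⊗ (K⁻¹ J_-): K J_+ commutes with t_+, passes t_- up to a term in
t_+, and the coefficient recursion `rCoef_succ` resums these terms. On the first leg of R, J_+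
lowers n_b, so the sum is locally finite and R is a diagonal invertible times a locally unipotent
operator. The closed form is a spinor operator for the coproduct (`IsSpinor.braided_left`), and legs
to the right cost nothing (`IsSpinor.extend_right`). Hence E_{ij}, a scalar product of two spinor
operators, commutes with the generators (`IsSpinor.dot_commute`).

Change of variables. The legs below both indices cancel (`scriptE_self`, `scriptE_lt`,
`scriptE_gt`); the remaining terms match those of 𝔈_{ij}, each leg strictly between giving one
summand of the third term.

U_q(u(N)). A simple generator is the coproduct of two commuting Jordan–Schwinger hops, one in the
a-modes and one in the b-modes; this yields the brackets. The q-Serre relations follow from those of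
each hop and from q-commutation (`serre_add`), and the inductive formula is bilinear, hence checked
on monomials. As each N_a + N_b commutes with U_q(su(2)), inverting the change of variables
transfers the preservation of the intertwiner space from E_{ij} to 𝔈_{ij}. -/

lemma qNum_pos {q : ℝ} (hq : 0 < q) (hq1 : q ≠ 1) {x : ℝ} (hx : 0 < x) : 0 < qNum q x := by
  unfold qNum
  rcases lt_or_gt_of_ne hq1 with h | h
  · apply div_pos_of_neg_of_neg <;> rw [sub_neg] <;>
      apply Real.rpow_lt_rpow_of_exponent_gt hq h <;> linarith
  · apply div_pos <;> rw [sub_pos] <;> apply Real.rpow_lt_rpow_of_exponent_lt h <;> linarith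

lemma qFact_pos {q : ℝ} (hq : 0 < q) (hq1 : q ≠ 1) (n : ℕ) : 0 < qFact q n :=
  Finset.prod_pos fun k _ => qNum_pos hq hq1 (by positivity)

lemma qFact_succ (q : ℝ) (n : ℕ) : qFact q (n + 1) = qFact q n * qNum q ((n : ℝ) + 1) := by
  simp [qFact, Finset.prod_range_succ]

lemma qNum_zero (q : ℝ) : qNum q 0 = 0 := by simp [qNum]

/-- The normalization factor of the rescaled state. -/
def stateNorm (q : ℝ) (n : Occ N) : ℝ := ∏ μ, (√(qFact q (n μ)))⁻¹

lemma stateNorm_ne_zero {q : ℝ} (hq : 0 < q) (hq1 : q ≠ 1) (n : Occ N) : stateNorm q n ≠ 0 :=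
  Finset.prod_ne_zero_iff.mpr fun _ _ =>
    inv_ne_zero (Real.sqrt_pos.mpr (qFact_pos hq hq1 _)).ne'

/-- The reason for this normalization: it absorbs the factor √[n+1] of a creation operator, which
gets coefficient 1, while annihilation gets coefficient [n] without a root. -/
lemma stateNorm_update_succ {q : ℝ} (hq : 0 < q) (hq1 : q ≠ 1) (n : Occ N) (μ : Fin N × Bool) :
    √(qNum q ((n μ : ℝ) + 1)) * stateNorm q (Function.update n μ (n μ + 1)) = stateNorm q n := by
  have h0 : √(qNum q ((n μ : ℝ) + 1)) ≠ 0 :=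
    (Real.sqrt_pos.mpr (qNum_pos hq hq1 (by positivity))).ne'
  unfold stateNorm
  rw [← Finset.mul_prod_erase _ _ (Finset.mem_univ μ),
    ← Finset.mul_prod_erase (a := μ) _ (fun μ => (√(qFact q (n μ)))⁻¹) (Finset.mem_univ μ),
    Function.update_self, qFact_succ, Real.sqrt_mul (qFact_pos hq hq1 _).le, mul_inv,
    Finset.prod_congr rfl (g := fun ν => (√(qFact q (n ν)))⁻¹)]
  · field_simp
  · intro ν hν
    rw [Function.update_of_ne (Finset.ne_of_mem_erase hν)]

/-- Translation by `δ` with coefficient `f`. -/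
def shiftOp (𝕜 : Type*) [RCLike 𝕜] {N : ℕ} (δ : Fin N × Bool → ℝ)
    (f : (Fin N × Bool → ℝ) → ℝ) : Module.End 𝕜 ((Fin N × Bool → ℝ) →₀ 𝕜) :=
  Finsupp.linearCombination 𝕜 fun z => Finsupp.single (z + δ) ((f z : ℝ) : 𝕜)

lemma shiftOp_mul (δ δ' : Fin N × Bool → ℝ) (f f' : (Fin N × Bool → ℝ) → ℝ) :
    shiftOp 𝕜 δ f * shiftOp 𝕜 δ' f' = shiftOp 𝕜 (δ' + δ) fun z => f (z + δ') * f' z := by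
  ext z : 2
  simp [shiftOp, Finsupp.linearCombination_single, add_assoc, mul_comm]

/-- The embedding of the Fock space with rescaled states. -/
def emb (𝕜 : Type*) [RCLike 𝕜] (q : ℝ) (N : ℕ) : Fock 𝕜 N →ₗ[𝕜] ((Fin N × Bool → ℝ) →₀ 𝕜) :=
  Finsupp.linearCombination 𝕜 fun n =>
    Finsupp.single (fun μ => (n μ : ℝ)) ((stateNorm q n : ℝ) : 𝕜)

lemma emb_single (q : ℝ) (n : Occ N) (c : 𝕜) : emb 𝕜 q N (Finsupp.single n c) =
    Finsupp.single (fun μ => (n μ : ℝ)) (c * ((stateNorm q n : ℝ) : 𝕜)) := by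
  simp [emb, Finsupp.linearCombination_single]

lemma emb_injective {q : ℝ} (hq : 0 < q) (hq1 : q ≠ 1) : Function.Injective (emb 𝕜 q N) := by
  have hinj : Function.Injective fun (n : Occ N) (μ : Fin N × Bool) => (n μ : ℝ) := by
    intro n m h
    funext μ
    simpa using congrFun h μ
  rw [injective_iff_map_eq_zero]
  intro v hv
  ext n
  have h : ∀ v : Fock 𝕜 N, emb 𝕜 q N v (fun μ => (n μ : ℝ)) = v n * ((stateNorm q n : ℝ) : 𝕜) := by
    intro v
    induction v using Finsupp.induction_linear with
    | zero => simp
    | add f g hf hg => simp [hf, hg, add_mul]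
    | single m c =>
      rw [emb_single]
      by_cases hm : m = n
      · subst hm; simp
      · rw [Finsupp.single_eq_of_ne (fun h => hm (hinj h.symm)), Finsupp.single_eq_of_ne (Ne.symm hm),
          zero_mul]
  have h1 := h v
  rw [hv] at h1
  have h2 : ((stateNorm q n : ℝ) : 𝕜) ≠ 0 := by
    exact_mod_cast stateNorm_ne_zero hq hq1 n
  simpa [h2] using h1

/-- `A` shifts the occupation numbers by `δ`, with coefficient `f` on the rescaled states. -/
class IsMono (q : ℝ) (A : Op 𝕜 N) (δ : outParam (Fin N × Bool → ℝ))
    (f : outParam ((Fin N × Bool → ℝ) → ℝ)) : Prop where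
  comp : emb 𝕜 q N ∘ₗ A = shiftOp 𝕜 δ f ∘ₗ emb 𝕜 q N

/-- `g'` extends the function `g` of the occupation numbers to real vectors. -/
class IsExt (g : Occ N → ℝ) (g' : outParam ((Fin N × Bool → ℝ) → ℝ)) : Prop where
  eq : ∀ n : Occ N, g n = g' fun μ => (n μ : ℝ)

namespace IsExt

variable {g h : Occ N → ℝ} {g' h' : (Fin N × Bool → ℝ) → ℝ}

instance nA (i : Fin N) : IsExt (nA i) fun z => z (i, true) := ⟨fun _ => rfl⟩
instance nB (i : Fin N) : IsExt (nB i) fun z => z (i, false) := ⟨fun _ => rfl⟩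
instance nLeg (i : Fin N) : IsExt (nLeg i) fun z => z (i, true) + z (i, false) := ⟨fun _ => rfl⟩
instance jz (i : Fin N) : IsExt (jz i) fun z => (z (i, true) - z (i, false)) / 2 := ⟨fun _ => rfl⟩
instance const (c : ℝ) : IsExt (fun _ : Occ N => c) fun _ => c := ⟨fun _ => rfl⟩
instance add [IsExt g g'] [IsExt h h'] : IsExt (fun n => g n + h n) fun z => g' z + h' z :=
  ⟨fun n => by rw [IsExt.eq (g := g), IsExt.eq (g := h)]⟩
instance sub [IsExt g g'] [IsExt h h'] : IsExt (fun n => g n - h n) fun z => g' z - h' z :=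
  ⟨fun n => by rw [IsExt.eq (g := g), IsExt.eq (g := h)]⟩
instance mul [IsExt g g'] [IsExt h h'] : IsExt (fun n => g n * h n) fun z => g' z * h' z :=
  ⟨fun n => by rw [IsExt.eq (g := g), IsExt.eq (g := h)]⟩
instance div [IsExt g g'] [IsExt h h'] : IsExt (fun n => g n / h n) fun z => g' z / h' z :=
  ⟨fun n => by rw [IsExt.eq (g := g), IsExt.eq (g := h)]⟩
instance neg [IsExt g g'] : IsExt (fun n => -g n) fun z => -g' z :=
  ⟨fun n => by rw [IsExt.eq (g := g)]⟩
instance qNum (q : ℝ) [IsExt g g'] : IsExt (fun n => qNum q (g n)) fun z => qNum q (g' z) :=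
  ⟨fun n => by rw [IsExt.eq (g := g)]⟩
instance sum {ι : Type*} (s : Finset ι) {g : ι → Occ N → ℝ} {g' : ι → (Fin N × Bool → ℝ) → ℝ}
    [∀ i, IsExt (g i) (g' i)] : IsExt (fun n => ∑ i ∈ s, g i n) fun z => ∑ i ∈ s, g' i z :=
  ⟨fun n => Finset.sum_congr rfl fun i _ => IsExt.eq (g := g i) n⟩

end IsExt

namespace IsMono

variable {q : ℝ} {A B C : Op 𝕜 N} {δ δ' δ'' : Fin N × Bool → ℝ}
  {f f' f'' : (Fin N × Bool → ℝ) → ℝ}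

lemma of_single (h : ∀ n : Occ N, emb 𝕜 q N (A (Finsupp.single n 1)) =
    Finsupp.single ((fun μ => (n μ : ℝ)) + δ)
      (((f fun μ => (n μ : ℝ)) * stateNorm q n : ℝ) : 𝕜)) : IsMono q A δ f := by
  refine ⟨?_⟩
  ext n : 2
  simp [h, emb_single, shiftOp, Finsupp.linearCombination_single, mul_comm]

instance diag (g : Occ N → ℝ) (g' : (Fin N × Bool → ℝ) → ℝ) [IsExt g g'] :
    IsMono q (diag g : Op 𝕜 N) 0 g' := of_single fun n => by
  simp [QIntertwiner.diag, ofBasis, Finsupp.linearCombination_single, emb_single,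
    IsExt.eq (g := g) n]

instance qPow (r : ℝ) (g : Occ N → ℝ) (g' : (Fin N × Bool → ℝ) → ℝ) [IsExt g g'] :
    IsMono q (qPow r g : Op 𝕜 N) 0 fun z => r ^ g' z := of_single fun n => by
  simp [QIntertwiner.qPow, QIntertwiner.diag, ofBasis, Finsupp.linearCombination_single,
    emb_single, IsExt.eq (g := g) n]

instance create [hq : Fact (0 < q)] [hq1 : Fact (q ≠ 1)] (μ : Fin N × Bool) :
    IsMono q (create q μ : Op 𝕜 N) (Pi.single μ 1) fun _ => 1 := of_single fun n => by
  simp only [QIntertwiner.create, ofBasis, Finsupp.linearCombination_single, emb_single, one_smul]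
  rw [← RCLike.ofReal_mul, stateNorm_update_succ hq.out hq1.out, one_mul]
  congr 1
  funext ν
  by_cases h : ν = μ
  · subst h; simp
  · simp [h]

instance annihilate [hq : Fact (0 < q)] [hq1 : Fact (q ≠ 1)] (μ : Fin N × Bool) :
    IsMono q (annihilate q μ : Op 𝕜 N) (-Pi.single μ 1) fun z => QIntertwiner.qNum q (z μ) :=
  of_single fun n => by
  simp only [QIntertwiner.annihilate, ofBasis, Finsupp.linearCombination_single, emb_single,
    one_smul]
  -- At occupation 0 the natural predecessor and the real shift to -1 disagree; the coefficient [0]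
  -- = 0 makes both sides vanish.
  rcases Nat.eq_zero_or_pos (n μ) with h0 | h0
  · simp [h0, qNum_zero]
  · obtain ⟨k, hk⟩ : ∃ k, n μ = k + 1 := ⟨n μ - 1, by omega⟩
    have h1 := stateNorm_update_succ hq.out hq1.out (Function.update n μ (n μ - 1)) μ
    rw [Function.update_self, Function.update_idem, Nat.sub_add_cancel h0,
      Function.update_eq_self] at h1
    have h2 : ((n μ - 1 : ℕ) : ℝ) + 1 = n μ := by rw [hk]; simp
    rw [h2] at h1
    rw [← RCLike.ofReal_mul, ← h1, ← mul_assoc, Real.mul_self_sqrt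
      (qNum_pos hq.out hq1.out (by exact_mod_cast h0)).le]
    congr 1
    funext ν
    by_cases h : ν = μ
    · subst h; simp [← h2]
    · simp [h]

instance aDag [Fact (0 < q)] [Fact (q ≠ 1)] (i : Fin N) :
    IsMono q (aDag q i : Op 𝕜 N) (Pi.single (i, true) 1) fun _ => 1 := create _
instance bDag [Fact (0 < q)] [Fact (q ≠ 1)] (i : Fin N) :
    IsMono q (bDag q i : Op 𝕜 N) (Pi.single (i, false) 1) fun _ => 1 := create _
instance aOp [Fact (0 < q)] [Fact (q ≠ 1)] (i : Fin N) :
    IsMono q (aOp q i : Op 𝕜 N) (-Pi.single (i, true) 1)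
      fun z => QIntertwiner.qNum q (z (i, true)) := annihilate _
instance bOp [Fact (0 < q)] [Fact (q ≠ 1)] (i : Fin N) :
    IsMono q (bOp q i : Op 𝕜 N) (-Pi.single (i, false) 1)
      fun z => QIntertwiner.qNum q (z (i, false)) := annihilate _

instance one : IsMono q (1 : Op 𝕜 N) 0 fun _ => 1 := of_single fun n => by simp [emb_single]

instance mul [hA : IsMono q A δ f] [hB : IsMono q B δ' f'] :
    IsMono q (A * B) (δ' + δ) fun z => f (z + δ') * f' z := by
  refine ⟨?_⟩
  rw [← shiftOp_mul, Module.End.mul_eq_comp, Module.End.mul_eq_comp, ← LinearMap.comp_assoc,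
    hA.comp, LinearMap.comp_assoc, hB.comp, LinearMap.comp_assoc]

instance smul (c : ℝ) [hA : IsMono q A δ f] : IsMono q ((c : 𝕜) • A) δ fun z => c * f z := by
  refine ⟨?_⟩
  rw [LinearMap.comp_smul, hA.comp]
  have : shiftOp 𝕜 δ (fun z => c * f z) = (c : 𝕜) • shiftOp 𝕜 δ f := by
    ext z : 2
    simp [shiftOp, Finsupp.linearCombination_single]
  rw [this, LinearMap.smul_comp]

instance neg [hA : IsMono q A δ f] : IsMono q (-A) δ fun z => -f z := by
  have h : IsMono q (((-1 : ℝ) : 𝕜) • A) δ fun z => -1 * f z := inferInstance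
  have e : ((-1 : ℝ) : 𝕜) • A = -A := LinearMap.ext fun v => by simp
  rw [e] at h
  simpa only [neg_mul, one_mul] using h

/-- The coefficients are compared at all real vectors. This is more than equality on occupation
numbers, but it turns the claim into algebra of exponentials, free of truncated subtraction; shifts
and coefficients are found by instance search. -/
lemma ext [hq : Fact (0 < q)] [hq1 : Fact (q ≠ 1)] (hA : IsMono q A δ f) (hB : IsMono q B δ' f')
    (hδ : δ = δ') (hf : ∀ z, f z = f' z) : A = B := by
  obtain rfl : f = f' := funext hf
  subst hδ
  ext1 n
  exact LinearMap.ext fun c => emb_injective hq.out hq1.out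
    (LinearMap.congr_fun (hA.comp.trans hB.comp.symm) _)

lemma congr (hA : IsMono q A δ f) (hδ : δ = δ') (hf : ∀ z, f z = f' z) : IsMono q A δ' f' := by
  obtain rfl : f = f' := funext hf
  exact hδ ▸ hA

lemma add (hA : IsMono q A δ f) (hB : IsMono q B δ' f') (hδ : δ' = δ) :
    IsMono q (A + B) δ fun z => f z + f' z := by
  subst hδ
  refine ⟨?_⟩
  have : shiftOp 𝕜 δ' (fun z => f z + f' z) = shiftOp 𝕜 δ' f + shiftOp 𝕜 δ' f' := by
    ext z : 2
    simp [shiftOp, Finsupp.linearCombination_single]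
  rw [LinearMap.comp_add, hA.comp, hB.comp, this, LinearMap.add_comp]

instance add_same [hA : IsMono q A δ f] [hB : IsMono q B δ f'] :
    IsMono q (A + B) δ fun z => f z + f' z := hA.add hB rfl

instance sub_same [hA : IsMono q A δ f] [hB : IsMono q B δ f'] :
    IsMono q (A - B) δ fun z => f z - f' z := by
  have h := hA.add (neg (hA := hB)) rfl
  have e : A + -B = A - B := (sub_eq_add_neg A B).symm
  rw [e] at h
  simpa only [← sub_eq_add_neg] using h

/-- Three-term relations are brought to this subtraction-free shape; the three shifts must agree,
though not syntactically. -/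
lemma ext_add [Fact (0 < q)] [Fact (q ≠ 1)] (hA : IsMono q A δ f) (hB : IsMono q B δ' f')
    (hC : IsMono q C δ'' f'') (h1 : δ = δ') (h2 : δ'' = δ') (hf : ∀ z, f z = f' z + f'' z) :
    A = B + C :=
  hA.ext (hB.add hC h2) h1 hf

end IsMono

end QIntertwiner

end

noncomputable section

namespace QIntertwiner

/-! ### Representations of `U_q(su(2))` and spinor operators -/

section Algebra

variable {F A : Type*} [Field F] [Ring A] [Algebra F A]

/-- The relations of `U_q(su(2))` for `J_+`, `J_-`, `q^{J_z/2}`, `q^{-J_z/2}`, where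
`p = q^{1/4}`. -/
structure IsTriple (p : F) (Jp Jm K Ki : A) : Prop where
  K_Ki : K * Ki = 1
  Ki_K : Ki * K = 1
  K_Jp : K * Jp = p ^ 2 • (Jp * K)
  K_Jm : K * Jm = (p⁻¹) ^ 2 • (Jm * K)
  Ki_Jp : Ki * Jp = (p⁻¹) ^ 2 • (Jp * Ki)
  Ki_Jm : Ki * Jm = p ^ 2 • (Jm * Ki)
  bracket : Jp * Jm = Jm * Jp + (p ^ 2 - (p⁻¹) ^ 2)⁻¹ • (K * K - Ki * Ki)

/-- The pair `(t_+, t_-)` is a spinor operator for `U_q(su(2))`. -/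
structure IsSpinor (p : F) (Jp Jm K Ki tp tm : A) : Prop where
  K_tp : K * tp = p • (tp * K)
  K_tm : K * tm = p⁻¹ • (tm * K)
  Ki_tp : Ki * tp = p⁻¹ • (tp * Ki)
  Ki_tm : Ki * tm = p • (tm * Ki)
  Jp_tp : Jp * tp = p⁻¹ • (tp * Jp)
  Jm_tm : Jm * tm = p • (tm * Jm)
  Jp_tm : Jp * tm = tp * K + p • (tm * Jp)
  Jm_tp : Jm * tp = tm * K + p⁻¹ • (tp * Jm)

/-- The generators of a `U_q(su(2))` commute with `a`. -/
structure CommuteAll (Jp Jm K Ki a : A) : Prop where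
  Jp : Jp * a = a * Jp
  Jm : Jm * a = a * Jm
  K : K * a = a * K
  Ki : Ki * a = a * Ki

variable {p : F} {Jp Jm K Ki Jp' Jm' K' Ki' tp tm sp sm a : A}

lemma mul_mul_of_mul_eq {a b c : A} (h : a * b = c) (x : A) : a * (b * x) = c * x := by
  rw [← h, mul_assoc]

/-- As `simp` rules these move K^{±1} to the right of J_±, and J_+ to the right of J_-. Each comes
also with a trailing factor, to apply inside right-associated products; after normal ordering only
scalars have to be compared. -/
lemma IsTriple.rules (h : IsTriple p Jp Jm K Ki) :
    (K * Ki = 1 ∧ Ki * K = 1 ∧ K * Jp = p ^ 2 • (Jp * K) ∧ K * Jm = (p⁻¹) ^ 2 • (Jm * K) ∧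
      Ki * Jp = (p⁻¹) ^ 2 • (Jp * Ki) ∧ Ki * Jm = p ^ 2 • (Jm * Ki) ∧
      Jp * Jm = Jm * Jp + (p ^ 2 - (p⁻¹) ^ 2)⁻¹ • (K * K - Ki * Ki)) ∧
    ∀ x : A, K * (Ki * x) = 1 * x ∧ Ki * (K * x) = 1 * x ∧
      K * (Jp * x) = (p ^ 2 • (Jp * K)) * x ∧ K * (Jm * x) = ((p⁻¹) ^ 2 • (Jm * K)) * x ∧
      Ki * (Jp * x) = ((p⁻¹) ^ 2 • (Jp * Ki)) * x ∧ Ki * (Jm * x) = (p ^ 2 • (Jm * Ki)) * x ∧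
      Jp * (Jm * x) = (Jm * Jp + (p ^ 2 - (p⁻¹) ^ 2)⁻¹ • (K * K - Ki * Ki)) * x :=
  ⟨⟨h.1, h.2, h.3, h.4, h.5, h.6, h.7⟩, fun x => ⟨mul_mul_of_mul_eq h.1 x,
    mul_mul_of_mul_eq h.2 x, mul_mul_of_mul_eq h.3 x, mul_mul_of_mul_eq h.4 x,
    mul_mul_of_mul_eq h.5 x, mul_mul_of_mul_eq h.6 x, mul_mul_of_mul_eq h.7 x⟩⟩

lemma IsSpinor.rules (h : IsSpinor p Jp Jm K Ki tp tm) :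
    (K * tp = p • (tp * K) ∧ K * tm = p⁻¹ • (tm * K) ∧ Ki * tp = p⁻¹ • (tp * Ki) ∧
      Ki * tm = p • (tm * Ki) ∧ Jp * tp = p⁻¹ • (tp * Jp) ∧ Jm * tm = p • (tm * Jm) ∧
      Jp * tm = tp * K + p • (tm * Jp) ∧ Jm * tp = tm * K + p⁻¹ • (tp * Jm)) ∧
    ∀ x : A, K * (tp * x) = (p • (tp * K)) * x ∧ K * (tm * x) = (p⁻¹ • (tm * K)) * x ∧
      Ki * (tp * x) = (p⁻¹ • (tp * Ki)) * x ∧ Ki * (tm * x) = (p • (tm * Ki)) * x ∧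
      Jp * (tp * x) = (p⁻¹ • (tp * Jp)) * x ∧ Jm * (tm * x) = (p • (tm * Jm)) * x ∧
      Jp * (tm * x) = (tp * K + p • (tm * Jp)) * x ∧
      Jm * (tp * x) = (tm * K + p⁻¹ • (tp * Jm)) * x :=
  ⟨⟨h.1, h.2, h.3, h.4, h.5, h.6, h.7, h.8⟩, fun x => ⟨mul_mul_of_mul_eq h.1 x,
    mul_mul_of_mul_eq h.2 x, mul_mul_of_mul_eq h.3 x, mul_mul_of_mul_eq h.4 x,
    mul_mul_of_mul_eq h.5 x, mul_mul_of_mul_eq h.6 x, mul_mul_of_mul_eq h.7 x,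
    mul_mul_of_mul_eq h.8 x⟩⟩

lemma CommuteAll.rules (h : CommuteAll Jp Jm K Ki a) :
    (Jp * a = a * Jp ∧ Jm * a = a * Jm ∧ K * a = a * K ∧ Ki * a = a * Ki) ∧
    ∀ x : A, Jp * (a * x) = a * Jp * x ∧ Jm * (a * x) = a * Jm * x ∧ K * (a * x) = a * K * x ∧
      Ki * (a * x) = a * Ki * x :=
  ⟨⟨h.1, h.2, h.3, h.4⟩, fun x => ⟨mul_mul_of_mul_eq h.1 x,
    mul_mul_of_mul_eq h.2 x, mul_mul_of_mul_eq h.3 x, mul_mul_of_mul_eq h.4 x⟩⟩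

/-- In the bracket the mixed terms cancel, since K⁻¹J_+ and K'J'_- reorder with the same factor p⁻²,
and the others telescope: (K² - K⁻²)K'² + K⁻²(K'² - K'⁻²) = K²K'² - K⁻²K'⁻². -/
lemma IsTriple.coproduct (hp : p ≠ 0) (h : IsTriple p Jp Jm K Ki) (h' : IsTriple p Jp' Jm' K' Ki')
    (cp : CommuteAll Jp' Jm' K' Ki' Jp) (cm : CommuteAll Jp' Jm' K' Ki' Jm)
    (cK : CommuteAll Jp' Jm' K' Ki' K) (cKi : CommuteAll Jp' Jm' K' Ki' Ki) :
    IsTriple p (Jp * K' + Ki * Jp') (Jm * K' + Ki * Jm') (K * K') (Ki * Ki') := by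
  constructor
  all_goals
    simp only [mul_add, add_mul, mul_sub, sub_mul, mul_assoc, smul_mul_assoc, mul_smul_comm,
      smul_add, smul_sub, mul_one, one_mul, h.rules, h'.rules, cp.rules, cm.rules, cK.rules,
      cKi.rules]
    try match_scalars <;> field_simp <;> try ring

/-- A spinor operator for the first factor is one for the coproduct. -/
lemma IsSpinor.extend_right (h : IsSpinor p Jp Jm K Ki tp tm)
    (cp : CommuteAll Jp' Jm' K' Ki' tp) (cm : CommuteAll Jp' Jm' K' Ki' tm) :
    IsSpinor p (Jp * K' + Ki * Jp') (Jm * K' + Ki * Jm') (K * K') (Ki * Ki') tp tm := by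
  constructor
  all_goals
    simp only [mul_add, add_mul, mul_assoc, smul_mul_assoc, mul_smul_comm,
      smul_add, h.rules, cp.rules, cm.rules]
    try module

/-- A spinor operator for the second factor, braided with the first one, is a spinor operator
for the coproduct. -/
lemma IsSpinor.braided_left (hp : p ≠ 0) (hp4 : p ^ 4 ≠ 1)
    (h : IsTriple p Jp Jm K Ki) (ht : IsSpinor p Jp' Jm' K' Ki' tp tm)
    (hK' : K' * Ki' = 1 ∧ Ki' * K' = 1)
    (cp : CommuteAll Jp Jm K Ki tp) (cm : CommuteAll Jp Jm K Ki tm)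
    (cm' : CommuteAll Jp' Jm' K' Ki' Jm)
    (cK : CommuteAll Jp' Jm' K' Ki' K) (cKi : CommuteAll Jp' Jm' K' Ki' Ki) :
    IsSpinor p (Jp * K' + Ki * Jp') (Jm * K' + Ki * Jm') (K * K') (Ki * Ki')
      (tp * K) (tm * Ki + (p - (p⁻¹) ^ 3) • (tp * Jm)) := by
  -- Since p - p⁻³ = p⁻¹(p² - p⁻²), the coefficient cancels the denominator of [J_+, J_-]; this is
  -- where p⁴ ≠ 1 enters.
  have hp4' : p ^ 4 - 1 ≠ 0 := sub_ne_zero.mpr hp4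
  have hKx : ∀ x, K' * (Ki' * x) = 1 * x := mul_mul_of_mul_eq hK'.1
  have hKy : ∀ x, Ki' * (K' * x) = 1 * x := mul_mul_of_mul_eq hK'.2
  constructor
  all_goals
    simp only [mul_add, add_mul, mul_sub, sub_mul, mul_assoc, smul_mul_assoc, mul_smul_comm,
      smul_add, smul_sub, mul_one, one_mul, h.rules, ht.rules, cp.rules, cm.rules,
      cm'.rules, cK.rules, cKi.rules, hK', hKx, hKy]
    try match_scalars <;> field_simp <;> try ring

/-- The scalar product of two spinor operators is invariant. -/
lemma IsSpinor.dot_commute (hp : p ≠ 0) (h : IsSpinor p Jp Jm K Ki tp tm)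
    (h' : IsSpinor p Jp Jm K Ki sp sm) :
    CommuteAll Jp Jm K Ki (p • (tp * sm) - p⁻¹ • (tm * sp)) := by
  constructor
  all_goals
    simp only [mul_add, add_mul, mul_sub, sub_mul, mul_assoc, smul_mul_assoc, mul_smul_comm,
      smul_add, smul_sub, h.rules, h'.rules]
    match_scalars <;> field_simp <;> try ring

/-- The `q`-Serre relation for a sum of `q`-commuting terms. -/
lemma serre_add (hp : p ≠ 0) {u v u' v' : A}
    (hu : u * (u * u') - (p ^ 2 + (p⁻¹) ^ 2) • (u * (u' * u)) + u' * (u * u) = 0)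
    (hv : v * (v * v') - (p ^ 2 + (p⁻¹) ^ 2) • (v * (v' * v)) + v' * (v * v) = 0)
    (huv : u * v = p ^ 4 • (v * u)) (huv' : u * v' = (p⁻¹) ^ 2 • (v' * u))
    (hu'v : u' * v = (p⁻¹) ^ 2 • (v * u')) :
    (u + v) ^ 2 * (u' + v') - (p ^ 2 + (p⁻¹) ^ 2) • ((u + v) * (u' + v') * (u + v)) +
      (u' + v') * (u + v) ^ 2 = 0 := by
  have h1 := mul_mul_of_mul_eq huv
  have h2 := mul_mul_of_mul_eq huv'
  have h3 := mul_mul_of_mul_eq hu'v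
  have hu' : u * (u * u') = (p ^ 2 + (p⁻¹) ^ 2) • (u * (u' * u)) - u' * (u * u) := by
    rw [← sub_eq_zero, ← hu]; abel
  have hv' : v * (v * v') = (p ^ 2 + (p⁻¹) ^ 2) • (v * (v' * v)) - v' * (v * v) := by
    rw [← sub_eq_zero, ← hv]; abel
  -- The pure parts in u, u' and in v, v' are the hypotheses. The mixed terms cancel by
  -- q-commutation alone, for instance because p⁻⁴ - (p² + p⁻²)p⁻² + 1 = 0.
  simp only [pow_two (u + v), mul_add, add_mul, mul_assoc, smul_mul_assoc, mul_smul_comm, smul_add,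
    smul_sub, mul_sub, sub_mul, huv, huv', hu'v, h1, h2, h3, hu', hv']
  match_scalars <;> field_simp <;> ring

end Algebra

end QIntertwiner

end

noncomputable section

namespace QIntertwiner

variable {𝕜 : Type*} [RCLike 𝕜] {N : ℕ} {q : ℝ}

/-! ### The operators on one leg -/

/-- `q^{1/4}` as a scalar. -/
def quarter (𝕜 : Type*) [RCLike 𝕜] (q : ℝ) : 𝕜 := ((q ^ (1 / 4 : ℝ) : ℝ) : 𝕜)

/-- `q^{J_z/2}` on the leg `i`. -/
def legK (q : ℝ) (i : Fin N) : Op 𝕜 N := qPow q fun n => jz i n / 2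

/-- `q^{-J_z/2}` on the leg `i`. -/
def legKi (q : ℝ) (i : Fin N) : Op 𝕜 N := qPow q fun n => -jz i n / 2

/-- The inverse of the denominator of the `q`-numbers. -/
def qDen (q : ℝ) : ℝ := (q ^ (1 / 2 : ℝ) - q ^ (-1 / 2 : ℝ))⁻¹

instance (i : Fin N) : IsMono q (legK q i : Op 𝕜 N) 0
    fun z => q ^ ((z (i, true) - z (i, false)) / 2 / 2) :=
  inferInstanceAs (IsMono q (qPow q fun n => jz i n / 2) _ _)

instance (i : Fin N) : IsMono q (legKi q i : Op 𝕜 N) 0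
    fun z => q ^ (-((z (i, true) - z (i, false)) / 2) / 2) :=
  inferInstanceAs (IsMono q (qPow q fun n => -jz i n / 2) _ _)

/-- Collects a scalar in p into the cast of one real number, the form in which `IsMono.smul`
applies. -/
lemma quarter_casts : (∀ q : ℝ, quarter 𝕜 q = ((q ^ (1 / 4 : ℝ) : ℝ) : 𝕜)) ∧
    (∀ (x : ℝ) (n : ℕ), (x : 𝕜) ^ n = ((x ^ n : ℝ) : 𝕜)) ∧
    (∀ x : ℝ, (x : 𝕜)⁻¹ = ((x⁻¹ : ℝ) : 𝕜)) ∧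
    (∀ x y : ℝ, (x : 𝕜) - (y : 𝕜) = ((x - y : ℝ) : 𝕜)) ∧
    (∀ x y : ℝ, (x : 𝕜) * (y : 𝕜) = ((x * y : ℝ) : 𝕜)) :=
  ⟨fun _ => rfl, fun x n => by simp, fun x => by simp, fun x y => by simp, fun x y => by simp⟩

section
variable [hq : Fact (0 < q)] [hq1 : Fact (q ≠ 1)]

lemma rpow_eq_exp (q : ℝ) [hq : Fact (0 < q)] (x : ℝ) : q ^ x = Real.exp (Real.log q * x) :=
  Real.rpow_def_of_pos hq.out x

lemma qNum_eq_exp (q : ℝ) [hq : Fact (0 < q)] (x : ℝ) : qNum q x =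
    (Real.exp (Real.log q * (x / 2)) - Real.exp (Real.log q * (-x / 2))) * qDen q := by
  rw [qNum, rpow_eq_exp, rpow_eq_exp, qDen, div_eq_mul_inv]

/-- Rules that collect the exponentials in a product. -/
lemma exp_rules : (∀ a b c : ℝ, a * b * c = a * (b * c)) ∧
    (∀ a b : ℝ, Real.exp a * Real.exp b = Real.exp (a + b)) ∧
    (∀ a b x : ℝ, Real.exp a * (Real.exp b * x) = Real.exp (a + b) * x) ∧
    (∀ q x y : ℝ, qNum q x * Real.exp y = Real.exp y * qNum q x) ∧
    (∀ q x y w : ℝ, qNum q x * (Real.exp y * w) = Real.exp y * (qNum q x * w)) ∧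
    (∀ q y : ℝ, qDen q * Real.exp y = Real.exp y * qDen q) ∧
    (∀ q y w : ℝ, qDen q * (Real.exp y * w) = Real.exp y * (qDen q * w)) ∧
    (∀ q y : ℝ, qDen q ^ 2 * Real.exp y = Real.exp y * qDen q ^ 2) ∧
    (∀ q y w : ℝ, qDen q ^ 2 * (Real.exp y * w) = Real.exp y * (qDen q ^ 2 * w)) ∧
    (∀ (a : ℝ) (n : ℕ), Real.exp a ^ n = Real.exp (n * a)) ∧
    (∀ a : ℝ, (Real.exp a)⁻¹ = Real.exp (-a)) := by
  refine ⟨fun a b c => mul_assoc a b c, fun a b => (Real.exp_add a b).symm, fun a b x => ?_,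
    fun _ _ _ => mul_comm _ _, fun _ _ _ _ => mul_left_comm _ _ _, fun _ _ => mul_comm _ _,
    fun _ _ _ => mul_left_comm _ _ _, fun _ _ => mul_comm _ _, fun _ _ _ => mul_left_comm _ _ _,
    fun a n => (Real.exp_nat_mul a n).symm, fun a => (Real.exp_neg a).symm⟩
  rw [Real.exp_add, mul_assoc]

instance (i : Fin N) : IsMono q (legJp q i : Op 𝕜 N)
    (Pi.single (i, true) 1 - Pi.single (i, false) 1) fun z => qNum q (z (i, false)) :=
  (inferInstance : IsMono q (aDag q i * bOp q i : Op 𝕜 N) _ _).congr (by abel)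
    fun z => by simp
instance (i : Fin N) : IsMono q (legJm q i : Op 𝕜 N)
    (Pi.single (i, false) 1 - Pi.single (i, true) 1) fun z => qNum q (z (i, true)) :=
  (inferInstance : IsMono q (bDag q i * aOp q i : Op 𝕜 N) _ _).congr (by abel)
    fun z => by simp
instance (i : Fin N) : IsMono q (spinorT q i true : Op 𝕜 N) (Pi.single (i, true) 1)
    fun z => q ^ (z (i, true) / 4) :=
  (inferInstance : IsMono q (aDag q i * qPow q (fun n => nA i n / 4) : Op 𝕜 N) _ _).congr
    (by abel) fun z => by simp
instance (i : Fin N) : IsMono q (spinorT q i false : Op 𝕜 N) (Pi.single (i, false) 1)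
    fun z => q ^ ((2 * z (i, true) + z (i, false)) / 4) :=
  (inferInstance : IsMono q (bDag q i * qPow q (fun n => (2 * nA i n + nB i n) / 4) : Op 𝕜 N)
    _ _).congr (by abel) fun z => by simp
instance (i : Fin N) : IsMono q (spinorTt q i true : Op 𝕜 N) (-Pi.single (i, false) 1)
    fun z => q ^ ((2 * z (i, true) + z (i, false)) / 4) * qNum q (z (i, false)) :=
  (inferInstance : IsMono q (qPow q (fun n => (2 * nA i n + nB i n + 1) / 4) * bOp q i : Op 𝕜 N)
    _ _).congr (by abel) fun z => by simp; ring_nf; simp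
instance (i : Fin N) : IsMono q (spinorTt q i false : Op 𝕜 N) (-Pi.single (i, true) 1)
    fun z => -(q ^ ((z (i, true) - 2) / 4) * qNum q (z (i, true))) :=
  (inferInstance : IsMono q (-(qPow q (fun n => (nA i n - 1) / 4) * aOp q i) : Op 𝕜 N)
    _ _).congr (by abel) fun z => by simp; ring_nf; simp

lemma qDen_eq_quarter :
    (quarter 𝕜 q ^ 2 - (quarter 𝕜 q)⁻¹ ^ 2)⁻¹ = ((qDen q : ℝ) : 𝕜) := by
  simp only [quarter_casts, qDen, rpow_eq_exp, exp_rules]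
  push_cast
  ring_nf

lemma qSub_ne_zero : q ^ (1 / 2 : ℝ) - (q ^ (1 / 2 : ℝ))⁻¹ ≠ 0 := by
  intro h
  have h1 := qNum_pos hq.out hq1.out one_pos
  rw [qNum, neg_div, Real.rpow_neg hq.out.le, h, div_zero] at h1
  exact lt_irrefl 0 h1

lemma sq_sub_one_ne_zero : (q ^ (1 / 2 : ℝ)) ^ 2 - 1 ≠ 0 := by
  intro h
  apply qSub_ne_zero (q := q)
  have hs : q ^ (1 / 2 : ℝ) ≠ 0 := (Real.rpow_pos_of_pos hq.out _).ne'
  field_simp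
  simpa using h

/-- This recursion and the next are the oscillator relations α α† = q^{±1/2} α† α + q^{∓N/2} read on
a state. The second is the first at -x - 1, as the q-number is odd. -/
lemma qNum_add_one (x : ℝ) :
    qNum q (x + 1) = Real.exp (Real.log q * (1 / 2)) * qNum q x + Real.exp (Real.log q * (-x / 2)) := by
  have hq0 := hq.out
  have h1 := sq_sub_one_ne_zero (q := q)
  have hs : q ^ (1 / 2 : ℝ) ≠ 0 := (Real.rpow_pos_of_pos hq0 _).ne'
  have hx : q ^ (x / 2 : ℝ) ≠ 0 := (Real.rpow_pos_of_pos hq0 _).ne'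
  simp only [← rpow_eq_exp, qNum, neg_div, Real.rpow_neg hq0.le, add_div, Real.rpow_add hq0]
  rw [← sub_eq_zero]
  field_simp
  ring

lemma qNum_add_one' (x : ℝ) :
    qNum q (x + 1) = Real.exp (Real.log q * (-1 / 2)) * qNum q x + Real.exp (Real.log q * (x / 2)) := by
  have h := qNum_add_one (q := q) (-x - 1)
  have h0 : ∀ y, qNum q (-y) = -qNum q y := fun y => by
    rw [qNum, qNum, neg_neg, ← neg_div, neg_sub]
  rw [sub_add_cancel, ← neg_add', h0, h0, neg_eq_iff_eq_neg] at h
  have e1 : Real.exp (Real.log q * (-1 / 2)) * Real.exp (Real.log q * (1 / 2)) = 1 := by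
    rw [← Real.exp_add, ← Real.exp_zero]; ring_nf
  have e2 : Real.exp (Real.log q * (-1 / 2)) * Real.exp (Real.log q * (- -(x + 1) / 2)) =
      Real.exp (Real.log q * (x / 2)) := by
    rw [← Real.exp_add]; ring_nf
  linear_combination -Real.exp (Real.log q * (-1 / 2)) * h + (-qNum q (x + 1)) * e1 + e2

/-- The two orders of a Jordan–Schwinger pair have coefficients [x][y+1] and [y][x+1]; this is their
bracket. -/
lemma qNum_mul_sub (x y : ℝ) :
    qNum q x * qNum q (y + 1) - qNum q y * qNum q (x + 1) = qNum q (x - y) := by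
  have hq0 := hq.out
  have h1 := sq_sub_one_ne_zero (q := q)
  have hs : q ^ (1 / 2 : ℝ) ≠ 0 := (Real.rpow_pos_of_pos hq0 _).ne'
  have hx : q ^ (x / 2 : ℝ) ≠ 0 := (Real.rpow_pos_of_pos hq0 _).ne'
  have hy : q ^ (y / 2 : ℝ) ≠ 0 := (Real.rpow_pos_of_pos hq0 _).ne'
  simp only [qNum, neg_div, Real.rpow_neg hq0.le, add_div, sub_div, Real.rpow_add hq0,
    Real.rpow_sub hq0]
  field_simp
  ring

lemma isTriple_leg (i : Fin N) :
    IsTriple (quarter 𝕜 q) (legJp q i : Op 𝕜 N) (legJm q i) (legK q i) (legKi q i) := by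
  constructor
  case bracket =>
    rw [qDen_eq_quarter]
    refine IsMono.ext_add (q := q) inferInstance inferInstance inferInstance (by abel) (by abel)
      fun z => ?_
    have h := qNum_mul_sub (q := q) (z (i, true)) (z (i, false))
    rw [qNum_eq_exp q (_ - _)] at h
    simp only [← sub_eq_iff_eq_add']
    simp
    simp only [rpow_eq_exp, exp_rules]
    ring_nf at h ⊢
    linear_combination h
  all_goals
    try simp only [quarter_casts]
    refine IsMono.ext (q := q) inferInstance inferInstance (by abel) fun z => ?_
    simp
    simp only [rpow_eq_exp]
    ring_nf
    simp only [exp_rules]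
    ring_nf
    try simp

/-- Only the two inhomogeneous relations need an identity of q-numbers, the recursion for [x + 1];
the others compare exponents. -/
lemma isSpinor_spinorT (i : Fin N) : IsSpinor (quarter 𝕜 q) (legJp q i : Op 𝕜 N) (legJm q i)
    (legK q i) (legKi q i) (spinorT q i true) (spinorT q i false) := by
  constructor
  case Jp_tm =>
    simp only [quarter_casts]
    refine IsMono.ext_add (q := q) inferInstance inferInstance inferInstance (by abel) (by abel)
      fun z => ?_
    simp
    simp only [rpow_eq_exp, qNum_add_one]
    ring_nf
    simp only [exp_rules]
    ring_nf
  case Jm_tp =>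
    simp only [quarter_casts]
    refine IsMono.ext_add (q := q) inferInstance inferInstance inferInstance (by abel) (by abel)
      fun z => ?_
    simp
    simp only [rpow_eq_exp, qNum_add_one']
    ring_nf
    simp only [exp_rules]
    ring_nf
  all_goals
    simp only [quarter_casts]
    refine IsMono.ext (q := q) inferInstance inferInstance (by abel) fun z => ?_
    simp
    simp only [rpow_eq_exp]
    ring_nf
    simp only [exp_rules]
    ring_nf

lemma isSpinor_spinorTt (i : Fin N) : IsSpinor (quarter 𝕜 q) (legJp q i : Op 𝕜 N) (legJm q i)
    (legK q i) (legKi q i) (spinorTt q i true) (spinorTt q i false) := by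
  constructor
  case Jp_tm =>
    simp only [quarter_casts]
    refine IsMono.ext_add (q := q) inferInstance inferInstance inferInstance (by abel) (by abel)
      fun z => ?_
    simp
    simp only [rpow_eq_exp, qNum_add_one']
    ring_nf
    simp only [exp_rules]
    ring_nf
  case Jm_tp =>
    simp only [quarter_casts]
    refine IsMono.ext_add (q := q) inferInstance inferInstance inferInstance (by abel) (by abel)
      fun z => ?_
    simp
    simp only [rpow_eq_exp, qNum_add_one]
    ring_nf
    simp only [exp_rules]
    ring_nf
  all_goals
    simp only [quarter_casts]
    refine IsMono.ext (q := q) inferInstance inferInstance (by abel) fun z => ?_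
    simp
    simp only [rpow_eq_exp]
    ring_nf
    simp only [exp_rules]
    ring_nf

end
end QIntertwiner

end

noncomputable section

namespace QIntertwiner

variable {𝕜 : Type*} [RCLike 𝕜] {N : ℕ} {q : ℝ}

/-! ### Operators on sets of legs -/

lemma ofBasis_single (f : Occ N → Fock 𝕜 N) (n : Occ N) (c : 𝕜) :
    ofBasis f (Finsupp.single n c) = c • f n := by
  simp [ofBasis, Finsupp.linearCombination_single]

lemma diag_single (g : Occ N → ℝ) (n : Occ N) (c : 𝕜) :
    (diag g : Op 𝕜 N) (Finsupp.single n c) = Finsupp.single n (c * ((g n : ℝ) : 𝕜)) := by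
  simp [diag, ofBasis_single]

lemma diag_mul_diag (g h : Occ N → ℝ) :
    (diag g * diag h : Op 𝕜 N) = diag fun n => g n * h n := by
  ext n : 2
  simp [diag_single, mul_comm]

lemma qPow_mul_qPow (hq : 0 < q) (g h : Occ N → ℝ) :
    (qPow q g * qPow q h : Op 𝕜 N) = qPow q fun n => g n + h n := by
  simp only [qPow, diag_mul_diag, Real.rpow_add hq]

lemma qPow_zero : (qPow q (fun _ => 0) : Op 𝕜 N) = 1 := by
  ext n : 2
  simp [qPow, diag_single]

/-- The operators that act on the legs in `S`. -/
def localOps (𝕜 : Type*) [RCLike 𝕜] {N : ℕ} (q : ℝ) (S : Set (Fin N)) :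
    Subalgebra 𝕜 (Op 𝕜 N) :=
  Algebra.adjoin 𝕜 {A | ∃ δ f, IsMono q A δ f ∧ (∀ μ : Fin N × Bool, μ.1 ∉ S → δ μ = 0) ∧
    ∀ z z' : Fin N × Bool → ℝ, (∀ μ, μ.1 ∈ S → z μ = z' μ) → f z = f z'}

lemma localOps_mono {S T : Set (Fin N)} (h : S ⊆ T) : localOps 𝕜 q S ≤ localOps 𝕜 q T :=
  Algebra.adjoin_mono fun _ ⟨δ, f, hA, h1, h2⟩ =>
    ⟨δ, f, hA, fun μ hμ => h1 μ fun h' => hμ (h h'), fun z z' hz => h2 z z' fun μ hμ => hz μ (h hμ)⟩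

lemma IsMono.mem_localOps {A : Op 𝕜 N} {δ f} (hA : IsMono q A δ f) (S : Set (Fin N))
    (h1 : ∀ μ : Fin N × Bool, μ.1 ∉ S → δ μ = 0)
    (h2 : ∀ z z' : Fin N × Bool → ℝ, (∀ μ, μ.1 ∈ S → z μ = z' μ) → f z = f z') :
    A ∈ localOps 𝕜 q S :=
  Algebra.subset_adjoin ⟨δ, f, hA, h1, h2⟩

section
variable [hq : Fact (0 < q)] [hq1 : Fact (q ≠ 1)]

/-- For monomials, a shift supported in one set of legs does not change a coefficient that depends
on the other; commutation passes to the generated algebras. -/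
lemma localOps_commute {S T : Set (Fin N)} (hST : Disjoint S T) {A B : Op 𝕜 N}
    (hA : A ∈ localOps 𝕜 q S) (hB : B ∈ localOps 𝕜 q T) : A * B = B * A := by
  have key : Commute A B := by
    refine Algebra.commute_of_mem_adjoin_of_forall_mem_commute hB ?_
    rintro B ⟨δ', f', hB, h1', h2'⟩
    refine (Algebra.commute_of_mem_adjoin_of_forall_mem_commute hA ?_).symm
    rintro A ⟨δ, f, hA, h1, h2⟩
    refine IsMono.ext (hB.mul (hB := hA)) (hA.mul (hB := hB)) (add_comm _ _) fun z => ?_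
    rw [h2' (z + δ) z, h2 (z + δ') z, mul_comm]
    · intro μ hμ
      simp [h1' μ (hST.notMem_of_mem_left hμ)]
    · intro μ hμ
      simp [h1 μ (hST.notMem_of_mem_right hμ)]
  exact key

lemma legJp_mem (i : Fin N) : (legJp q i : Op 𝕜 N) ∈ localOps 𝕜 q {i} := by
  refine IsMono.mem_localOps (q := q) inferInstance _ (fun μ hμ => ?_) fun z z' h => ?_
  · rw [Set.mem_singleton_iff] at hμ
    simp [Pi.single_apply, Prod.ext_iff, hμ]
  · simp only [h (i, true) rfl, h (i, false) rfl]

lemma legJm_mem (i : Fin N) : (legJm q i : Op 𝕜 N) ∈ localOps 𝕜 q {i} := by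
  refine IsMono.mem_localOps (q := q) inferInstance _ (fun μ hμ => ?_) fun z z' h => ?_
  · rw [Set.mem_singleton_iff] at hμ
    simp [Pi.single_apply, Prod.ext_iff, hμ]
  · simp only [h (i, true) rfl, h (i, false) rfl]

lemma legK_mem (i : Fin N) : (legK q i : Op 𝕜 N) ∈ localOps 𝕜 q {i} := by
  refine IsMono.mem_localOps (q := q) inferInstance _ (fun μ hμ => ?_) fun z z' h => ?_
  · rw [Set.mem_singleton_iff] at hμ
    simp [Pi.single_apply, Prod.ext_iff, hμ]
  · simp only [h (i, true) rfl, h (i, false) rfl]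

lemma legKi_mem (i : Fin N) : (legKi q i : Op 𝕜 N) ∈ localOps 𝕜 q {i} := by
  refine IsMono.mem_localOps (q := q) inferInstance _ (fun μ hμ => ?_) fun z z' h => ?_
  · rw [Set.mem_singleton_iff] at hμ
    simp [Pi.single_apply, Prod.ext_iff, hμ]
  · simp only [h (i, true) rfl, h (i, false) rfl]

lemma spinorT_mem (i : Fin N) (m : Bool) : (spinorT q i m : Op 𝕜 N) ∈ localOps 𝕜 q {i} := by
  cases m
  all_goals
    refine IsMono.mem_localOps (q := q) inferInstance _ (fun μ hμ => ?_) fun z z' h => ?_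
    · rw [Set.mem_singleton_iff] at hμ
      simp [Pi.single_apply, Prod.ext_iff, hμ]
    · simp only [h (i, true) rfl, h (i, false) rfl]

lemma spinorTt_mem (i : Fin N) (m : Bool) : (spinorTt q i m : Op 𝕜 N) ∈ localOps 𝕜 q {i} := by
  cases m
  all_goals
    refine IsMono.mem_localOps (q := q) inferInstance _ (fun μ hμ => ?_) fun z z' h => ?_
    · rw [Set.mem_singleton_iff] at hμ
      simp [Pi.single_apply, Prod.ext_iff, hμ]
    · simp only [h (i, true) rfl, h (i, false) rfl]

/-- `q^{J_z/2}` on the legs in `S`. -/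
def segK (q : ℝ) (S : Finset (Fin N)) : Op 𝕜 N := qPow q fun n => (∑ k ∈ S, jz k n) / 2

/-- `q^{-J_z/2}` on the legs in `S`. -/
def segKi (q : ℝ) (S : Finset (Fin N)) : Op 𝕜 N := qPow q fun n => -(∑ k ∈ S, jz k n) / 2

/-- The operators `J` of the single legs, added up over the legs in `S` through the coproduct. -/
def segJ (q : ℝ) (J : Fin N → Op 𝕜 N) (S : Finset (Fin N)) : Op 𝕜 N :=
  ∑ l ∈ S, segKi q (S.filter (· < l)) * J l * segK q (S.filter (l < ·))

lemma segK_mem (S : Finset (Fin N)) : (segK q S : Op 𝕜 N) ∈ localOps 𝕜 q S := by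
  refine IsMono.mem_localOps (q := q) (IsMono.qPow _ _ _) _ (fun μ hμ => rfl) fun z z' h => ?_
  rw [Finset.sum_congr rfl fun k hk => by rw [h (k, true) hk, h (k, false) hk]]

lemma segKi_mem (S : Finset (Fin N)) : (segKi q S : Op 𝕜 N) ∈ localOps 𝕜 q S := by
  refine IsMono.mem_localOps (q := q) (IsMono.qPow _ _ _) _ (fun μ hμ => rfl) fun z z' h => ?_
  rw [Finset.sum_congr rfl fun k hk => by rw [h (k, true) hk, h (k, false) hk]]

lemma segJ_mem {J : Fin N → Op 𝕜 N} (hJ : ∀ i, J i ∈ localOps 𝕜 q {i}) (S : Finset (Fin N)) :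
    segJ q J S ∈ localOps 𝕜 q S :=
  Subalgebra.sum_mem _ fun l hl => mul_mem (mul_mem
    (localOps_mono (by exact_mod_cast Finset.filter_subset _ S) (segKi_mem _))
    (localOps_mono (by simpa using hl) (hJ l)))
    (localOps_mono (by exact_mod_cast Finset.filter_subset _ S) (segK_mem _))

lemma segK_union {S T : Finset (Fin N)} (h : Disjoint S T) :
    (segK q (S ∪ T) : Op 𝕜 N) = segK q S * segK q T := by
  simp only [segK, qPow_mul_qPow hq.out, Finset.sum_union h, add_div]

lemma segKi_union {S T : Finset (Fin N)} (h : Disjoint S T) :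
    (segKi q (S ∪ T) : Op 𝕜 N) = segKi q S * segKi q T := by
  simp only [segKi, qPow_mul_qPow hq.out, Finset.sum_union h, neg_add, add_div]

lemma disjoint_of_lt {S T : Finset (Fin N)} (h : ∀ a ∈ S, ∀ b ∈ T, a < b) : Disjoint S T :=
  Finset.disjoint_left.mpr fun a ha hb => lt_irrefl a (h a ha a hb)

/-- Coassociativity, in the form that splits the legs into consecutive blocks. -/
lemma segJ_union (J : Fin N → Op 𝕜 N) {S T : Finset (Fin N)} (h : ∀ a ∈ S, ∀ b ∈ T, a < b) :
    segJ q J (S ∪ T) = segJ q J S * segK q T + segKi q S * segJ q J T := by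
  have hd := disjoint_of_lt h
  simp only [segJ]
  rw [Finset.sum_union hd, Finset.sum_mul, Finset.mul_sum]
  congr 1
  · refine Finset.sum_congr rfl fun l hl => ?_
    rw [Finset.filter_union, Finset.filter_union,
      Finset.filter_false_of_mem (s := T) (p := (· < l)) fun b hb => (h l hl b hb).not_gt,
      Finset.filter_true_of_mem (s := T) (p := (l < ·)) fun b hb => h l hl b hb,
      Finset.union_empty, segK_union (hd.mono_left (Finset.filter_subset _ _))]
    simp only [mul_assoc]
  · refine Finset.sum_congr rfl fun l hl => ?_
    rw [Finset.filter_union, Finset.filter_union,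
      Finset.filter_true_of_mem (s := S) (p := (· < l)) fun b hb => h b hb l hl,
      Finset.filter_false_of_mem (s := S) (p := (l < ·)) fun b hb => (h b hb l hl).not_gt,
      Finset.empty_union, segKi_union (hd.mono_right (Finset.filter_subset _ _))]
    simp only [mul_assoc]

lemma segK_singleton (i : Fin N) : (segK q {i} : Op 𝕜 N) = legK q i := by
  simp [segK, legK]

lemma segKi_singleton (i : Fin N) : (segKi q {i} : Op 𝕜 N) = legKi q i := by
  simp [segKi, legKi]

lemma segK_empty : (segK q ∅ : Op 𝕜 N) = 1 := by
  simpa [segK] using qPow_zero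

lemma segKi_empty : (segKi q ∅ : Op 𝕜 N) = 1 := by
  simpa [segKi] using qPow_zero

lemma segJ_singleton (J : Fin N → Op 𝕜 N) (i : Fin N) : segJ q J {i} = J i := by
  simp [segJ, Finset.filter_singleton, segK_empty, segKi_empty]

/-- The generators on the legs in `S` commute with operators on other legs. -/
lemma commuteAll_seg {S : Finset (Fin N)} {T : Set (Fin N)} (h : Disjoint (S : Set (Fin N)) T)
    {A : Op 𝕜 N} (hA : A ∈ localOps 𝕜 q T) :
    CommuteAll (segJ q (legJp q) S) (segJ q (legJm q) S) (segK q S) (segKi q S) A :=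
  ⟨localOps_commute h (segJ_mem legJp_mem S) hA, localOps_commute h (segJ_mem legJm_mem S) hA,
    localOps_commute h (segK_mem S) hA, localOps_commute h (segKi_mem S) hA⟩

lemma commuteAll_leg {i : Fin N} {T : Set (Fin N)} (h : i ∉ T)
    {A : Op 𝕜 N} (hA : A ∈ localOps 𝕜 q T) :
    CommuteAll (legJp q i) (legJm q i) (legK q i) (legKi q i) A := by
  have := commuteAll_seg (S := {i}) (by simpa using h) hA
  simpa only [segJ_singleton, segK_singleton, segKi_singleton] using this

lemma quarter_ne_zero : quarter 𝕜 q ≠ 0 := by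
  have := (Real.rpow_pos_of_pos hq.out (1 / 4)).ne'
  rw [quarter]
  exact_mod_cast this

lemma quarter_pow_four : quarter 𝕜 q ^ 4 = (q : 𝕜) := by
  rw [quarter, ← RCLike.ofReal_pow, ← Real.rpow_natCast, ← Real.rpow_mul hq.out.le]
  norm_num

lemma quarter_pow_four_ne_one : quarter 𝕜 q ^ 4 ≠ 1 := by
  rw [quarter_pow_four]
  exact_mod_cast hq1.out

/-- The coproduct of the operators on the legs in `S` is a representation of `U_q(su(2))`. -/
lemma isTriple_seg (S : Finset (Fin N)) :
    IsTriple (quarter 𝕜 q) (segJ q (legJp q) S : Op 𝕜 N) (segJ q (legJm q) S) (segK q S)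
      (segKi q S) := by
  induction S using Finset.induction_on_max with
  | empty => constructor <;> simp [segJ, segK_empty, segKi_empty]
  | insert a S ha ih =>
    have hd : ∀ x ∈ S, ∀ b ∈ ({a} : Finset (Fin N)), x < b := by simpa using ha
    rw [Finset.insert_eq, Finset.union_comm, segJ_union _ hd, segJ_union _ hd,
      segK_union (disjoint_of_lt hd), segKi_union (disjoint_of_lt hd), segJ_singleton,
      segJ_singleton, segK_singleton, segKi_singleton]
    have ha' : a ∉ (S : Set (Fin N)) := fun h => lt_irrefl a (ha a h)
    exact ih.coproduct quarter_ne_zero (isTriple_leg a)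
      (commuteAll_leg ha' (segJ_mem legJp_mem S)) (commuteAll_leg ha' (segJ_mem legJm_mem S))
      (commuteAll_leg ha' (segK_mem S)) (commuteAll_leg ha' (segKi_mem S))

lemma totJp_eq : (totJp q : Op 𝕜 N) = segJ q (legJp q) Finset.univ := by
  refine Finset.sum_congr rfl fun l _ => ?_
  rw [show Finset.univ.filter (· < l) = Finset.Iio l by ext; simp,
    show Finset.univ.filter (l < ·) = Finset.Ioi l by ext; simp]
  rfl

lemma totJm_eq : (totJm q : Op 𝕜 N) = segJ q (legJm q) Finset.univ := by
  refine Finset.sum_congr rfl fun l _ => ?_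
  rw [show Finset.univ.filter (· < l) = Finset.Iio l by ext; simp,
    show Finset.univ.filter (l < ·) = Finset.Ioi l by ext; simp]
  rfl

lemma totKinv_eq : (totKinv q : Op 𝕜 N) = segKi q Finset.univ := rfl

end
end QIntertwiner

end

noncomputable section

namespace QIntertwiner

variable {𝕜 : Type*} [RCLike 𝕜] {N : ℕ} {q : ℝ}

/-! ### The `R`-matrix -/

/-- The coefficients of the `R`-matrix. -/
def rCoef (q : ℝ) (r : ℕ) : ℝ := (1 - q⁻¹) ^ r / qFact q r * q ^ ((r : ℝ) * ((r : ℝ) - 1) / 4)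

/-- The partial sums of the `R`-matrix, without its diagonal factor. -/
def rSum (q : ℝ) (m s : Fin N) (M : ℕ) : Op 𝕜 N :=
  ∑ r ∈ Finset.range M, ((rCoef q r : ℝ) : 𝕜) • ((legK q m * legJp q m) ^ r *
    (legKi q s * legJm q s) ^ r)

/-- The diagonal factor of the `R`-matrix. -/
def rDiag (q : ℝ) (m s : Fin N) : Op 𝕜 N := qPow q fun n => jz m n * jz s n

/-- The span of the states with fewer than `d` quanta `b_m`. -/
def levelB (𝕜 : Type*) [RCLike 𝕜] {N : ℕ} (m : Fin N) (d : ℕ) : Submodule 𝕜 (Fock 𝕜 N) :=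
  Finsupp.supported 𝕜 𝕜 {n | n (m, false) < d}

lemma levelB_zero (m : Fin N) {v : Fock 𝕜 N} (hv : v ∈ levelB 𝕜 m 0) : v = 0 := by
  simpa [levelB] using hv

lemma levelB_mono (m : Fin N) {d d' : ℕ} (h : d ≤ d') : levelB 𝕜 m d ≤ levelB 𝕜 m d' :=
  Finsupp.supported_mono fun _ hn => lt_of_lt_of_le hn h

lemma exists_mem_levelB (m : Fin N) (v : Fock 𝕜 N) : ∃ d, v ∈ levelB 𝕜 m d := by
  induction v using Finsupp.induction_linear with
  | zero => exact ⟨0, zero_mem _⟩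
  | add f g hf hg =>
    obtain ⟨d, hd⟩ := hf
    obtain ⟨d', hd'⟩ := hg
    exact ⟨max d d', add_mem (levelB_mono m (le_max_left _ _) hd)
      (levelB_mono m (le_max_right _ _) hd')⟩
  | single n c => exact ⟨n (m, false) + 1, Finsupp.single_mem_supported _ _ (Nat.lt_succ_self _)⟩

lemma levelB_induction {m : Fin N} {d : ℕ} {A : Op 𝕜 N} {P : Submodule 𝕜 (Fock 𝕜 N)}
    (h : ∀ n : Occ N, n (m, false) < d → A (Finsupp.single n 1) ∈ P) {v : Fock 𝕜 N}
    (hv : v ∈ levelB 𝕜 m d) : A v ∈ P := by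
  rw [levelB, Finsupp.supported_eq_span_single] at hv
  induction hv using Submodule.span_induction with
  | mem x hx => obtain ⟨n, hn, rfl⟩ := hx; exact h n hn
  | zero => simp
  | add x y _ _ hx hy => rw [map_add]; exact add_mem hx hy
  | smul c x _ hx => rw [map_smul]; exact P.smul_mem c hx

/-- An operator that is the identity up to a term lowering an exhaustive filtration is
invertible. -/
lemma isUnit_of_sub_mem {V : Type*} [AddCommGroup V] [Module 𝕜 V] (G : ℕ → Submodule 𝕜 V)
    (h0 : ∀ v ∈ G 0, v = 0) (hG : ∀ v, ∃ d, v ∈ G d) (A : Module.End 𝕜 V)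
    (hA : ∀ d, ∀ v ∈ G (d + 1), A v - v ∈ G d) : IsUnit A := by
  rw [Module.End.isUnit_iff]
  constructor
  · rw [injective_iff_map_eq_zero]
    intro v hv
    obtain ⟨d, hd⟩ := hG v
    induction d with
    | zero => exact h0 v hd
    | succ d ih =>
      have := hA d v hd
      rw [hv, zero_sub] at this
      exact ih (neg_mem_iff.mp this)
  · intro v
    obtain ⟨d, hd⟩ := hG v
    induction d generalizing v with
    | zero => exact ⟨0, by rw [h0 v hd, map_zero]⟩
    | succ d ih =>
      -- By induction A v - v = A w, hence v = A (v - w).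
      obtain ⟨w, hw⟩ := ih _ (hA d v hd)
      exact ⟨v - w, by rw [map_sub, hw]; abel⟩

/-- J_+ on the leg m contains `bOp`, which lowers n_b by one and kills n_b = 0; the other leg does
not touch this mode. This makes the sum in R locally finite and its part with r > 0 locally
nilpotent. -/
lemma ladder_single (m s : Fin N) (hms : s ≠ m) (n : Occ N) : ∃ (n' : Occ N) (c : 𝕜),
    ((legK q m * legJp q m) * (legKi q s * legJm q s) : Op 𝕜 N) (Finsupp.single n 1) =
      Finsupp.single n' c ∧ n' (m, false) = n (m, false) - 1 ∧ (n (m, false) = 0 → c = 0) := by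
  simp only [legK, legKi, legJp, legJm, aDag, bDag, aOp, bOp, qPow, create, annihilate,
    Module.End.mul_apply, ofBasis_single, diag_single, Finsupp.smul_single]
  refine ⟨_, _, rfl, ?_, fun h => ?_⟩
  · simp [Function.update_apply, hms.symm]
  · simp [Function.update_apply, hms.symm, h, qNum_zero]

section
variable [hq : Fact (0 < q)] [hq1 : Fact (q ≠ 1)]

lemma ladder_commute {m s : Fin N} (hms : s ≠ m) :
    Commute (legK q m * legJp q m : Op 𝕜 N) (legKi q s * legJm q s) :=
  localOps_commute (q := q) (S := {m}) (T := {s}) (by simpa using hms.symm)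
    (mul_mem (legK_mem m) (legJp_mem m)) (mul_mem (legKi_mem s) (legJm_mem s))

lemma ladder_mem_levelB {m s : Fin N} (hms : s ≠ m) {d : ℕ} {v : Fock 𝕜 N}
    (hv : v ∈ levelB 𝕜 m (d + 1)) :
    ((legK q m * legJp q m) * (legKi q s * legJm q s) : Op 𝕜 N) v ∈ levelB 𝕜 m d := by
  refine levelB_induction (fun n hn => ?_) hv
  obtain ⟨n', c, h1, h2, h3⟩ := ladder_single (𝕜 := 𝕜) (q := q) m s hms n
  rw [h1]
  rcases Nat.eq_zero_or_pos (n (m, false)) with h | h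
  · simp [h3 h]
  · exact Finsupp.single_mem_supported _ _ (by simp only [Set.mem_ofPred_eq]; omega)

lemma ladder_pow_mem_levelB {m s : Fin N} (hms : s ≠ m) (r : ℕ) {d : ℕ} {v : Fock 𝕜 N}
    (hv : v ∈ levelB 𝕜 m (d + r)) :
    ((legK q m * legJp q m) ^ r * (legKi q s * legJm q s) ^ r : Op 𝕜 N) v ∈ levelB 𝕜 m d := by
  rw [← (ladder_commute hms).mul_pow]
  induction r generalizing v with
  | zero => simpa using hv
  | succ r ih =>
    rw [pow_succ, Module.End.mul_apply]
    exact ih (ladder_mem_levelB hms hv)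

lemma ladder_pow_eq_zero {m s : Fin N} (hms : s ≠ m) {r d : ℕ} (h : d ≤ r) {v : Fock 𝕜 N}
    (hv : v ∈ levelB 𝕜 m d) :
    ((legK q m * legJp q m) ^ r * (legKi q s * legJm q s) ^ r : Op 𝕜 N) v = 0 :=
  levelB_zero m (ladder_pow_mem_levelB hms r (levelB_mono m (by omega) hv))

lemma rSum_eq_of_le {m s : Fin N} (hms : s ≠ m) {d M : ℕ} (h : d ≤ M) {v : Fock 𝕜 N}
    (hv : v ∈ levelB 𝕜 m d) : (rSum q m s M : Op 𝕜 N) v = (rSum q m s d : Op 𝕜 N) v := by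
  simp only [rSum, LinearMap.sum_apply, LinearMap.smul_apply]
  refine (Finset.sum_subset (Finset.range_mono h) fun r _ hr => ?_).symm
  rw [ladder_pow_eq_zero hms (by simpa using hr) hv, smul_zero]

/-- On a given vector, the `R`-matrix is given by its partial sums. -/
lemma rMatrix_apply {m s : Fin N} (hms : s ≠ m) {d M : ℕ} (h : d ≤ M) {v : Fock 𝕜 N}
    (hv : v ∈ levelB 𝕜 m d) :
    (rMatrix q m s : Op 𝕜 N) v = (rDiag q m s * rSum q m s M : Op 𝕜 N) v := by
  -- The truncation in `rMatrix` depends on the state, so the comparison is made on basis states, as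
  -- membership of the difference in the zero subspace.
  rw [← sub_eq_zero, ← LinearMap.sub_apply, ← Submodule.mem_bot 𝕜]
  refine levelB_induction (fun n hn => ?_) hv
  rw [Submodule.mem_bot, LinearMap.sub_apply, sub_eq_zero, Module.End.mul_apply,
    rSum_eq_of_le hms (d := n (m, false) + 1) (by omega)
      (Finsupp.single_mem_supported _ _ (Nat.lt_succ_self _)), rMatrix, Module.End.mul_apply,
    ofBasis_single, one_smul, rSum, LinearMap.sum_apply]
  rfl

lemma rCoef_zero : rCoef q 0 = 1 := by simp [rCoef, qFact]

lemma isUnit_qPow (g : Occ N → ℝ) : IsUnit (qPow q g : Op 𝕜 N) := by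
  refine ⟨⟨qPow q g, qPow q fun n => -g n, ?_, ?_⟩, rfl⟩ <;>
  simp [qPow_mul_qPow hq.out, qPow_zero]

/-- Once the invertible diagonal factor is removed, the term r = 0 is the identity and all others
lower n_b on the leg m. -/
lemma isUnit_rMatrix {m s : Fin N} (hms : s ≠ m) : IsUnit (rMatrix q m s : Op 𝕜 N) := by
  obtain ⟨D, hD⟩ : IsUnit (rDiag q m s : Op 𝕜 N) := isUnit_qPow _
  have key : IsUnit ((↑D⁻¹ : Op 𝕜 N) * rMatrix q m s) := by
    refine isUnit_of_sub_mem (levelB 𝕜 m) (fun v => levelB_zero m) (exists_mem_levelB m) _ ?_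
    intro d v hv
    rw [Module.End.mul_apply, rMatrix_apply hms le_rfl hv, ← hD, ← Module.End.mul_apply,
      ← mul_assoc, Units.inv_mul, one_mul, rSum, Finset.sum_range_succ', LinearMap.add_apply,
      LinearMap.sum_apply]
    simp only [rCoef_zero, pow_zero, mul_one, RCLike.ofReal_one, one_smul, Module.End.one_apply,
      add_sub_cancel_right]
    refine Submodule.sum_mem _ fun r _ => Submodule.smul_mem _ _ ?_
    exact levelB_mono m (Nat.sub_le d r) (ladder_pow_mem_levelB hms (r + 1) (levelB_mono m (by omega) hv))
  have := D.isUnit.mul key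
  rwa [← mul_assoc, Units.mul_inv, one_mul] at this

end
end QIntertwiner

end

noncomputable section

namespace QIntertwiner

variable {𝕜 : Type*} [RCLike 𝕜] {N : ℕ} {q : ℝ}

/-! ### Braiding of spinor operators -/

lemma op_mul_mul_of_mul_eq {a b c : Op 𝕜 N} (h : a * b = c) (x : Op 𝕜 N) : a * (b * x) = c * x :=
  mul_mul_of_mul_eq h x

section
variable [hq : Fact (0 < q)] [hq1 : Fact (q ≠ 1)]

lemma qNum_nat_add_one (r : ℕ) : qNum q ((r : ℝ) + 1) =
    Real.exp (Real.log q * (r / 2)) * ∑ i ∈ Finset.range (r + 1), q⁻¹ ^ i := by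
  induction r with
  | zero =>
    have h := qNum_add_one (q := q) 0
    simpa [qNum_zero] using h
  | succ r ih =>
    rw [geom_sum_succ, qNum_add_one', Nat.cast_add_one, ih, mul_add, mul_one, ← mul_assoc,
      ← mul_assoc, ← Real.exp_add]
    congr 2
    have : q⁻¹ = Real.exp (Real.log q * (-1)) := by
      rw [← rpow_eq_exp, Real.rpow_neg_one]
    rw [this, ← Real.exp_add]
    ring_nf

/-- As [r+1] = q^{r/2}(1 + q⁻¹ + … + q^{-r}), the power q^{r(r-1)/4} replaces the symmetric
q-factorial by the one-sided one in q⁻¹: the sum in R is a q-exponential. -/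
lemma rCoef_succ (r : ℕ) :
    rCoef q (r + 1) * ∑ i ∈ Finset.range (r + 1), q⁻¹ ^ i = (1 - q⁻¹) * rCoef q r := by
  have h1 := qFact_pos hq.out hq1.out r
  have h2 := qNum_pos hq.out hq1.out (x := (r : ℝ) + 1) (by positivity)
  have h3 := qNum_nat_add_one (q := q) r
  have h4 : q ^ (((r + 1 : ℕ) : ℝ) * (((r + 1 : ℕ) : ℝ) - 1) / 4) =
      q ^ ((r : ℝ) * ((r : ℝ) - 1) / 4) * Real.exp (Real.log q * (r / 2)) := by
    rw [rpow_eq_exp, rpow_eq_exp, ← Real.exp_add]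
    push_cast
    ring_nf
  rw [rCoef, rCoef, h4, qFact_succ, pow_succ]
  field_simp
  rw [h3]
  ring_nf

lemma rDiag_mem (m s : Fin N) : (rDiag q m s : Op 𝕜 N) ∈ localOps 𝕜 q {m, s} := by
  refine IsMono.mem_localOps (q := q) (IsMono.qPow _ _ _) _ (fun μ hμ => rfl) fun z z' h => ?_
  rw [h (m, true) (by simp), h (m, false) (by simp), h (s, true) (by simp), h (s, false) (by simp)]

lemma rSum_mem (m s : Fin N) (M : ℕ) : (rSum q m s M : Op 𝕜 N) ∈ localOps 𝕜 q {m, s} := by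
  refine Subalgebra.sum_mem _ fun r _ => Subalgebra.smul_mem _ (mul_mem (pow_mem
    (localOps_mono (S := {m}) (by simp) (mul_mem (legK_mem m) (legJp_mem m))) r) (pow_mem
    (localOps_mono (S := {s}) (by simp) (mul_mem (legKi_mem s) (legJm_mem s))) r)) _

/-- An identity for all large partial sums gives an identity for the `R`-matrix. -/
lemma rMatrix_mul_eq {m s : Fin N} (hms : s ≠ m) {A B C : Op 𝕜 N}
    (h : ∀ M, rDiag q m s * rSum q m s (M + 1) * A =
      B * (rDiag q m s * rSum q m s (M + 1)) + C * (rDiag q m s * rSum q m s M)) :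
    rMatrix q m s * A = (B + C) * rMatrix q m s := by
  refine LinearMap.ext fun v => ?_
  obtain ⟨d, hd⟩ := exists_mem_levelB m v
  obtain ⟨d', hd'⟩ := exists_mem_levelB m (A v)
  -- Beyond the filtration degrees of v and A v the partial sums agree with R. Two consecutive
  -- orders occur because passing t_- costs one power of the ladder operator.
  have h1 := rMatrix_apply (q := q) hms (M := max d d') (le_max_left _ _) hd
  have h2 := rMatrix_apply (q := q) hms (M := max d d' + 1) ((le_max_left _ _).trans (Nat.le_succ _)) hd
  have h3 := rMatrix_apply (q := q) hms (M := max d d' + 1)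
    ((le_max_right _ _).trans (Nat.le_succ _)) hd'
  have h4 := LinearMap.congr_fun (h (max d d')) v
  rw [Module.End.mul_apply, h3, Module.End.mul_apply (B + C), LinearMap.add_apply]
  rw [Module.End.mul_apply, LinearMap.add_apply, Module.End.mul_apply B, Module.End.mul_apply C,
    ← h2, ← h1] at h4
  exact h4

lemma rMatrix_commute {m s : Fin N} (hms : s ≠ m) {U : Set (Fin N)} (hm : m ∉ U) (hs : s ∉ U)
    {A : Op 𝕜 N} (hA : A ∈ localOps 𝕜 q U) : rMatrix q m s * A = A * rMatrix q m s := by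
  have h := rMatrix_mul_eq (q := q) hms (A := A) (B := A) (C := 0) fun M => by
    rw [zero_mul, add_zero]
    refine localOps_commute (q := q) (S := {m, s}) (T := U) ?_
      (mul_mem (rDiag_mem m s) (rSum_mem m s _)) hA
    simp [hm, hs]
  rwa [add_zero] at h

variable {m s : Fin N} {tp tm : Op 𝕜 N}

/-- Passing t_-, one factor K J_+ leaves p t_+ K². The factors to its left commute with t_+ and give
q⁻¹ at K², so the r + 1 positions add up to a geometric sum. -/
lemma ladder_pow_tm (ht : IsSpinor (quarter 𝕜 q) (legJp q m) (legJm q m) (legK q m) (legKi q m) tp tm)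
    (r : ℕ) : (legK q m * legJp q m) ^ (r + 1) * tm = tm * (legK q m * legJp q m) ^ (r + 1) +
      (quarter 𝕜 q * ((∑ i ∈ Finset.range (r + 1), q⁻¹ ^ i : ℝ) : 𝕜)) •
        (tp * (legK q m * legK q m) * (legK q m * legJp q m) ^ r) := by
  have hp : quarter 𝕜 q ≠ 0 := quarter_ne_zero
  have hJ := isTriple_leg (𝕜 := 𝕜) (q := q) m
  have h1 : (legK q m * legJp q m) * tm =
      tm * (legK q m * legJp q m) + quarter 𝕜 q • (tp * (legK q m * legK q m)) := by
    simp only [mul_add, add_mul, mul_assoc, smul_mul_assoc, mul_smul_comm, smul_add, ht.rules]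
    match_scalars <;> field_simp
  have h2 : (legK q m * legJp q m) * tp = tp * (legK q m * legJp q m) := by
    simp only [mul_assoc, smul_mul_assoc, mul_smul_comm, ht.rules]
    match_scalars <;> field_simp
  have hq4 : (q : 𝕜)⁻¹ = (quarter 𝕜 q ^ 4)⁻¹ := by rw [quarter_pow_four]
  have h3 : (legK q m * legJp q m) * (legK q m * legK q m) =
      (q : 𝕜)⁻¹ • ((legK q m * legK q m : Op 𝕜 N) * (legK q m * legJp q m)) := by
    simp only [mul_assoc, smul_mul_assoc, mul_smul_comm, hJ.rules, hq4]
    match_scalars <;> field_simp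
  induction r with
  | zero => simp [h1, mul_assoc]
  | succ r ih =>
    generalize (legK q m * legJp q m : Op 𝕜 N) = x at h1 h2 h3 ih ⊢
    generalize (legK q m * legK q m : Op 𝕜 N) = k at h1 h2 h3 ih ⊢
    have e2 := op_mul_mul_of_mul_eq h2
    have e3 := op_mul_mul_of_mul_eq h3
    have e1 := op_mul_mul_of_mul_eq h1
    rw [geom_sum_succ (n := r + 1), pow_succ' _ (r + 1), mul_assoc]
    generalize ∑ i ∈ Finset.range (r + 1), q⁻¹ ^ i = g at ih ⊢
    rw [ih]
    push_cast
    simp only [mul_add, add_mul, mul_assoc, smul_mul_assoc, mul_smul_comm, smul_add, e1, e2, e3,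
      pow_succ' x r]
    module

/-- The factors p from K and p⁻¹ from J_+ cancel, so K J_+ commutes with t_+; the second ladder
factor lives on another leg. -/
lemma rSum_mul_tp (hms : s ≠ m)
    (ht : IsSpinor (quarter 𝕜 q) (legJp q m) (legJm q m) (legK q m) (legKi q m) tp tm)
    (htp : tp ∈ localOps 𝕜 q {m}) (M : ℕ) : rSum q m s M * tp = tp * rSum q m s M := by
  have hp : quarter 𝕜 q ≠ 0 := quarter_ne_zero
  have h2 : Commute (legK q m * legJp q m) tp := by
    change _ * _ = _ * _
    simp only [mul_assoc, smul_mul_assoc, mul_smul_comm, ht.rules]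
    match_scalars <;> field_simp
  have h3 : Commute (legKi q s * legJm q s) tp :=
    localOps_commute (q := q) (S := {s}) (T := {m}) (by simpa using hms)
      (mul_mem (legKi_mem s) (legJm_mem s)) htp
  rw [rSum, Finset.sum_mul, Finset.mul_sum]
  refine Finset.sum_congr rfl fun r _ => ?_
  rw [smul_mul_assoc, mul_smul_comm, ((h2.pow_left r).mul_left (h3.pow_left r)).eq]

/-- By `rCoef_succ` the geometric sums of `ladder_pow_tm` turn the coefficients into those of one
order lower, so the correction is again a partial sum. -/
lemma rSum_mul_tm (hms : s ≠ m)
    (ht : IsSpinor (quarter 𝕜 q) (legJp q m) (legJm q m) (legK q m) (legKi q m) tp tm)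
    (htm : tm ∈ localOps 𝕜 q {m}) (M : ℕ) : rSum q m s (M + 1) * tm = tm * rSum q m s (M + 1) +
      (quarter 𝕜 q * (1 - (q : 𝕜)⁻¹)) •
        (tp * (legK q m * legK q m) * rSum q m s M * (legKi q s * legJm q s)) := by
  have h3 : Commute (legKi q s * legJm q s) tm :=
    localOps_commute (q := q) (S := {s}) (T := {m}) (by simpa using hms)
      (mul_mem (legKi_mem s) (legJm_mem s)) htm
  have h4 := fun r : ℕ => (h3.pow_left r).eq
  -- The term r = 0 commutes with t_-; the others, reindexed by r + 1, match the shorter sum.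
  rw [rSum, Finset.sum_range_succ', add_mul, mul_add, Finset.sum_mul, Finset.mul_sum, rSum,
    Finset.mul_sum, Finset.sum_mul, Finset.smul_sum, add_right_comm, ← Finset.sum_add_distrib]
  simp only [pow_zero, mul_one, smul_mul_assoc, mul_smul_comm, one_mul]
  congr 1
  refine Finset.sum_congr rfl fun r _ => ?_
  have h5 : ((rCoef q (r + 1) : ℝ) : 𝕜) * ((∑ i ∈ Finset.range (r + 1), q⁻¹ ^ i : ℝ) : 𝕜) =
      (1 - (q : 𝕜)⁻¹) * ((rCoef q r : ℝ) : 𝕜) := by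
    exact_mod_cast congrArg (RCLike.ofReal : ℝ → 𝕜) (rCoef_succ (q := q) r)
  rw [mul_assoc, h4, ← mul_assoc, ladder_pow_tm ht, add_mul, smul_add, smul_mul_assoc, smul_smul,
    smul_smul, mul_left_comm, h5, pow_succ (legKi q s * legJm q s) r]
  simp only [mul_assoc]

end
end QIntertwiner

end

/-! ### Closed form of the braided spinor operators -/

noncomputable section

namespace QIntertwiner

variable {𝕜 : Type*} [RCLike 𝕜] {N : ℕ} {q : ℝ}

/-- A spinor operator on the leg `m`. -/
structure IsLegSpinor (q : ℝ) (m : Fin N) (t : Bool → Op 𝕜 N) : Prop where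
  spinor : IsSpinor (quarter 𝕜 q) (legJp q m) (legJm q m) (legK q m) (legKi q m) (t true) (t false)
  mem : ∀ b, t b ∈ localOps 𝕜 q {m}
  diag_true : ∀ s, s ≠ m → rDiag q m s * t true = t true * legK q s * rDiag q m s
  diag_false : ∀ s, s ≠ m → rDiag q m s * t false = t false * legKi q s * rDiag q m s

instance (m s : Fin N) : IsMono q (rDiag q m s : Op 𝕜 N) 0 fun z =>
    q ^ ((z (m, true) - z (m, false)) / 2 * ((z (s, true) - z (s, false)) / 2)) :=
  inferInstanceAs (IsMono q (qPow q fun n => jz m n * jz s n) _ _)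

/-- The legs numbered below `s`. -/
def legsBelow (N s : ℕ) : Finset (Fin N) := Finset.univ.filter fun k => k.val < s

lemma legsBelow_succ {s : ℕ} (hs : s < N) : legsBelow N (s + 1) = legsBelow N s ∪ {⟨s, hs⟩} := by
  ext k
  simp [legsBelow, Fin.ext_iff]
  omega

lemma legsBelow_val (i : Fin N) : legsBelow N i.val = Finset.Iio i := by
  ext k
  simp [legsBelow]

section
variable [hq : Fact (0 < q)] [hq1 : Fact (q ≠ 1)]

lemma isLegSpinor_spinorT (i : Fin N) : IsLegSpinor q i (spinorT q i : Bool → Op 𝕜 N) where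
  spinor := isSpinor_spinorT i
  mem := spinorT_mem i
  diag_true s hs := by
    refine IsMono.ext (q := q) inferInstance inferInstance (by abel) fun z => ?_
    simp [hs]
    simp only [rpow_eq_exp]
    ring_nf
    simp only [exp_rules]
    ring_nf
  diag_false s hs := by
    refine IsMono.ext (q := q) inferInstance inferInstance (by abel) fun z => ?_
    simp [hs]
    simp only [rpow_eq_exp]
    ring_nf
    simp only [exp_rules]
    ring_nf

lemma isLegSpinor_spinorTt (i : Fin N) : IsLegSpinor q i (spinorTt q i : Bool → Op 𝕜 N) where
  spinor := isSpinor_spinorTt i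
  mem := spinorTt_mem i
  diag_true s hs := by
    refine IsMono.ext (q := q) inferInstance inferInstance (by abel) fun z => ?_
    simp [hs]
    simp only [rpow_eq_exp]
    ring_nf
    simp only [exp_rules]
    ring_nf
  diag_false s hs := by
    refine IsMono.ext (q := q) inferInstance inferInstance (by abel) fun z => ?_
    simp [hs]
    simp only [rpow_eq_exp]
    ring_nf
    simp only [exp_rules]
    ring_nf

/-- Moving J_- of the leg s through q^{J_z ⊗ J_z} gives q^{-J_z} on the leg m, which K_m² cancels;
K_s and K_s⁻¹ cancel too. -/
lemma legK_rDiag_legJm {m s : Fin N} (hms : s ≠ m) :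
    (legK q s * (rDiag q m s * (legK q m * legK q m * (legKi q s * legJm q s))) : Op 𝕜 N) =
      legJm q s * rDiag q m s := by
  refine IsMono.ext (q := q) inferInstance inferInstance (by abel) fun z => ?_
  simp [hms, hms.symm]
  simp only [rpow_eq_exp]
  ring_nf
  simp only [exp_rules]
  ring_nf

/-- The coefficient in the braiding of spinor operators. -/
def braidCoef (𝕜 : Type*) [RCLike 𝕜] (q : ℝ) : 𝕜 := quarter 𝕜 q - (quarter 𝕜 q)⁻¹ ^ 3

lemma braidCoef_eq : braidCoef 𝕜 q = quarter 𝕜 q * (1 - (q : 𝕜)⁻¹) := by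
  have hp : quarter 𝕜 q ≠ 0 := quarter_ne_zero
  rw [braidCoef, ← quarter_pow_four]
  field_simp

variable {m s : Fin N} {t : Bool → Op 𝕜 N}

lemma rMatrix_mul_true (hms : s ≠ m) (ht : IsLegSpinor q m t) :
    rMatrix q m s * t true = t true * legK q s * rMatrix q m s := by
  have h := rMatrix_mul_eq (q := q) hms (A := t true) (B := t true * legK q s) (C := 0) fun M => by
    rw [zero_mul, add_zero, mul_assoc, rSum_mul_tp hms ht.spinor (ht.mem true), ← mul_assoc,
      ht.diag_true s hms, mul_assoc]
  rwa [add_zero] at h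

/-- The diagonal factor turns t_- into t_- K_s⁻¹; the correction of the q-exponential loses its
dependence on the leg m through `legK_rDiag_legJm` and leaves J_- of the leg s. -/
lemma rMatrix_mul_false (hms : s ≠ m) (ht : IsLegSpinor q m t) :
    rMatrix q m s * t false =
      (t false * legKi q s + braidCoef 𝕜 q • (t true * legJm q s)) * rMatrix q m s := by
  refine rMatrix_mul_eq (q := q) hms fun M => ?_
  have hy : Commute (rSum q m s M : Op 𝕜 N) (legKi q s * legJm q s) := by
    refine Commute.sum_left _ _ _ fun r _ => Commute.smul_left ?_ _
    exact ((ladder_commute hms).pow_left r).mul_left ((Commute.refl _).pow_left r)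
  have hd := op_mul_mul_of_mul_eq (ht.diag_true s hms)
  rw [mul_assoc, rSum_mul_tm hms ht.spinor (ht.mem false), mul_add, ← mul_assoc,
    ht.diag_false s hms, mul_assoc (t false * legKi q s), mul_smul_comm, braidCoef_eq,
    mul_assoc _ (rSum q m s M), hy.eq, smul_mul_assoc]
  congr 2
  have e := congrArg (fun x => t true * x * rSum q m s M) (legK_rDiag_legJm (𝕜 := 𝕜) (q := q) hms)
  simpa only [mul_assoc, hd] using e

lemma isUnit_braidUpTo (i : Fin N) (s : ℕ) (h : s ≤ i.val) :
    IsUnit (braidUpTo q i s h : Op 𝕜 N) := by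
  induction s with
  | zero => exact isUnit_one
  | succ s ih =>
    exact (isUnit_rMatrix (by simpa [Fin.ext_iff] using (Nat.lt_of_succ_le h).ne)).mul (ih _)

lemma braidUpTo_mul_true {i : Fin N} (ht : IsLegSpinor q i t) (s : ℕ) (h : s ≤ i.val) :
    braidUpTo q i s h * t true = t true * segK q (legsBelow N s) * braidUpTo q i s h := by
  induction s with
  | zero => simp [braidUpTo, legsBelow, segK_empty]
  | succ s ih =>
    have hs : s < N := lt_of_lt_of_le h i.isLt.le
    have hne : (⟨s, hs⟩ : Fin N) ≠ i := by simpa [Fin.ext_iff] using (Nat.lt_of_succ_le h).ne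
    have hi : i ∉ (legsBelow N s : Set (Fin N)) := by simp [legsBelow]; omega
    have hs' : (⟨s, hs⟩ : Fin N) ∉ (legsBelow N s : Set (Fin N)) := by simp [legsBelow]
    have hd : Disjoint (legsBelow N s) {⟨s, hs⟩} := by simpa using hs'
    rw [braidUpTo, mul_assoc, ih, legsBelow_succ hs, segK_union hd, segK_singleton]
    have h1 := rMatrix_mul_true hne ht
    have h2 := rMatrix_commute (q := q) hne hi hs' (segK_mem (𝕜 := 𝕜) (legsBelow N s))
    have h3 := (commuteAll_leg hs' (segK_mem (𝕜 := 𝕜) (q := q) (legsBelow N s))).K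
    simp only [mul_assoc, op_mul_mul_of_mul_eq h1, op_mul_mul_of_mul_eq h2, op_mul_mul_of_mul_eq h3]

/-- A new leg s reproduces the coproduct. The old correction becomes t_+ K_s J_-, and t_- K⁻¹ yields
a new correction t_+ J_-(s) K⁻¹, with J_- and K⁻¹ on the earlier legs; these are the two terms of
`segJ_union`. -/
lemma braidUpTo_mul_false {i : Fin N} (ht : IsLegSpinor q i t) (s : ℕ) (h : s ≤ i.val) :
    braidUpTo q i s h * t false = (t false * segKi q (legsBelow N s) +
      braidCoef 𝕜 q • (t true * segJ q (legJm q) (legsBelow N s))) * braidUpTo q i s h := by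
  induction s with
  | zero => simp [braidUpTo, legsBelow, segKi_empty, segJ]
  | succ s ih =>
    have hs : s < N := lt_of_lt_of_le h i.isLt.le
    have hne : (⟨s, hs⟩ : Fin N) ≠ i := by simpa [Fin.ext_iff] using (Nat.lt_of_succ_le h).ne
    have hi : i ∉ (legsBelow N s : Set (Fin N)) := by simp [legsBelow]; omega
    have hs' : (⟨s, hs⟩ : Fin N) ∉ (legsBelow N s : Set (Fin N)) := by simp [legsBelow]
    have hl : ∀ a ∈ legsBelow N s, ∀ b ∈ ({⟨s, hs⟩} : Finset (Fin N)), a < b := by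
      intro a ha b hb
      rw [Finset.mem_singleton.mp hb]
      exact (Finset.mem_filter.mp ha).2
    rw [braidUpTo, mul_assoc, ih, legsBelow_succ hs, segKi_union (disjoint_of_lt hl),
      segKi_singleton, segJ_union _ hl, segJ_singleton, segK_singleton]
    have h1 := rMatrix_mul_true hne ht
    have h1' := rMatrix_mul_false hne ht
    have h2 := rMatrix_commute (q := q) hne hi hs' (segKi_mem (𝕜 := 𝕜) (legsBelow N s))
    have h2' := rMatrix_commute (q := q) hne hi hs' (segJ_mem (legJm_mem (𝕜 := 𝕜)) (legsBelow N s))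
    have h3 := commuteAll_leg hs' (segKi_mem (𝕜 := 𝕜) (q := q) (legsBelow N s))
    have h3' := commuteAll_leg hs' (segJ_mem (legJm_mem (𝕜 := 𝕜) (q := q)) (legsBelow N s))
    simp only [mul_add, add_mul, mul_assoc, smul_mul_assoc, mul_smul_comm, smul_add,
      op_mul_mul_of_mul_eq h1, op_mul_mul_of_mul_eq h1', op_mul_mul_of_mul_eq h2, op_mul_mul_of_mul_eq h2',
      h3.rules, h3'.rules]
    abel

lemma isUnit_braid (i : Fin N) : IsUnit (braid q i : Op 𝕜 N) := isUnit_braidUpTo i _ _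

lemma braided_eq {i : Fin N} {A B : Op 𝕜 N} (h : braid q i * A = B * braid q i) :
    braided q i A = B := by
  rw [braided, h, mul_assoc, Ring.mul_inverse_cancel _ (isUnit_braid i), mul_one]

lemma braided_true {i : Fin N} (ht : IsLegSpinor q i t) :
    braided q i (t true) = t true * segK q (Finset.Iio i) := by
  rw [← legsBelow_val]
  exact braided_eq (braidUpTo_mul_true ht _ _)

lemma braided_false {i : Fin N} (ht : IsLegSpinor q i t) :
    braided q i (t false) = t false * segKi q (Finset.Iio i) +
      braidCoef 𝕜 q • (t true * segJ q (legJm q) (Finset.Iio i)) := by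
  rw [← legsBelow_val]
  exact braided_eq (braidUpTo_mul_false ht _ _)

end
end QIntertwiner

end

noncomputable section

namespace QIntertwiner

variable {𝕜 : Type*} [RCLike 𝕜] {N : ℕ} {q : ℝ}

/-! ### Invariance of the operators `E_{ij}` -/

lemma diag_apply (g : Occ N → ℝ) (v : Fock 𝕜 N) (n : Occ N) :
    (diag g : Op 𝕜 N) v n = ((g n : ℝ) : 𝕜) * v n := by
  induction v using Finsupp.induction_linear with
  | zero => simp
  | add f g hf hg => simp only [map_add, Finsupp.add_apply, hf, hg, mul_add]
  | single m c =>
    rw [diag_single]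
    by_cases h : m = n
    · subst h; simp [mul_comm]
    · simp [Finsupp.single_eq_of_ne (Ne.symm h)]

/-- An operator that commutes with diagonal operators commutes with the diagonal operators that are
functions of them. -/
lemma diag_commute_of_commute {ι : Type*} {g : ι → Occ N → ℝ} {g' : Occ N → ℝ}
    (hg : ∀ n m, (∀ i, g i n = g i m) → g' n = g' m)
    {O : Op 𝕜 N} (h : ∀ i, diag (g i) * O = O * diag (g i)) : diag g' * O = O * diag g' := by
  ext n : 2
  refine Finsupp.ext fun m => ?_
  have h1 := fun i => DFunLike.congr_fun (LinearMap.congr_fun (h i) (Finsupp.single n 1)) m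
  simp only [Module.End.mul_apply, diag_apply, diag_single, one_mul, LinearMap.comp_apply,
    Finsupp.lsingle_apply] at h1 ⊢
  have e : ∀ c : 𝕜, O (Finsupp.single n c) m = c * O (Finsupp.single n 1) m := fun c => by
    rw [← mul_one c, ← smul_eq_mul, ← Finsupp.smul_single, map_smul, Finsupp.smul_apply,
      smul_eq_mul, smul_eq_mul, mul_one]
  rw [e ((g' n : ℝ) : 𝕜)]
  by_cases h0 : O (Finsupp.single n 1) m = 0
  · rw [h0, mul_zero, mul_zero]
  -- A nonzero matrix element of O between n and m forces the eigenvalues of all `g i` to agree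
  -- there, hence those of `g'`.
  · rw [hg m n fun i => by
      have := h1 i
      rw [e ((g i n : ℝ) : 𝕜)] at this
      exact_mod_cast mul_right_cancel₀ h0 this]

lemma op_sub_self (A : Op 𝕜 N) : A - A = 0 := sub_self A

lemma CommuteAll.neg {A : Type*} [Ring A] {Jp Jm K Ki a : A} (h : CommuteAll Jp Jm K Ki a) :
    CommuteAll Jp Jm K Ki (-a) :=
  ⟨by rw [mul_neg, neg_mul, h.Jp], by rw [mul_neg, neg_mul, h.Jm], by rw [mul_neg, neg_mul, h.K],
    by rw [mul_neg, neg_mul, h.Ki]⟩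

lemma Iio_union_singleton (i : Fin N) : Finset.Iio i ∪ {i} = Finset.Iic i := by
  ext k; simp [le_iff_lt_or_eq]

lemma Iic_union_Ioi (i : Fin N) : Finset.Iic i ∪ Finset.Ioi i = Finset.univ := by
  ext k; simp [le_or_gt]

lemma Iic_union_Ioo {i j : Fin N} (h : i < j) :
    Finset.Iic i ∪ Finset.Ioo i j = Finset.Iio j := by
  ext k; simp only [Finset.mem_union, Finset.mem_Iic, Finset.mem_Ioo, Finset.mem_Iio]; omega

section
variable [hq : Fact (0 < q)] [hq1 : Fact (q ≠ 1)]

omit hq hq1 in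
lemma neg_quarter (hq : 0 < q) : (((q ^ (-1 / 4 : ℝ) : ℝ)) : 𝕜) = (quarter 𝕜 q)⁻¹ := by
  rw [quarter, neg_div, Real.rpow_neg hq.le, RCLike.ofReal_inv]

/-- The legs below i are handled by the braiding, whose closed form is that of
`IsSpinor.braided_left`. The legs above i need nothing, as the operator then sits in the first
factor of a coproduct. -/
lemma isSpinor_braided {i : Fin N} {t : Bool → Op 𝕜 N} (ht : IsLegSpinor q i t) :
    IsSpinor (quarter 𝕜 q) (totJp q) (totJm q) (segK q Finset.univ) (totKinv q)
      (braided q i (t true)) (braided q i (t false)) := by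
  have h1 : ∀ a ∈ Finset.Iio i, ∀ b ∈ ({i} : Finset (Fin N)), a < b := by simp
  have h2 : ∀ a ∈ Finset.Iic i, ∀ b ∈ Finset.Ioi i, a < b := by
    simp only [Finset.mem_Iic, Finset.mem_Ioi]
    exact fun a ha b hb => lt_of_le_of_lt ha hb
  have hi : i ∉ ((Finset.Iio i : Finset (Fin N)) : Set (Fin N)) := by simp
  have hi' : Disjoint ((Finset.Iio i : Finset (Fin N)) : Set (Fin N)) {i} := by simp
  have e1 := IsSpinor.braided_left quarter_ne_zero quarter_pow_four_ne_one
    (isTriple_seg (Finset.Iio i)) ht.spinor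
    ⟨(isTriple_leg i).K_Ki, (isTriple_leg i).Ki_K⟩ (commuteAll_seg hi' (ht.mem true))
    (commuteAll_seg hi' (ht.mem false)) (commuteAll_leg hi (segJ_mem legJm_mem _))
    (commuteAll_leg hi (segK_mem _)) (commuteAll_leg hi (segKi_mem _))
  have m1 : braided q i (t true) ∈ localOps 𝕜 q ((Finset.Iic i : Finset (Fin N)) : Set (Fin N)) := by
    rw [braided_true ht]
    exact mul_mem (localOps_mono (by simp) (ht.mem true))
      (localOps_mono (by simpa using Set.Iio_subset_Iic_self) (segK_mem _))
  have m2 : braided q i (t false) ∈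
      localOps 𝕜 q ((Finset.Iic i : Finset (Fin N)) : Set (Fin N)) := by
    rw [braided_false ht]
    exact add_mem (mul_mem (localOps_mono (by simp) (ht.mem false))
      (localOps_mono (by simpa using Set.Iio_subset_Iic_self) (segKi_mem _)))
      (Subalgebra.smul_mem _ (mul_mem (localOps_mono (by simp) (ht.mem true))
        (localOps_mono (by simpa using Set.Iio_subset_Iic_self) (segJ_mem legJm_mem _))) _)
  have e2 : IsSpinor (quarter 𝕜 q) (segJ q (legJp q) (Finset.Iic i)) (segJ q (legJm q) (Finset.Iic i))
      (segK q (Finset.Iic i)) (segKi q (Finset.Iic i)) (braided q i (t true))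
      (braided q i (t false)) := by
    rw [← Iio_union_singleton, segJ_union _ h1, segJ_union _ h1, segK_union (disjoint_of_lt h1),
      segKi_union (disjoint_of_lt h1), segJ_singleton, segJ_singleton, segK_singleton,
      segKi_singleton, braided_true ht, braided_false ht]
    exact e1
  have hd : Disjoint ((Finset.Ioi i : Finset (Fin N)) : Set (Fin N))
      ((Finset.Iic i : Finset (Fin N)) : Set (Fin N)) := by
    exact_mod_cast (disjoint_of_lt h2).symm
  have e3 := e2.extend_right (commuteAll_seg hd m1) (commuteAll_seg hd m2)
  rw [totJp_eq, totJm_eq, totKinv_eq, ← Iic_union_Ioi i, segJ_union _ h2, segJ_union _ h2,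
    segK_union (disjoint_of_lt h2), segKi_union (disjoint_of_lt h2)]
  exact e3

lemma scriptE_eq (i j : Fin N) : (scriptE q i j : Op 𝕜 N) =
    -(quarter 𝕜 q • (braided q i (spinorT q i true) * braided q j (spinorTt q j false)) -
      (quarter 𝕜 q)⁻¹ • (braided q i (spinorT q i false) * braided q j (spinorTt q j true))) := by
  rw [scriptE, spinorDot, neg_quarter hq.out]
  rfl

lemma commuteAll_scriptE (i j : Fin N) : CommuteAll (totJp q) (totJm q) (segK q Finset.univ)
    (totKinv q) (scriptE q i j : Op 𝕜 N) := by
  have h := IsSpinor.dot_commute (F := 𝕜) quarter_ne_zero (isSpinor_braided (isLegSpinor_spinorT (𝕜 := 𝕜) (q := q) i))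
    (isSpinor_braided (isLegSpinor_spinorTt (𝕜 := 𝕜) (q := q) j))
  rw [scriptE_eq]
  exact h.neg

/-- The algebraic lemmas only involve q^{J_z/2}; as q ≠ 1, its eigenvalues determine those of J_z.
-/
lemma totJz_commute_scriptE (i j : Fin N) :
    totJz * (scriptE q i j : Op 𝕜 N) = scriptE q i j * totJz := by
  refine diag_commute_of_commute (fun n m h => ?_) fun _ : Unit => (commuteAll_scriptE i j).K
  have h1 := Real.rpow_right_inj hq.out hq1.out |>.mp (h ())
  linarith

/-- Commutation with the generators gives adjoint invariance: the factor q^{±1/2} offsets the one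
from exchanging q^{-J_z/2} with J_±. -/
lemma isInvariant_scriptE (i j : Fin N) : IsInvariant q (scriptE q i j : Op 𝕜 N) := by
  have hc := commuteAll_scriptE (𝕜 := 𝕜) (q := q) i j
  have ht := isTriple_seg (𝕜 := 𝕜) (q := q) (N := N) Finset.univ
  rw [← totJp_eq, ← totJm_eq, ← totKinv_eq] at ht
  have hp : quarter 𝕜 q ≠ 0 := quarter_ne_zero
  have e1 : ((q ^ (1 / 2 : ℝ) : ℝ) : 𝕜) = quarter 𝕜 q ^ 2 := by
    rw [quarter, ← RCLike.ofReal_pow, ← Real.rpow_natCast, ← Real.rpow_mul hq.out.le]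
    norm_num
  have e2 : ((q ^ (-1 / 2 : ℝ) : ℝ) : 𝕜) = (quarter 𝕜 q)⁻¹ ^ 2 := by
    rw [neg_div, Real.rpow_neg hq.out.le, RCLike.ofReal_inv, e1, inv_pow]
  refine ⟨by rw [totJz_commute_scriptE]; exact op_sub_self _, ?_, ?_⟩
  · rw [hc.Jp, hc.Ki, mul_assoc, mul_assoc, ht.Ki_Jp, mul_smul_comm, smul_smul, e1]
    have : quarter 𝕜 q ^ 2 * (quarter 𝕜 q)⁻¹ ^ 2 = 1 := by field_simp
    rw [this, one_smul]
    exact op_sub_self _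
  · rw [hc.Jm, hc.Ki, mul_assoc, mul_assoc, ht.Ki_Jm, mul_smul_comm, smul_smul, e2]
    have : (quarter 𝕜 q)⁻¹ ^ 2 * quarter 𝕜 q ^ 2 = 1 := by field_simp
    rw [this, one_smul]
    exact op_sub_self _

omit hq hq1 in
lemma mem_intertwiners_of_commute {O : Op 𝕜 N} (hz : totJz * O = O * totJz)
    (hp : totJp q * O = O * totJp q) (hm : totJm q * O = O * totJm q) {v : Fock 𝕜 N}
    (hv : v ∈ intertwiners 𝕜 q N) : O v ∈ intertwiners 𝕜 q N := by
  obtain ⟨⟨h1, h2⟩, h3⟩ := hv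
  replace h3 : totJm q v = 0 := h3
  replace h1 : totJz v = 0 := h1
  replace h2 : totJp q v = 0 := h2
  refine ⟨⟨?_, ?_⟩, ?_⟩
  · change totJz (O v) = 0
    rw [← Module.End.mul_apply, hz, Module.End.mul_apply, h1, map_zero]
  · change totJp q (O v) = 0
    rw [← Module.End.mul_apply, hp, Module.End.mul_apply, h2, map_zero]
  · change totJm q (O v) = 0
    rw [← Module.End.mul_apply, hm, Module.End.mul_apply, h3, map_zero]

lemma scriptE_mem_intertwiners (i j : Fin N) {v : Fock 𝕜 N} (hv : v ∈ intertwiners 𝕜 q N) :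
    (scriptE q i j : Op 𝕜 N) v ∈ intertwiners 𝕜 q N := by
  have hc := commuteAll_scriptE (𝕜 := 𝕜) (q := q) i j
  exact mem_intertwiners_of_commute (totJz_commute_scriptE i j) hc.Jp hc.Jm hv

/-! ### The operators `E_{ij}` without the legs to the left -/

/-- The legs below i drop out: K K⁻¹ = 1, and the two terms with their J_- cancel because p K J_- =
p⁻¹ J_- K. -/
lemma scriptE_self (i : Fin N) : (scriptE q i i : Op 𝕜 N) =
    (quarter 𝕜 q)⁻¹ • (spinorT q i false * spinorTt q i true) +
      (-quarter 𝕜 q) • (spinorT q i true * spinorTt q i false) := by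
  have hp : quarter 𝕜 q ≠ 0 := quarter_ne_zero
  have hL := isTriple_seg (𝕜 := 𝕜) (q := q) (Finset.Iio i)
  have hi : Disjoint ((Finset.Iio i : Finset (Fin N)) : Set (Fin N)) {i} := by simp
  have c1 := commuteAll_seg hi (spinorTt_mem (𝕜 := 𝕜) (q := q) i true)
  have c2 := commuteAll_seg hi (spinorTt_mem (𝕜 := 𝕜) (q := q) i false)
  rw [scriptE_eq, braided_true (isLegSpinor_spinorT i), braided_true (isLegSpinor_spinorTt i),
    braided_false (isLegSpinor_spinorT i), braided_false (isLegSpinor_spinorTt i)]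
  simp only [mul_add, add_mul, mul_assoc, smul_mul_assoc, mul_smul_comm, smul_add, mul_one, one_mul,
    hL.rules, c1.rules, c2.rules]
  match_scalars <;> field_simp <;> ring

/-- The legs below i cancel as in `scriptE_self`, but the spinor operator on j still sees the leg i
and the legs strictly between. The coproduct splits their J_- into the terms with coefficient p(p -
p⁻³). -/
lemma scriptE_lt {i j : Fin N} (h : i < j) : (scriptE q i j : Op 𝕜 N) =
    (-quarter 𝕜 q) • (spinorT q i true * spinorTt q j false * legKi q i * segKi q (Finset.Ioo i j)) +
    ((-(braidCoef 𝕜 q * quarter 𝕜 q)) •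
        (spinorT q i true * spinorTt q j true * legJm q i * segK q (Finset.Ioo i j)) +
      (quarter 𝕜 q)⁻¹ •
        (spinorT q i false * spinorTt q j true * legK q i * segK q (Finset.Ioo i j))) +
    (-(braidCoef 𝕜 q * quarter 𝕜 q)) • (spinorT q i true * spinorTt q j true * legKi q i *
      segJ q (legJm q) (Finset.Ioo i j)) := by
  have hp : quarter 𝕜 q ≠ 0 := quarter_ne_zero
  have hL := isTriple_seg (𝕜 := 𝕜) (q := q) (Finset.Iio i)
  have hi : Disjoint ((Finset.Iio i : Finset (Fin N)) : Set (Fin N)) {i} := by simp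
  have hj : Disjoint ((Finset.Iio i : Finset (Fin N)) : Set (Fin N)) {j} := by simp [h.le]
  have hM : Disjoint ((Finset.Iio i : Finset (Fin N)) : Set (Fin N))
      ((Finset.Ioo i j : Finset (Fin N)) : Set (Fin N)) := by
    rw [Set.disjoint_left]
    simp only [Finset.coe_Iio, Finset.coe_Ioo, Set.mem_Iio, Set.mem_Ioo]
    omega
  have c1 := commuteAll_seg hj (spinorTt_mem (𝕜 := 𝕜) (q := q) j true)
  have c2 := commuteAll_seg hj (spinorTt_mem (𝕜 := 𝕜) (q := q) j false)
  have c3 := commuteAll_seg hi (legJm_mem (𝕜 := 𝕜) (q := q) i)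
  have c4 := commuteAll_seg hi (legK_mem (𝕜 := 𝕜) (q := q) i)
  have c5 := commuteAll_seg hi (legKi_mem (𝕜 := 𝕜) (q := q) i)
  have c6 := commuteAll_seg hM (segJ_mem (legJm_mem (𝕜 := 𝕜) (q := q)) (Finset.Ioo i j))
  have c7 := commuteAll_seg hM (segK_mem (𝕜 := 𝕜) (q := q) (Finset.Ioo i j))
  have c8 := commuteAll_seg hM (segKi_mem (𝕜 := 𝕜) (q := q) (Finset.Ioo i j))
  have h1 : ∀ a ∈ Finset.Iio i, ∀ b ∈ ({i} : Finset (Fin N)), a < b := by simp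
  have h2 : ∀ a ∈ Finset.Iic i, ∀ b ∈ Finset.Ioo i j, a < b := by
    simp only [Finset.mem_Iic, Finset.mem_Ioo]
    omega
  rw [scriptE_eq, braided_true (isLegSpinor_spinorT i), braided_true (isLegSpinor_spinorTt j),
    braided_false (isLegSpinor_spinorT i), braided_false (isLegSpinor_spinorTt j),
    ← Iic_union_Ioo h, segJ_union _ h2, segK_union (disjoint_of_lt h2),
    segKi_union (disjoint_of_lt h2), ← Iio_union_singleton, segJ_union _ h1,
    segK_union (disjoint_of_lt h1), segKi_union (disjoint_of_lt h1), segJ_singleton, segK_singleton,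
    segKi_singleton]
  simp only [mul_add, add_mul, mul_assoc, smul_mul_assoc, mul_smul_comm, smul_add, mul_one, one_mul,
    hL.rules, c1.rules, c2.rules, c3.rules, c4.rules, c5.rules, c6.rules, c7.rules, c8.rules]
  match_scalars <;> field_simp <;> ring

/-- As `scriptE_lt`, with T on the farther leg; the generators of the leg i now stand to the left of
T̃ and are not moved past it. -/
lemma scriptE_gt {i j : Fin N} (h : i < j) : (scriptE q j i : Op 𝕜 N) =
    ((-quarter 𝕜 q) •
        (spinorT q j true * legK q i * segK q (Finset.Ioo i j) * spinorTt q i false) +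
      ((quarter 𝕜 q)⁻¹ * braidCoef 𝕜 q) •
        (spinorT q j true * legJm q i * segK q (Finset.Ioo i j) * spinorTt q i true)) +
    (quarter 𝕜 q)⁻¹ •
      (spinorT q j false * legKi q i * segKi q (Finset.Ioo i j) * spinorTt q i true) +
    ((quarter 𝕜 q)⁻¹ * braidCoef 𝕜 q) • (spinorT q j true * legKi q i *
      segJ q (legJm q) (Finset.Ioo i j) * spinorTt q i true) := by
  have hp : quarter 𝕜 q ≠ 0 := quarter_ne_zero
  have hL := isTriple_seg (𝕜 := 𝕜) (q := q) (Finset.Iio i)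
  have hi : Disjoint ((Finset.Iio i : Finset (Fin N)) : Set (Fin N)) {i} := by simp
  have hM : Disjoint ((Finset.Iio i : Finset (Fin N)) : Set (Fin N))
      ((Finset.Ioo i j : Finset (Fin N)) : Set (Fin N)) := by
    rw [Set.disjoint_left]
    simp only [Finset.coe_Iio, Finset.coe_Ioo, Set.mem_Iio, Set.mem_Ioo]
    omega
  have c1 := commuteAll_seg hi (spinorTt_mem (𝕜 := 𝕜) (q := q) i true)
  have c2 := commuteAll_seg hi (spinorTt_mem (𝕜 := 𝕜) (q := q) i false)
  have c3 := commuteAll_seg hi (legJm_mem (𝕜 := 𝕜) (q := q) i)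
  have c4 := commuteAll_seg hi (legK_mem (𝕜 := 𝕜) (q := q) i)
  have c5 := commuteAll_seg hi (legKi_mem (𝕜 := 𝕜) (q := q) i)
  have c6 := commuteAll_seg hM (segJ_mem (legJm_mem (𝕜 := 𝕜) (q := q)) (Finset.Ioo i j))
  have c7 := commuteAll_seg hM (segK_mem (𝕜 := 𝕜) (q := q) (Finset.Ioo i j))
  have c8 := commuteAll_seg hM (segKi_mem (𝕜 := 𝕜) (q := q) (Finset.Ioo i j))
  have h1 : ∀ a ∈ Finset.Iio i, ∀ b ∈ ({i} : Finset (Fin N)), a < b := by simp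
  have h2 : ∀ a ∈ Finset.Iic i, ∀ b ∈ Finset.Ioo i j, a < b := by
    simp only [Finset.mem_Iic, Finset.mem_Ioo]
    omega
  rw [scriptE_eq, braided_true (isLegSpinor_spinorT j), braided_true (isLegSpinor_spinorTt i),
    braided_false (isLegSpinor_spinorT j), braided_false (isLegSpinor_spinorTt i),
    ← Iic_union_Ioo h, segJ_union _ h2, segK_union (disjoint_of_lt h2),
    segKi_union (disjoint_of_lt h2), ← Iio_union_singleton, segJ_union _ h1,
    segK_union (disjoint_of_lt h1), segKi_union (disjoint_of_lt h1), segJ_singleton, segK_singleton,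
    segKi_singleton]
  simp only [mul_add, add_mul, mul_assoc, smul_mul_assoc, mul_smul_comm, smul_add, mul_one, one_mul,
    hL.rules, c1.rules, c2.rules, c3.rules, c4.rules, c5.rules, c6.rules, c7.rules, c8.rules]
  match_scalars <;> field_simp <;> ring

end
end QIntertwiner

end

noncomputable section

namespace QIntertwiner

variable {𝕜 : Type*} [RCLike 𝕜] {N : ℕ} {q : ℝ}

/-! ### The change of variables -/

instance (S : Finset (Fin N)) : IsMono q (segK q S : Op 𝕜 N) 0 fun z =>
    q ^ ((∑ k ∈ S, (z (k, true) - z (k, false)) / 2) / 2) :=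
  inferInstanceAs (IsMono q (qPow q fun n => (∑ k ∈ S, jz k n) / 2) _ _)

instance (S : Finset (Fin N)) : IsMono q (segKi q S : Op 𝕜 N) 0 fun z =>
    q ^ (-(∑ k ∈ S, (z (k, true) - z (k, false)) / 2) / 2) :=
  inferInstanceAs (IsMono q (qPow q fun n => -(∑ k ∈ S, jz k n) / 2) _ _)

/-- Evaluates the exponents Σ N after a shift of a single mode. -/
lemma sum_single_mode (S : Finset (Fin N)) (i : Fin N) (b b' : Bool) :
    ∑ k ∈ S, (Pi.single (i, b) 1 : Fin N × Bool → ℝ) (k, b') = if i ∈ S ∧ b = b' then 1 else 0 := by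
  by_cases hb : b = b'
  · subst hb
    simp [Pi.single_apply, Prod.ext_iff]
  · simp [Pi.single_apply, Prod.ext_iff, hb, Ne.symm hb]

lemma scalar_casts : (∀ q : ℝ, quarter 𝕜 q = ((q ^ (1 / 4 : ℝ) : ℝ) : 𝕜)) ∧
    (∀ q : ℝ, braidCoef 𝕜 q = ((q ^ (1 / 4 : ℝ) - (q ^ (1 / 4 : ℝ))⁻¹ ^ 3 : ℝ) : 𝕜)) ∧
    (∀ x : ℝ, (x : 𝕜)⁻¹ = ((x⁻¹ : ℝ) : 𝕜)) ∧
    (∀ x : ℝ, -(x : 𝕜) = ((-x : ℝ) : 𝕜)) ∧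
    (∀ x y : ℝ, (x : 𝕜) * (y : 𝕜) = ((x * y : ℝ) : 𝕜)) :=
  ⟨fun _ => rfl, fun _ => by simp [braidCoef, quarter], fun x => by simp, fun x => by simp,
    fun x y => by simp⟩

section
variable [hq : Fact (0 < q)] [hq1 : Fact (q ≠ 1)]

lemma scriptE_self_eq (i : Fin N) : (scriptE q i i : Op 𝕜 N) =
    ((q ^ (-1 / 2 : ℝ) : ℝ) : 𝕜) •
      (qPow q (fun n => nLeg i n / 2) * diag (fun n => qNum q (nLeg i n))) := by
  rw [scriptE_self]
  simp only [scalar_casts]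
  refine (IsMono.ext_add (q := q) inferInstance inferInstance inferInstance (by abel) (by abel)
    fun z => ?_).symm
  simp
  simp only [rpow_eq_exp, qNum_eq_exp]
  ring_nf
  simp only [exp_rules]
  ring_nf

lemma exp_sub_exp_mul_qNum (x : ℝ) :
    (Real.exp (Real.log q * (1 / 2)) - Real.exp (Real.log q * (-1 / 2))) * qNum q x =
      Real.exp (Real.log q * (x / 2)) - Real.exp (Real.log q * (-x / 2)) := by
  linear_combination qNum_add_one' (q := q) x - qNum_add_one (q := q) x

variable {i j : Fin N}

lemma change_up_a (h : i < j) :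
    ((-quarter 𝕜 q) • (spinorT q i true * spinorTt q j false * legKi q i *
      segKi q (Finset.Ioo i j)) : Op 𝕜 N) =
    qPow q (fun n => (-(∑ l ∈ Finset.Ioo i j, nLeg l n) + nLeg j n) / 4) * (aDag q i * aOp q j *
      qPow q (fun n => (nB i n + 2 * (∑ l ∈ Finset.Ioo i j, nB l n) - nB j n) / 4)) := by
  simp only [scalar_casts]
  refine IsMono.ext (q := q) inferInstance inferInstance (by abel) fun z => ?_
  simp [Finset.sum_add_distrib, Finset.sum_sub_distrib, ← Finset.sum_div, sum_single_mode,
    h.ne, h.ne', -Finset.sum_ite_eq]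
  simp only [rpow_eq_exp]
  ring_nf
  simp only [exp_rules]
  ring_nf

/-- The two monomials have the same shift and merge: t_+ J_- on the leg i contributes [N_{a_i}]
b_i†, and (q^{1/2} - q^{-1/2})[x] is a difference of two powers, one of which cancels the t_- term.
-/
lemma change_up_b (h : i < j) :
    ((-(braidCoef 𝕜 q * quarter 𝕜 q)) •
        (spinorT q i true * spinorTt q j true * legJm q i * segK q (Finset.Ioo i j)) +
      (quarter 𝕜 q)⁻¹ •
        (spinorT q i false * spinorTt q j true * legK q i * segK q (Finset.Ioo i j)) : Op 𝕜 N) =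
    qPow q (fun n => (-(∑ l ∈ Finset.Ioo i j, nLeg l n) + nLeg j n) / 4) *
      (qPow q (fun n => (-nA i n + 2 * (∑ l ∈ Finset.Ioo i j, nA l n) + nA j n) / 4) *
      (bDag q i * bOp q j)) := by
  simp only [scalar_casts]
  refine (IsMono.ext_add (q := q) inferInstance inferInstance inferInstance (by abel) (by abel)
    fun z => ?_).symm
  simp [Finset.sum_add_distrib, Finset.sum_sub_distrib, ← Finset.sum_div, sum_single_mode,
    h.ne, h.ne', -Finset.sum_ite_eq]
  simp only [rpow_eq_exp]
  -- The scalar p(p - p⁻³) equals q^{1/2} - q^{-1/2}; the multiplier collects the other factors of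
  -- the J_- term.
  linear_combination (norm := skip) (Real.exp (Real.log q * (-1 / 4 + (∑ x ∈ Finset.Ioo i j,
    z (x, true)) / 4 - (∑ x ∈ Finset.Ioo i j, z (x, false)) / 4 + z (j, true) / 2 +
    z (j, false) / 4 + z (i, true) / 4)) * qNum q (z (j, false))) * exp_sub_exp_mul_qNum (q := q) (z (i, true))
  ring_nf
  simp only [exp_rules]
  ring_nf

/-- One summand of the third term for each leg k between: with the prefactor q^{-(N_a + N_b)/4}
moved over, the factors q^{∓J_z/2} become powers of N_b alone before k and of N_a alone after k. -/
lemma change_up_c {k : Fin N} (hk : k ∈ Finset.Ioo i j) :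
    ((-(braidCoef 𝕜 q * quarter 𝕜 q)) • (spinorT q i true * spinorTt q j true * legKi q i *
      (segKi q (Finset.Ioo i k) * legJm q k * segK q (Finset.Ioo k j))) : Op 𝕜 N) =
    qPow q (fun n => (-(∑ l ∈ Finset.Ioo i j, nLeg l n) + nLeg j n) / 4) *
    ((q ^ (-1 / 4 : ℝ) - q ^ (3 / 4 : ℝ) : ℝ) : 𝕜) • (
      qPow q (fun n => (nA k n + 2 * (∑ l ∈ Finset.Ioo k j, nA l n) + nA j n) / 4) *
        (aDag q i * aOp q k) *
        qPow q (fun n => (nB i n + 2 * (∑ l ∈ Finset.Ioo i k, nB l n) + nB k n) / 4) *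
        (bDag q k * bOp q j)) := by
  obtain ⟨h1, h2⟩ := Finset.mem_Ioo.mp hk
  have hij := h1.trans h2
  have hS : Finset.Ioo i j = Finset.Ioo i k ∪ ({k} ∪ Finset.Ioo k j) := by
    ext l; simp only [Finset.mem_union, Finset.mem_singleton, Finset.mem_Ioo]; omega
  have hd1 : Disjoint (Finset.Ioo i k) ({k} ∪ Finset.Ioo k j) := by
    rw [Finset.disjoint_left]
    simp only [Finset.mem_union, Finset.mem_singleton, Finset.mem_Ioo]; omega
  have hd2 : Disjoint {k} (Finset.Ioo k j) := by simp
  simp only [scalar_casts, hS, Finset.sum_union hd1, Finset.sum_union hd2, Finset.sum_singleton]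
  refine IsMono.ext (q := q) inferInstance inferInstance (by abel) fun z => ?_
  simp [Finset.sum_add_distrib, Finset.sum_sub_distrib, ← Finset.sum_div, sum_single_mode,
    hij.ne, hij.ne', h1.ne, h1.ne', h2.ne, h2.ne', h1.le, h1.not_gt, h2.not_gt, -Finset.sum_ite_eq]
  simp only [rpow_eq_exp]
  ring_nf
  simp only [exp_rules]
  ring_nf

/-- Here T̃_- and J_- T̃_+ on the leg i merge, by the same identity for [N_{b_i}]. -/
lemma change_down_a (h : i < j) :
    ((-quarter 𝕜 q) •
        (spinorT q j true * legK q i * segK q (Finset.Ioo i j) * spinorTt q i false) +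
      ((quarter 𝕜 q)⁻¹ * braidCoef 𝕜 q) •
        (spinorT q j true * legJm q i * segK q (Finset.Ioo i j) * spinorTt q i true) : Op 𝕜 N) =
    qPow q (fun n => (2 * nLeg i n + ∑ l ∈ Finset.Ioo i j, nLeg l n) / 4) *
      (aOp q i * aDag q j *
        qPow q (fun n => (nB i n - 2 * (∑ l ∈ Finset.Ioo i j, nB l n) - nB j n) / 4)) *
      qPow q (fun n => nLeg j n / 4) := by
  simp only [scalar_casts]
  refine (IsMono.ext_add (q := q) inferInstance inferInstance inferInstance (by abel) (by abel)
    fun z => ?_).symm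
  simp [Finset.sum_add_distrib, Finset.sum_sub_distrib, ← Finset.sum_div, sum_single_mode,
    h.ne, h.ne', -Finset.sum_ite_eq]
  simp only [rpow_eq_exp]
  linear_combination (norm := skip) -(Real.exp (Real.log q * (-1 / 2 + (∑ x ∈ Finset.Ioo i j,
    z (x, true)) / 4 - (∑ x ∈ Finset.Ioo i j, z (x, false)) / 4 + z (j, true) / 4 +
    z (i, false) / 4 + z (i, true) / 2)) * qNum q (z (i, true))) *
    exp_sub_exp_mul_qNum (q := q) (z (i, false))
  ring_nf
  simp only [exp_rules]
  ring_nf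

lemma change_down_b (h : i < j) :
    ((quarter 𝕜 q)⁻¹ •
      (spinorT q j false * legKi q i * segKi q (Finset.Ioo i j) * spinorTt q i true) : Op 𝕜 N) =
    qPow q (fun n => (2 * nLeg i n + ∑ l ∈ Finset.Ioo i j, nLeg l n) / 4) *
      (qPow q (fun n => (-nA i n - 2 * (∑ l ∈ Finset.Ioo i j, nA l n) + nA j n) / 4) *
        (bOp q i * bDag q j)) * qPow q (fun n => nLeg j n / 4) := by
  simp only [scalar_casts]
  refine IsMono.ext (q := q) inferInstance inferInstance (by abel) fun z => ?_
  simp [Finset.sum_add_distrib, Finset.sum_sub_distrib, ← Finset.sum_div, sum_single_mode,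
    h.ne, h.ne', -Finset.sum_ite_eq]
  simp only [rpow_eq_exp]
  ring_nf
  simp only [exp_rules]
  ring_nf

lemma change_down_c {k : Fin N} (hk : k ∈ Finset.Ioo i j) :
    (((quarter 𝕜 q)⁻¹ * braidCoef 𝕜 q) • (spinorT q j true * legKi q i *
      (segKi q (Finset.Ioo i k) * legJm q k * segK q (Finset.Ioo k j)) * spinorTt q i true) :
        Op 𝕜 N) =
    qPow q (fun n => (2 * nLeg i n + ∑ l ∈ Finset.Ioo i j, nLeg l n) / 4) *
    (((q ^ (1 / 4 : ℝ) - q ^ (-3 / 4 : ℝ) : ℝ) : 𝕜) • (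
      qPow q (fun n => (-nA i n - 2 * (∑ l ∈ Finset.Ioo i k, nA l n) - nA k n) / 4) *
        (aDag q j * aOp q k) *
        qPow q (fun n => (-nB k n - 2 * (∑ l ∈ Finset.Ioo k j, nB l n) - nB j n) / 4) *
        (bDag q k * bOp q i))) * qPow q (fun n => nLeg j n / 4) := by
  obtain ⟨h1, h2⟩ := Finset.mem_Ioo.mp hk
  have hij := h1.trans h2
  have hS : Finset.Ioo i j = Finset.Ioo i k ∪ ({k} ∪ Finset.Ioo k j) := by
    ext l; simp only [Finset.mem_union, Finset.mem_singleton, Finset.mem_Ioo]; omega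
  have hd1 : Disjoint (Finset.Ioo i k) ({k} ∪ Finset.Ioo k j) := by
    rw [Finset.disjoint_left]
    simp only [Finset.mem_union, Finset.mem_singleton, Finset.mem_Ioo]; omega
  have hd2 : Disjoint {k} (Finset.Ioo k j) := by simp
  simp only [scalar_casts, hS, Finset.sum_union hd1, Finset.sum_union hd2, Finset.sum_singleton]
  refine IsMono.ext (q := q) inferInstance inferInstance (by abel) fun z => ?_
  simp [Finset.sum_add_distrib, Finset.sum_sub_distrib, ← Finset.sum_div, sum_single_mode,
    hij.ne, hij.ne', h1.ne, h1.ne', h2.ne, h2.ne', h1.le, h1.not_gt, h2.not_gt, -Finset.sum_ite_eq]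
  simp only [rpow_eq_exp]
  ring_nf
  simp only [exp_rules]
  ring_nf

lemma segJ_Ioo (J : Fin N → Op 𝕜 N) (i j : Fin N) : segJ q J (Finset.Ioo i j) =
    ∑ k ∈ Finset.Ioo i j, segKi q (Finset.Ioo i k) * J k * segK q (Finset.Ioo k j) := by
  refine Finset.sum_congr rfl fun k hk => ?_
  obtain ⟨h1, h2⟩ := Finset.mem_Ioo.mp hk
  have e1 : (Finset.Ioo i j).filter (· < k) = Finset.Ioo i k := by
    ext l; simp only [Finset.mem_filter, Finset.mem_Ioo]; omega
  have e2 : (Finset.Ioo i j).filter (k < ·) = Finset.Ioo k j := by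
    ext l; simp only [Finset.mem_filter, Finset.mem_Ioo]; omega
  rw [e1, e2]

lemma scriptE_lt_eq (h : i < j) : (scriptE q i j : Op 𝕜 N) =
    qPow q (fun n => (-(∑ l ∈ Finset.Ioo i j, nLeg l n) + nLeg j n) / 4) * frakE q i j := by
  rw [scriptE_lt h, change_up_a h, change_up_b h, frakE, if_pos h, frakUp, mul_add, mul_add,
    segJ_Ioo, Finset.mul_sum, Finset.smul_sum, Finset.smul_sum, Finset.mul_sum]
  congr 1
  exact Finset.sum_congr rfl fun k hk => change_up_c hk

lemma scriptE_gt_eq (h : i < j) : (scriptE q j i : Op 𝕜 N) =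
    qPow q (fun n => (2 * nLeg i n + ∑ l ∈ Finset.Ioo i j, nLeg l n) / 4) * frakE q j i *
      qPow q (fun n => nLeg j n / 4) := by
  rw [scriptE_gt h, change_down_a h, change_down_b h, frakE, if_neg h.not_gt, if_pos h, frakDown,
    mul_add, mul_add, add_mul, add_mul, segJ_Ioo, Finset.mul_sum, Finset.sum_mul, Finset.smul_sum,
    Finset.smul_sum, Finset.mul_sum, Finset.sum_mul]
  congr 1
  exact Finset.sum_congr rfl fun k hk => change_down_c hk

end
end QIntertwiner

end

noncomputable section

namespace QIntertwiner

variable {𝕜 : Type*} [RCLike 𝕜] {N : ℕ} {q : ℝ}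

/-! ### The simple generators -/

/-- The first term of `frakUp`. -/
abbrev upA (𝕜 : Type*) [RCLike 𝕜] (q : ℝ) (i j : Fin N) : Op 𝕜 N :=
  aDag q i * aOp q j *
    qPow q (fun n => (nB i n + 2 * (∑ l ∈ Finset.Ioo i j, nB l n) - nB j n) / 4)

/-- The second term of `frakUp`. -/
abbrev upB (𝕜 : Type*) [RCLike 𝕜] (q : ℝ) (i j : Fin N) : Op 𝕜 N :=
  qPow q (fun n => (-nA i n + 2 * (∑ l ∈ Finset.Ioo i j, nA l n) + nA j n) / 4) *
    (bDag q i * bOp q j)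

/-- The summands of the third term of `frakUp`. -/
abbrev upC (𝕜 : Type*) [RCLike 𝕜] (q : ℝ) (i k j : Fin N) : Op 𝕜 N :=
  qPow q (fun n => (nA k n + 2 * (∑ l ∈ Finset.Ioo k j, nA l n) + nA j n) / 4) *
    (aDag q i * aOp q k) *
    qPow q (fun n => (nB i n + 2 * (∑ l ∈ Finset.Ioo i k, nB l n) + nB k n) / 4) *
    (bDag q k * bOp q j)

/-- The first term of `frakDown`. -/
abbrev downA (𝕜 : Type*) [RCLike 𝕜] (q : ℝ) (i j : Fin N) : Op 𝕜 N :=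
  aOp q i * aDag q j *
    qPow q (fun n => (nB i n - 2 * (∑ l ∈ Finset.Ioo i j, nB l n) - nB j n) / 4)

/-- The second term of `frakDown`. -/
abbrev downB (𝕜 : Type*) [RCLike 𝕜] (q : ℝ) (i j : Fin N) : Op 𝕜 N :=
  qPow q (fun n => (-nA i n - 2 * (∑ l ∈ Finset.Ioo i j, nA l n) + nA j n) / 4) *
    (bOp q i * bDag q j)

/-- The summands of the third term of `frakDown`. -/
abbrev downC (𝕜 : Type*) [RCLike 𝕜] (q : ℝ) (i k j : Fin N) : Op 𝕜 N :=
  qPow q (fun n => (-nA i n - 2 * (∑ l ∈ Finset.Ioo i k, nA l n) - nA k n) / 4) *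
    (aDag q j * aOp q k) *
    qPow q (fun n => (-nB k n - 2 * (∑ l ∈ Finset.Ioo k j, nB l n) - nB j n) / 4) *
    (bDag q k * bOp q i)

lemma frakE_eq_up {i j : Fin N} (h : i < j) : (frakE q i j : Op 𝕜 N) =
    upA 𝕜 q i j + upB 𝕜 q i j + ((q ^ (-1 / 4 : ℝ) - q ^ (3 / 4 : ℝ) : ℝ) : 𝕜) •
      ∑ k ∈ Finset.Ioo i j, upC 𝕜 q i k j := by
  rw [frakE, if_pos h, frakUp]

lemma frakE_eq_down {i j : Fin N} (h : i < j) : (frakE q j i : Op 𝕜 N) =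
    downA 𝕜 q i j + downB 𝕜 q i j + ((q ^ (1 / 4 : ℝ) - q ^ (-3 / 4 : ℝ) : ℝ) : 𝕜) •
      ∑ k ∈ Finset.Ioo i j, downC 𝕜 q i k j := by
  rw [frakE, if_neg h.not_gt, if_pos h, frakDown]

lemma Ioo_succ_eq_empty {i i' : Fin N} (h : i.val + 1 = i'.val) : Finset.Ioo i i' = ∅ := by
  ext l; simp only [Finset.mem_Ioo, Finset.notMem_empty, iff_false, Fin.lt_def]; omega

lemma frakE_raise {i i' : Fin N} (h : i.val + 1 = i'.val) : (frakE q i i' : Op 𝕜 N) =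
    upA 𝕜 q i i' + upB 𝕜 q i i' := by
  rw [frakE_eq_up (Fin.lt_def.mpr (by omega)), Ioo_succ_eq_empty h, Finset.sum_empty, smul_zero,
    add_zero]

lemma frakE_lower {i i' : Fin N} (h : i.val + 1 = i'.val) : (frakE q i' i : Op 𝕜 N) =
    downA 𝕜 q i i' + downB 𝕜 q i i' := by
  rw [frakE_eq_down (Fin.lt_def.mpr (by omega)), Ioo_succ_eq_empty h, Finset.sum_empty, smul_zero,
    add_zero]

lemma frakE_self (i : Fin N) : (frakE q i i : Op 𝕜 N) = diag (nLeg i) := by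
  rw [frakE, if_neg (lt_irrefl i), if_neg (lt_irrefl i)]

section
variable [hq : Fact (0 < q)] [hq1 : Fact (q ≠ 1)]

/-- Jordan–Schwinger realization on the modes a_i and a_j, with (N_{a_i} - N_{a_j})/2 as J_z. -/
lemma isTriple_hopA {i j : Fin N} (h : i ≠ j) :
    IsTriple (quarter 𝕜 q) (aDag q i * aOp q j : Op 𝕜 N) (aOp q i * aDag q j)
      (qPow q fun n => (nA i n - nA j n) / 4) (qPow q fun n => (-nA i n + nA j n) / 4) := by
  constructor
  case bracket =>
    rw [qDen_eq_quarter]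
    refine IsMono.ext_add (q := q) inferInstance inferInstance inferInstance (by abel) (by abel)
      fun z => ?_
    have h := qNum_mul_sub (q := q) (z (i, true)) (z (j, true))
    rw [qNum_eq_exp q (_ - _)] at h
    simp only [← sub_eq_iff_eq_add']
    simp [h.symm, ‹i ≠ j›, ‹i ≠ j›.symm]
    simp only [rpow_eq_exp, exp_rules]
    ring_nf at h ⊢
    linear_combination h
  all_goals
    try simp only [quarter_casts]
    refine IsMono.ext (q := q) inferInstance inferInstance (by abel) fun z => ?_
    simp [h, h.symm]
    simp only [rpow_eq_exp]
    ring_nf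
    simp only [exp_rules]
    ring_nf
    try simp

lemma isTriple_hopB {i j : Fin N} (h : i ≠ j) :
    IsTriple (quarter 𝕜 q) (bDag q i * bOp q j : Op 𝕜 N) (bOp q i * bDag q j)
      (qPow q fun n => (nB i n - nB j n) / 4) (qPow q fun n => (-nB i n + nB j n) / 4) := by
  constructor
  case bracket =>
    rw [qDen_eq_quarter]
    refine IsMono.ext_add (q := q) inferInstance inferInstance inferInstance (by abel) (by abel)
      fun z => ?_
    have h := qNum_mul_sub (q := q) (z (i, false)) (z (j, false))
    rw [qNum_eq_exp q (_ - _)] at h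
    simp only [← sub_eq_iff_eq_add']
    simp [h.symm, ‹i ≠ j›, ‹i ≠ j›.symm]
    simp only [rpow_eq_exp, exp_rules]
    ring_nf at h ⊢
    linear_combination h
  all_goals
    try simp only [quarter_casts]
    refine IsMono.ext (q := q) inferInstance inferInstance (by abel) fun z => ?_
    simp [h, h.symm]
    simp only [rpow_eq_exp]
    ring_nf
    simp only [exp_rules]
    ring_nf
    try simp

lemma commute_hop (i j : Fin N) :
    CommuteAll (bDag q i * bOp q j : Op 𝕜 N) (bOp q i * bDag q j)
      (qPow q fun n => (nB i n - nB j n) / 4) (qPow q fun n => (-nB i n + nB j n) / 4)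
      (aDag q i * aOp q j) ∧
    CommuteAll (bDag q i * bOp q j : Op 𝕜 N) (bOp q i * bDag q j)
      (qPow q fun n => (nB i n - nB j n) / 4) (qPow q fun n => (-nB i n + nB j n) / 4)
      (aOp q i * aDag q j) ∧
    CommuteAll (bDag q i * bOp q j : Op 𝕜 N) (bOp q i * bDag q j)
      (qPow q fun n => (nB i n - nB j n) / 4) (qPow q fun n => (-nB i n + nB j n) / 4)
      (qPow q fun n => (nA i n - nA j n) / 4) ∧
    CommuteAll (bDag q i * bOp q j : Op 𝕜 N) (bOp q i * bDag q j)
      (qPow q fun n => (nB i n - nB j n) / 4) (qPow q fun n => (-nB i n + nB j n) / 4)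
      (qPow q fun n => (-nA i n + nA j n) / 4) := by
  refine ⟨?_, ?_, ?_, ?_⟩
  all_goals
    constructor
    all_goals
      refine IsMono.ext (q := q) inferInstance inferInstance (by abel) fun z => ?_
      simp
      try ring_nf

/-- The simple generators of one pair of legs form a `U_q(su(2))`. -/
lemma isTriple_frakE {i i' : Fin N} (h : i.val + 1 = i'.val) :
    IsTriple (quarter 𝕜 q) (frakE q i i' : Op 𝕜 N) (frakE q i' i)
      ((qPow q fun n => (nA i n - nA i' n) / 4) * (qPow q fun n => (nB i n - nB i' n) / 4))
      ((qPow q fun n => (-nA i n + nA i' n) / 4) * (qPow q fun n => (-nB i n + nB i' n) / 4)) := by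
  have hne : i ≠ i' := by rintro rfl; omega
  obtain ⟨c1, c2, c3, c4⟩ := commute_hop (𝕜 := 𝕜) (q := q) i i'
  -- The a-term is hop ⊗ K and the b-term is K⁻¹ ⊗ hop, so their sum is the coproduct of the hops.
  have := IsTriple.coproduct (quarter_ne_zero (𝕜 := 𝕜) (q := q)) (isTriple_hopA hne)
    (isTriple_hopB hne) c1 c2 c3 c4
  rw [frakE_raise h, frakE_lower h, upA, upB, downA, downB, Ioo_succ_eq_empty h]
  simpa only [Finset.sum_empty, mul_zero, add_zero, sub_zero] using this

lemma frakE_bracket {i i' : Fin N} (h : i.val + 1 = i'.val) :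
    (frakE q i i' * frakE q i' i - frakE q i' i * frakE q i i' : Op 𝕜 N) =
    (((q ^ (1 / 2 : ℝ) - q ^ (-1 / 2 : ℝ))⁻¹ : ℝ) : 𝕜) •
      ((qPow q fun n => nLeg i n / 4) ^ 2 * (qPow q fun n => -nLeg i' n / 4) ^ 2 -
        (qPow q fun n => -nLeg i n / 4) ^ 2 * (qPow q fun n => nLeg i' n / 4) ^ 2) := by
  have hb := (isTriple_frakE (𝕜 := 𝕜) (q := q) h).bracket
  rw [qDen_eq_quarter, qDen] at hb
  rw [hb]
  simp only [sq, qPow_mul_qPow hq.out]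
  have e : ∀ A B : Op 𝕜 N, A + B - A = B := fun A B => add_sub_cancel_left A B
  rw [e]
  congr 2
  · congr 1; funext n; simp only [nLeg]; ring
  · congr 1; funext n; simp only [nLeg]; ring

end
end QIntertwiner

end

noncomputable section

namespace QIntertwiner

variable {𝕜 : Type*} [RCLike 𝕜] {N : ℕ} {q : ℝ}

/-! ### Weights, commutators and `q`-Serre relations of the simple generators -/

section Algebra

variable {F A : Type*} [Field F] [Ring A] [Algebra F A] {s w c : F} {K x x' y y' z z' : A}

/-- `K (x y - s y x) = z`. -/
def IsStep (s : F) (K x y z : A) : Prop := K * (x * y) = z + s • (K * (y * x))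

lemma IsStep.eq (h : IsStep s K x y z) : z = K * (x * y - s • (y * x)) := by
  rw [mul_sub, mul_smul_comm, h, add_sub_cancel_right]

/-- The q-commutator is bilinear, so it can be evaluated on monomials and reassembled. `IsStep`
avoids subtraction in order to match `IsMono.ext_add`. -/
lemma IsStep.add_left (h : IsStep s K x y z) (h' : IsStep s K x' y z') :
    IsStep s K (x + x') y (z + z') := by
  simp only [IsStep, add_mul, mul_add] at *
  rw [h, h', smul_add]; abel

lemma IsStep.add_right (h : IsStep s K x y z) (h' : IsStep s K x y' z') :
    IsStep s K x (y + y') (z + z') := by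
  simp only [IsStep, add_mul, mul_add] at *
  rw [h, h', smul_add]; abel

lemma IsStep.smul_left (c : F) (h : IsStep s K x y z) : IsStep s K (c • x) y (c • z) := by
  simp only [IsStep, smul_mul_assoc, mul_smul_comm] at *
  rw [h, smul_add, smul_comm]

lemma IsStep.smul_right (c : F) (h : IsStep s K x y z) : IsStep s K x (c • y) (c • z) := by
  simp only [IsStep, smul_mul_assoc, mul_smul_comm] at *
  rw [h, smul_add, smul_comm]

lemma IsStep.sum_left {ι : Type*} {S : Finset ι} {f g : ι → A}
    (h : ∀ k ∈ S, IsStep s K (f k) y (g k)) : IsStep s K (∑ k ∈ S, f k) y (∑ k ∈ S, g k) := by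
  simp only [IsStep, Finset.sum_mul, Finset.mul_sum, Finset.smul_sum] at *
  rw [← Finset.sum_add_distrib]
  exact Finset.sum_congr rfl h

lemma IsStep.sum_right {ι : Type*} {S : Finset ι} {f g : ι → A}
    (h : ∀ k ∈ S, IsStep s K x (f k) (g k)) : IsStep s K x (∑ k ∈ S, f k) (∑ k ∈ S, g k) := by
  simp only [IsStep, Finset.sum_mul, Finset.mul_sum, Finset.smul_sum] at *
  rw [← Finset.sum_add_distrib]
  exact Finset.sum_congr rfl h

lemma mul_add_eq_smul (h : K * x = c • (x * K)) (h' : K * y = c • (y * K)) :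
    K * (x + y) = c • ((x + y) * K) := by
  rw [mul_add, add_mul, smul_add, h, h']

lemma mul_add_eq_smul_add (h : K * x = c • x + x * K) (h' : K * y = c • y + y * K) :
    K * (x + y) - (x + y) * K = c • (x + y) := by
  rw [mul_add, add_mul, smul_add, h, h']; abel

lemma add_mul_add_comm (h1 : x * y = y * x) (h2 : x * y' = y' * x) (h3 : x' * y = y * x')
    (h4 : x' * y' = y' * x') : (x + x') * (y + y') - (y + y') * (x + x') = 0 := by
  simp only [mul_add, add_mul, h1, h2, h3, h4]; abel

lemma sub_add_eq_zero_of_eq (h : z = x + y) : x - z + y = 0 := by rw [h]; abel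

/-- The Serre relation is symmetric under p ↦ p⁻¹; the monomials of the lowering generators
q-commute with the inverse factors. -/
lemma serre_add_inv {p : F} (hp : p ≠ 0) {u v u' v' : A}
    (hu : u * (u * u') - (p ^ 2 + (p⁻¹) ^ 2) • (u * (u' * u)) + u' * (u * u) = 0)
    (hv : v * (v * v') - (p ^ 2 + (p⁻¹) ^ 2) • (v * (v' * v)) + v' * (v * v) = 0)
    (huv : u * v = (p⁻¹) ^ 4 • (v * u)) (huv' : u * v' = p ^ 2 • (v' * u))
    (hu'v : u' * v = p ^ 2 • (v * u')) :
    (u + v) ^ 2 * (u' + v') - (p ^ 2 + (p⁻¹) ^ 2) • ((u + v) * (u' + v') * (u + v)) +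
      (u' + v') * (u + v) ^ 2 = 0 := by
  have := serre_add (inv_ne_zero hp) (u := u) (v := v) (u' := u') (v' := v')
    (by rwa [inv_inv, add_comm (p⁻¹ ^ 2)]) (by rwa [inv_inv, add_comm (p⁻¹ ^ 2)]) huv
    (by rwa [inv_inv]) (by rwa [inv_inv])
  rwa [inv_inv, add_comm (p⁻¹ ^ 2)] at this

end Algebra

section
variable [hq : Fact (0 < q)] [hq1 : Fact (q ≠ 1)]

lemma diag_mul_raise (i : Fin N) {j k : Fin N} (h : j.val + 1 = k.val) :
    (diag (nLeg i) * frakE q j k - frakE q j k * diag (nLeg i) : Op 𝕜 N) =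
      ((weight i j k : ℝ) : 𝕜) • frakE q j k := by
  rw [frakE_raise h]
  refine mul_add_eq_smul_add (F := 𝕜) (A := Op 𝕜 N) ?_ ?_
  all_goals
    refine IsMono.ext_add (q := q) inferInstance inferInstance inferInstance (by abel) (by abel)
      fun z => ?_
    simp [Ioo_succ_eq_empty h, Pi.single_apply, weight]
    split_ifs <;> ring

lemma diag_mul_lower (i : Fin N) {j k : Fin N} (h : j.val + 1 = k.val) :
    (diag (nLeg i) * frakE q k j - frakE q k j * diag (nLeg i) : Op 𝕜 N) =
      ((weight i k j : ℝ) : 𝕜) • frakE q k j := by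
  rw [frakE_lower h]
  refine mul_add_eq_smul_add (F := 𝕜) (A := Op 𝕜 N) ?_ ?_
  all_goals
    refine IsMono.ext_add (q := q) inferInstance inferInstance inferInstance (by abel) (by abel)
      fun z => ?_
    simp [Ioo_succ_eq_empty h, Pi.single_apply, weight]
    split_ifs <;> ring

lemma qPow_mul_raise (i : Fin N) {j k : Fin N} (h : j.val + 1 = k.val) :
    (qPow q (fun n => nLeg i n / 4) * frakE q j k : Op 𝕜 N) =
      ((q ^ (weight i j k / 4) : ℝ) : 𝕜) • (frakE q j k * qPow q (fun n => nLeg i n / 4)) := by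
  rw [frakE_raise h]
  refine mul_add_eq_smul (F := 𝕜) (A := Op 𝕜 N) ?_ ?_
  all_goals
    refine IsMono.ext (q := q) inferInstance inferInstance (by abel) fun z => ?_
    simp [Ioo_succ_eq_empty h, Pi.single_apply, weight]
    simp only [rpow_eq_exp]
    split_ifs <;> (ring_nf; simp only [exp_rules]; ring_nf)

lemma qPow_mul_lower (i : Fin N) {j k : Fin N} (h : j.val + 1 = k.val) :
    (qPow q (fun n => nLeg i n / 4) * frakE q k j : Op 𝕜 N) =
      ((q ^ (weight i k j / 4) : ℝ) : 𝕜) • (frakE q k j * qPow q (fun n => nLeg i n / 4)) := by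
  rw [frakE_lower h]
  refine mul_add_eq_smul (F := 𝕜) (A := Op 𝕜 N) ?_ ?_
  all_goals
    refine IsMono.ext (q := q) inferInstance inferInstance (by abel) fun z => ?_
    simp [Ioo_succ_eq_empty h, Pi.single_apply, weight]
    simp only [rpow_eq_exp]
    split_ifs <;> (ring_nf; simp only [exp_rules]; ring_nf)

/-- If the two pairs share a leg, both generators raise it or both lower it; the powers of q then
give equal factors in the two orders. -/
lemma raise_lower_commute {i i' j j' : Fin N} (hi : i.val + 1 = i'.val) (hj : j.val + 1 = j'.val)
    (hij : i ≠ j) :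
    (frakE q i i' * frakE q j' j - frakE q j' j * frakE q i i' : Op 𝕜 N) = 0 := by
  have h1 : i ≠ i' := by rintro rfl; omega
  have h2 : j ≠ j' := by rintro rfl; omega
  have h3 : i' ≠ j' := by rintro rfl; omega
  rw [frakE_raise hi, frakE_lower hj]
  refine add_mul_add_comm (A := Op 𝕜 N) ?_ ?_ ?_ ?_
  all_goals
    refine IsMono.ext (q := q) inferInstance inferInstance (by abel) fun z => ?_
    rcases eq_or_ne i' j with rfl | h4
    · have h5 : i ≠ j' := by rintro rfl; omega
      simp [Ioo_succ_eq_empty hi, Ioo_succ_eq_empty hj, h1, h1.symm, h2, h2.symm, h5, h5.symm]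
      try simp only [rpow_eq_exp]
      try ring_nf
      try simp only [exp_rules]
      try ring_nf
    · rcases eq_or_ne i j' with rfl | h5
      · simp [Ioo_succ_eq_empty hi, Ioo_succ_eq_empty hj, h1, h1.symm, h2, h2.symm, h4, h4.symm]
        try simp only [rpow_eq_exp]
        try ring_nf
        try simp only [exp_rules]
        try ring_nf
      · simp [Ioo_succ_eq_empty hi, Ioo_succ_eq_empty hj, h1, h1.symm, h2, h2.symm, h3, h3.symm,
          h4, h4.symm, h5, h5.symm, hij, hij.symm]
        try ring_nf

lemma raise_commute {i i' j j' : Fin N} (hi : i.val + 1 = i'.val) (hj : j.val + 1 = j'.val)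
    (hij : i' < j) :
    (frakE q i i' * frakE q j j' - frakE q j j' * frakE q i i' : Op 𝕜 N) = 0 := by
  have h1 : i ≠ j := by rintro rfl; omega
  have h2 : i ≠ j' := by rintro rfl; omega
  have h3 : i' ≠ j' := by rintro rfl; omega
  rw [frakE_raise hi, frakE_raise hj]
  refine add_mul_add_comm (A := Op 𝕜 N) ?_ ?_ ?_ ?_
  all_goals
    refine IsMono.ext (q := q) inferInstance inferInstance (by abel) fun z => ?_
    simp [Ioo_succ_eq_empty hi, Ioo_succ_eq_empty hj, h1, h1.symm, h2, h2.symm, h3, h3.symm,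
      hij.ne, hij.ne']
    ring_nf

lemma lower_commute {i i' j j' : Fin N} (hi : i.val + 1 = i'.val) (hj : j.val + 1 = j'.val)
    (hij : i' < j) :
    (frakE q i' i * frakE q j' j - frakE q j' j * frakE q i' i : Op 𝕜 N) = 0 := by
  have h1 : i ≠ j := by rintro rfl; omega
  have h2 : i ≠ j' := by rintro rfl; omega
  have h3 : i' ≠ j' := by rintro rfl; omega
  rw [frakE_lower hi, frakE_lower hj]
  refine add_mul_add_comm (A := Op 𝕜 N) ?_ ?_ ?_ ?_
  all_goals
    refine IsMono.ext (q := q) inferInstance inferInstance (by abel) fun z => ?_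
    simp [Ioo_succ_eq_empty hi, Ioo_succ_eq_empty hj, h1, h1.symm, h2, h2.symm, h3, h3.symm,
      hij.ne, hij.ne']
    ring_nf

/-- The q-Serre relation of a single hop comes down to this recursion: the neighbouring hop acts
before, between or after the two equal ones, so the occupation of the shared mode varies by one. -/
lemma qNum_add_one_add_sub_one (x : ℝ) : qNum q (x + 1) + qNum q (x - 1) =
    (Real.exp (Real.log q * (1 / 2)) + Real.exp (Real.log q * (-1 / 2))) * qNum q x := by
  have h := qNum_add_one (q := q) (x - 1)
  rw [sub_add_cancel] at h
  have e1 : Real.exp (Real.log q * (-1 / 2)) * Real.exp (Real.log q * (1 / 2)) = 1 := by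
    rw [← Real.exp_add, ← Real.exp_zero]; ring_nf
  have e2 : Real.exp (Real.log q * (-1 / 2)) * Real.exp (Real.log q * (-(x - 1) / 2)) =
      Real.exp (Real.log q * (-x / 2)) := by
    rw [← Real.exp_add]; ring_nf
  rw [qNum_add_one]
  linear_combination -Real.exp (Real.log q * (-1 / 2)) * h - qNum q (x - 1) * e1 - e2

lemma qNum_two : qNum q 2 = q ^ (1 / 2 : ℝ) + q ^ (-1 / 2 : ℝ) := by
  have h1 := qNum_add_one_add_sub_one (q := q) 1
  have h2 : qNum q 1 = 1 := by
    have := qNum_add_one (q := q) 0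
    simpa [qNum_zero] using this
  norm_num [h2, qNum_zero] at h1
  rw [h1, rpow_eq_exp, rpow_eq_exp]
  norm_num

lemma qNum_neg_one_add (x : ℝ) :
    qNum q (-1 + x) = qNum q 2 * qNum q x - qNum q (1 + x) := by
  have h := qNum_add_one_add_sub_one (q := q) x
  rw [qNum_two, rpow_eq_exp, rpow_eq_exp, ← h]
  ring_nf

lemma qNum_two_add (x : ℝ) :
    qNum q (2 + x) = qNum q 2 * qNum q (1 + x) - qNum q x := by
  have h := qNum_neg_one_add (q := q) (1 + x)
  ring_nf at h ⊢
  linear_combination h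

lemma qNum_two_eq_quarter :
    ((qNum q 2 : ℝ) : 𝕜) = quarter 𝕜 q ^ 2 + (quarter 𝕜 q)⁻¹ ^ 2 := by
  simp only [quarter_casts, qNum_two, rpow_eq_exp, exp_rules]
  push_cast
  ring_nf

lemma quarter_scalars : quarter 𝕜 q ^ 4 = ((Real.exp (Real.log q) : ℝ) : 𝕜) ∧
    (quarter 𝕜 q)⁻¹ ^ 4 = ((Real.exp (-Real.log q) : ℝ) : 𝕜) ∧
    quarter 𝕜 q ^ 2 = ((q ^ (1 / 2 : ℝ) : ℝ) : 𝕜) ∧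
    (quarter 𝕜 q)⁻¹ ^ 2 = ((q ^ (-1 / 2 : ℝ) : ℝ) : 𝕜) := by
  have e : quarter 𝕜 q = ((Real.exp (Real.log q * (1 / 4)) : ℝ) : 𝕜) := by
    rw [← rpow_eq_exp]; rfl
  have e' : (quarter 𝕜 q)⁻¹ = ((Real.exp (Real.log q * (-1 / 4)) : ℝ) : 𝕜) := by
    rw [e, ← RCLike.ofReal_inv, ← Real.exp_neg]; ring_nf
  rw [e', e]
  simp only [← RCLike.ofReal_pow, ← Real.exp_nat_mul, rpow_eq_exp]
  refine ⟨?_, ?_, ?_, ?_⟩ <;> push_cast <;> ring_nf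

/-- For each pure part the three orders have coefficients [z][z+1], [z][z], [z][z-1], with z the
occupation of the shared mode, since the squared generator annihilates there. -/
lemma serre_raise_right {i i' j j' : Fin N} (hi : i.val + 1 = i'.val) (hj : j.val + 1 = j'.val)
    (hij : i' = j) :
    (frakE q i i' ^ 2 * frakE q j j' - ((qNum q 2 : ℝ) : 𝕜) •
      (frakE q i i' * frakE q j j' * frakE q i i') + frakE q j j' * frakE q i i' ^ 2 : Op 𝕜 N) =
      0 := by
  subst hij
  have h1 : i ≠ i' := by rintro rfl; omega
  have h2 : i' ≠ j' := by rintro rfl; omega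
  have h3 : i ≠ j' := by rintro rfl; omega
  rw [qNum_two_eq_quarter, frakE_raise hi, frakE_raise hj]
  refine serre_add (A := Op 𝕜 N) quarter_ne_zero ?_ ?_ ?_ ?_ ?_
  iterate 2
    · refine sub_add_eq_zero_of_eq (A := Op 𝕜 N) ?_
      rw [← qNum_two_eq_quarter]
      refine IsMono.ext_add (q := q) inferInstance inferInstance inferInstance (by abel) (by abel)
        fun z => ?_
      simp [Ioo_succ_eq_empty hi, Ioo_succ_eq_empty hj, h1, h1.symm, h2, h2.symm, h3, h3.symm]
      simp only [rpow_eq_exp]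
      ring_nf
      simp only [exp_rules]
      ring_nf
      simp only [qNum_neg_one_add]
      ring_nf
      try simp only [sq, exp_rules]
      try ring_nf
  -- What remains are the q-commutation factors between a-hops and b-hops required by `serre_add`.
  all_goals
    simp only [quarter_scalars]
    refine IsMono.ext (q := q) inferInstance inferInstance (by abel) fun z => ?_
    simp [Ioo_succ_eq_empty hi, Ioo_succ_eq_empty hj, h1, h1.symm, h2, h2.symm, h3, h3.symm]
    simp only [rpow_eq_exp]
    ring_nf
    simp only [exp_rules]
    ring_nf

/-- Now the squared generator creates in the shared mode, and the coefficients are [z], [z+1],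
[z+2]. -/
lemma serre_raise_left {i i' j j' : Fin N} (hi : i.val + 1 = i'.val) (hj : j.val + 1 = j'.val)
    (hij : j' = i) :
    (frakE q i i' ^ 2 * frakE q j j' - ((qNum q 2 : ℝ) : 𝕜) •
      (frakE q i i' * frakE q j j' * frakE q i i') + frakE q j j' * frakE q i i' ^ 2 : Op 𝕜 N) =
      0 := by
  subst hij
  have h1 : j' ≠ i' := by rintro rfl; omega
  have h2 : j ≠ j' := by rintro rfl; omega
  have h3 : j ≠ i' := by rintro rfl; omega
  rw [qNum_two_eq_quarter, frakE_raise hi, frakE_raise hj]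
  refine serre_add (A := Op 𝕜 N) quarter_ne_zero ?_ ?_ ?_ ?_ ?_
  iterate 2
    · refine sub_add_eq_zero_of_eq (A := Op 𝕜 N) ?_
      rw [← qNum_two_eq_quarter]
      refine IsMono.ext_add (q := q) inferInstance inferInstance inferInstance (by abel) (by abel)
        fun z => ?_
      simp [Ioo_succ_eq_empty hi, Ioo_succ_eq_empty hj, h1, h1.symm, h2, h2.symm, h3, h3.symm]
      simp only [rpow_eq_exp]
      ring_nf
      simp only [exp_rules]
      ring_nf
      simp only [qNum_two_add]
      ring_nf
      try simp only [sq, exp_rules]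
      try ring_nf
  all_goals
    simp only [quarter_scalars]
    refine IsMono.ext (q := q) inferInstance inferInstance (by abel) fun z => ?_
    simp [Ioo_succ_eq_empty hi, Ioo_succ_eq_empty hj, h1, h1.symm, h2, h2.symm, h3, h3.symm]
    simp only [rpow_eq_exp]
    ring_nf
    simp only [exp_rules]
    ring_nf

/-- Lowering exchanges creation and annihilation on the shared leg, so the coefficients are those of
`serre_raise_left`. -/
lemma serre_lower_right {i i' j j' : Fin N} (hi : i.val + 1 = i'.val) (hj : j.val + 1 = j'.val)
    (hij : i' = j) :
    (frakE q i' i ^ 2 * frakE q j' j - ((qNum q 2 : ℝ) : 𝕜) •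
      (frakE q i' i * frakE q j' j * frakE q i' i) + frakE q j' j * frakE q i' i ^ 2 : Op 𝕜 N) =
      0 := by
  subst hij
  have h1 : i ≠ i' := by rintro rfl; omega
  have h2 : i' ≠ j' := by rintro rfl; omega
  have h3 : i ≠ j' := by rintro rfl; omega
  rw [qNum_two_eq_quarter, frakE_lower hi, frakE_lower hj]
  refine serre_add_inv (A := Op 𝕜 N) quarter_ne_zero ?_ ?_ ?_ ?_ ?_
  iterate 2
    · refine sub_add_eq_zero_of_eq (A := Op 𝕜 N) ?_
      rw [← qNum_two_eq_quarter]
      refine IsMono.ext_add (q := q) inferInstance inferInstance inferInstance (by abel) (by abel)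
        fun z => ?_
      simp [Ioo_succ_eq_empty hi, Ioo_succ_eq_empty hj, h1, h1.symm, h2, h2.symm, h3, h3.symm]
      simp only [rpow_eq_exp]
      ring_nf
      simp only [exp_rules]
      ring_nf
      simp only [qNum_two_add]
      ring_nf
      try simp only [sq, exp_rules]
      try ring_nf
  all_goals
    simp only [quarter_scalars]
    refine IsMono.ext (q := q) inferInstance inferInstance (by abel) fun z => ?_
    simp [Ioo_succ_eq_empty hi, Ioo_succ_eq_empty hj, h1, h1.symm, h2, h2.symm, h3, h3.symm]
    simp only [rpow_eq_exp]
    ring_nf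
    simp only [exp_rules]
    ring_nf

lemma serre_lower_left {i i' j j' : Fin N} (hi : i.val + 1 = i'.val) (hj : j.val + 1 = j'.val)
    (hij : j' = i) :
    (frakE q i' i ^ 2 * frakE q j' j - ((qNum q 2 : ℝ) : 𝕜) •
      (frakE q i' i * frakE q j' j * frakE q i' i) + frakE q j' j * frakE q i' i ^ 2 : Op 𝕜 N) =
      0 := by
  subst hij
  have h1 : j' ≠ i' := by rintro rfl; omega
  have h2 : j ≠ j' := by rintro rfl; omega
  have h3 : j ≠ i' := by rintro rfl; omega
  rw [qNum_two_eq_quarter, frakE_lower hi, frakE_lower hj]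
  refine serre_add_inv (A := Op 𝕜 N) quarter_ne_zero ?_ ?_ ?_ ?_ ?_
  iterate 2
    · refine sub_add_eq_zero_of_eq (A := Op 𝕜 N) ?_
      rw [← qNum_two_eq_quarter]
      refine IsMono.ext_add (q := q) inferInstance inferInstance inferInstance (by abel) (by abel)
        fun z => ?_
      simp [Ioo_succ_eq_empty hi, Ioo_succ_eq_empty hj, h1, h1.symm, h2, h2.symm, h3, h3.symm]
      simp only [rpow_eq_exp]
      ring_nf
      simp only [exp_rules]
      ring_nf
      simp only [qNum_neg_one_add]
      ring_nf
      try simp only [sq, exp_rules]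
      try ring_nf
  all_goals
    simp only [quarter_scalars]
    refine IsMono.ext (q := q) inferInstance inferInstance (by abel) fun z => ?_
    simp [Ioo_succ_eq_empty hi, Ioo_succ_eq_empty hj, h1, h1.symm, h2, h2.symm, h3, h3.symm]
    simp only [rpow_eq_exp]
    ring_nf
    simp only [exp_rules]
    ring_nf

end
end QIntertwiner

end

noncomputable section

namespace QIntertwiner

variable {𝕜 : Type*} [RCLike 𝕜] {N : ℕ} {q : ℝ}

/-! ### The inductive definition of the other generators -/

lemma IsStep.of_mul_eq {F A : Type*} [Field F] [Ring A] [Algebra F A] {s : F} {K x y : A}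
    (h : x * y = s • (y * x)) : IsStep s K x y 0 := by
  rw [IsStep, h, mul_smul_comm, zero_add]

lemma Ioo_eq_insert {i k j : Fin N} (hik : i < k) (h : k.val + 1 = j.val) :
    Finset.Ioo i j = insert k (Finset.Ioo i k) := by
  ext l; simp only [Finset.mem_Ioo, Finset.mem_insert]; omega

lemma sum_Ioo_succ {M : Type*} [AddCommMonoid M] {i k j : Fin N} (hik : i < k)
    (h : k.val + 1 = j.val) (f : Fin N → M) :
    ∑ l ∈ Finset.Ioo i j, f l = f k + ∑ l ∈ Finset.Ioo i k, f l := by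
  rw [Ioo_eq_insert hik h, Finset.sum_insert (by simp)]

section
variable [hq : Fact (0 < q)] [hq1 : Fact (q ≠ 1)] {i m k j : Fin N}

lemma qNum_one_add (x : ℝ) : qNum q (1 + x) =
    Real.exp (Real.log q * (1 / 2)) * qNum q x + Real.exp (Real.log q * (-x / 2)) := by
  rw [add_comm, qNum_add_one]

lemma qNum_one_add' (x : ℝ) : qNum q (1 + x) =
    Real.exp (Real.log q * (-1 / 2)) * qNum q x + Real.exp (Real.log q * (x / 2)) := by
  rw [add_comm, qNum_add_one']

/-- On the mode a_k, α α† - q^{1/2} α† α = q^{-N/2}; the prefactor q^{(N_a + N_b)/2} removes this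
power and supplies the new term of Σ N_b. -/
lemma step_upA_upA (hik : i < k) (h : k.val + 1 = j.val) :
    IsStep ((q ^ (1 / 2 : ℝ) : ℝ) : 𝕜) (qPow q fun n => nLeg k n / 2)
      (upA 𝕜 q i k) (upA 𝕜 q k j) (upA 𝕜 q i j) := by
  have hkj : k < j := Fin.lt_def.mpr (by omega)
  have hij := hik.trans hkj
  refine IsMono.ext_add (q := q) inferInstance inferInstance inferInstance (by abel) (by abel)
    fun z => ?_
  simp [Ioo_succ_eq_empty h, sum_Ioo_succ hik h, Finset.sum_add_distrib, Finset.sum_sub_distrib, sum_single_mode,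
    hik.ne, hik.ne', hkj.ne, hkj.ne', hij.ne, hij.ne', hik.not_gt, hkj.not_gt, hik.le, hkj.le, -Finset.sum_ite_eq]
  simp only [rpow_eq_exp]
  ring_nf
  simp only [exp_rules]
  ring_nf
  simp only [qNum_one_add]
  ring_nf
  simp only [exp_rules]
  ring_nf

/-- The factors use different modes of the leg k and satisfy x y = q^{-1/2} y x, so the q-commutator
does not vanish; it produces the summand for the new intermediate leg k. -/
lemma step_upA_upB (hik : i < k) (h : k.val + 1 = j.val) :
    IsStep ((q ^ (1 / 2 : ℝ) : ℝ) : 𝕜) (qPow q fun n => nLeg k n / 2)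
      (upA 𝕜 q i k) (upB 𝕜 q k j) (((q ^ (-1 / 4 : ℝ) - q ^ (3 / 4 : ℝ) : ℝ) : 𝕜) • upC 𝕜 q i k j) := by
  have hkj : k < j := Fin.lt_def.mpr (by omega)
  have hij := hik.trans hkj
  refine IsMono.ext_add (q := q) inferInstance inferInstance inferInstance (by abel) (by abel)
    fun z => ?_
  simp [Ioo_succ_eq_empty h, sum_Ioo_succ hik h, Finset.sum_add_distrib, Finset.sum_sub_distrib, sum_single_mode,
    hik.ne, hik.ne', hkj.ne, hkj.ne', hij.ne, hij.ne', hik.not_gt, hkj.not_gt, hik.le, hkj.le, -Finset.sum_ite_eq]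
  simp only [rpow_eq_exp]
  ring_nf
  simp only [exp_rules]
  ring_nf

/-- In this order x y = q^{1/2} y x, which is exactly the factor in the q-commutator. -/
lemma step_upB_upA (hik : i < k) (h : k.val + 1 = j.val) :
    IsStep ((q ^ (1 / 2 : ℝ) : ℝ) : 𝕜) (qPow q fun n => nLeg k n / 2)
      (upB 𝕜 q i k) (upA 𝕜 q k j) 0 := by
  have hkj : k < j := Fin.lt_def.mpr (by omega)
  have hij := hik.trans hkj
  refine IsStep.of_mul_eq (A := Op 𝕜 N) ?_
  refine IsMono.ext (q := q) inferInstance inferInstance (by abel) fun z => ?_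
  simp [Ioo_succ_eq_empty h, sum_Ioo_succ hik h, Finset.sum_add_distrib, Finset.sum_sub_distrib, sum_single_mode,
    hik.ne, hik.ne', hkj.ne, hkj.ne', hij.ne, hij.ne', hik.not_gt, hkj.not_gt, hik.le, hkj.le, -Finset.sum_ite_eq]
  simp only [rpow_eq_exp]
  ring_nf
  simp only [exp_rules]
  ring_nf

lemma step_upB_upB (hik : i < k) (h : k.val + 1 = j.val) :
    IsStep ((q ^ (1 / 2 : ℝ) : ℝ) : 𝕜) (qPow q fun n => nLeg k n / 2)
      (upB 𝕜 q i k) (upB 𝕜 q k j) (upB 𝕜 q i j) := by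
  have hkj : k < j := Fin.lt_def.mpr (by omega)
  have hij := hik.trans hkj
  refine IsMono.ext_add (q := q) inferInstance inferInstance inferInstance (by abel) (by abel)
    fun z => ?_
  simp [Ioo_succ_eq_empty h, sum_Ioo_succ hik h, Finset.sum_add_distrib, Finset.sum_sub_distrib, sum_single_mode,
    hik.ne, hik.ne', hkj.ne, hkj.ne', hij.ne, hij.ne', hik.not_gt, hkj.not_gt, hik.le, hkj.le, -Finset.sum_ite_eq]
  simp only [rpow_eq_exp]
  ring_nf
  simp only [exp_rules]
  ring_nf
  simp only [qNum_one_add]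
  ring_nf
  simp only [exp_rules]
  ring_nf

/-- On the leg k the monomial `upC` has the same factors as `upB`, so the cancellation is that of
`step_upB_upA`. -/
lemma step_upC_upA (hm : m ∈ Finset.Ioo i k) (h : k.val + 1 = j.val) :
    IsStep ((q ^ (1 / 2 : ℝ) : ℝ) : 𝕜) (qPow q fun n => nLeg k n / 2)
      (upC 𝕜 q i m k) (upA 𝕜 q k j) 0 := by
  obtain ⟨him, hmk⟩ := Finset.mem_Ioo.mp hm
  have hik := him.trans hmk
  have hkj : k < j := Fin.lt_def.mpr (by omega)
  have hij := hik.trans hkj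
  have hmj := hmk.trans hkj
  refine IsStep.of_mul_eq (A := Op 𝕜 N) ?_
  refine IsMono.ext (q := q) inferInstance inferInstance (by abel) fun z => ?_
  simp [Ioo_succ_eq_empty h, sum_Ioo_succ hik h, sum_Ioo_succ hmk h,
    him.ne, him.ne', hmk.ne, hmk.ne', hmj.ne, hmj.ne', him.not_gt, hmk.not_gt, hmj.not_gt, him.le, hmk.le,
    Finset.sum_add_distrib, Finset.sum_sub_distrib, sum_single_mode,
    hik.ne, hik.ne', hkj.ne, hkj.ne', hij.ne, hij.ne', hik.not_gt, hkj.not_gt, hik.le, hkj.le, -Finset.sum_ite_eq]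
  simp only [rpow_eq_exp]
  ring_nf
  simp only [exp_rules]
  ring_nf

lemma step_upC_upB (hm : m ∈ Finset.Ioo i k) (h : k.val + 1 = j.val) :
    IsStep ((q ^ (1 / 2 : ℝ) : ℝ) : 𝕜) (qPow q fun n => nLeg k n / 2)
      (upC 𝕜 q i m k) (upB 𝕜 q k j) (upC 𝕜 q i m j) := by
  obtain ⟨him, hmk⟩ := Finset.mem_Ioo.mp hm
  have hik := him.trans hmk
  have hkj : k < j := Fin.lt_def.mpr (by omega)
  have hij := hik.trans hkj
  have hmj := hmk.trans hkj
  refine IsMono.ext_add (q := q) inferInstance inferInstance inferInstance (by abel) (by abel)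
    fun z => ?_
  simp [Ioo_succ_eq_empty h, sum_Ioo_succ hik h, sum_Ioo_succ hmk h,
    him.ne, him.ne', hmk.ne, hmk.ne', hmj.ne, hmj.ne', him.not_gt, hmk.not_gt, hmj.not_gt, him.le, hmk.le,
    Finset.sum_add_distrib, Finset.sum_sub_distrib, sum_single_mode,
    hik.ne, hik.ne', hkj.ne, hkj.ne', hij.ne, hij.ne', hik.not_gt, hkj.not_gt, hik.le, hkj.le, -Finset.sum_ite_eq]
  simp only [rpow_eq_exp]
  ring_nf
  simp only [exp_rules]
  ring_nf
  simp only [qNum_one_add]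
  ring_nf
  simp only [exp_rules]
  ring_nf

lemma step_downA_downA (hik : i < k) (h : k.val + 1 = j.val) :
    IsStep ((q ^ (-1 / 2 : ℝ) : ℝ) : 𝕜) (qPow q fun n => -nLeg k n / 2)
      (downA 𝕜 q k j) (downA 𝕜 q i k) (downA 𝕜 q i j) := by
  have hkj : k < j := Fin.lt_def.mpr (by omega)
  have hij := hik.trans hkj
  refine IsMono.ext_add (q := q) inferInstance inferInstance inferInstance (by abel) (by abel)
    fun z => ?_
  simp [Ioo_succ_eq_empty h, sum_Ioo_succ hik h, Finset.sum_add_distrib, Finset.sum_sub_distrib, sum_single_mode,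
    hik.ne, hik.ne', hkj.ne, hkj.ne', hij.ne, hij.ne', hik.not_gt, hkj.not_gt, hik.le, hkj.le, -Finset.sum_ite_eq]
  simp only [rpow_eq_exp]
  ring_nf
  simp only [exp_rules]
  ring_nf
  simp only [qNum_one_add']
  ring_nf
  simp only [exp_rules]
  ring_nf

/-- Here x y = q^{1/2} y x while the q-commutator subtracts q^{-1/2} y x; the remainder is the
summand for the new leg k. -/
lemma step_downA_downB (hik : i < k) (h : k.val + 1 = j.val) :
    IsStep ((q ^ (-1 / 2 : ℝ) : ℝ) : 𝕜) (qPow q fun n => -nLeg k n / 2)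
      (downA 𝕜 q k j) (downB 𝕜 q i k) (((q ^ (1 / 4 : ℝ) - q ^ (-3 / 4 : ℝ) : ℝ) : 𝕜) • downC 𝕜 q i k j) := by
  have hkj : k < j := Fin.lt_def.mpr (by omega)
  have hij := hik.trans hkj
  refine IsMono.ext_add (q := q) inferInstance inferInstance inferInstance (by abel) (by abel)
    fun z => ?_
  simp [Ioo_succ_eq_empty h, sum_Ioo_succ hik h, Finset.sum_add_distrib, Finset.sum_sub_distrib, sum_single_mode,
    hik.ne, hik.ne', hkj.ne, hkj.ne', hij.ne, hij.ne', hik.not_gt, hkj.not_gt, hik.le, hkj.le, -Finset.sum_ite_eq]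
  simp only [rpow_eq_exp]
  ring_nf
  simp only [exp_rules]
  ring_nf

lemma step_downB_downA (hik : i < k) (h : k.val + 1 = j.val) :
    IsStep ((q ^ (-1 / 2 : ℝ) : ℝ) : 𝕜) (qPow q fun n => -nLeg k n / 2)
      (downB 𝕜 q k j) (downA 𝕜 q i k) 0 := by
  have hkj : k < j := Fin.lt_def.mpr (by omega)
  have hij := hik.trans hkj
  refine IsStep.of_mul_eq (A := Op 𝕜 N) ?_
  refine IsMono.ext (q := q) inferInstance inferInstance (by abel) fun z => ?_
  simp [Ioo_succ_eq_empty h, sum_Ioo_succ hik h, Finset.sum_add_distrib, Finset.sum_sub_distrib, sum_single_mode,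
    hik.ne, hik.ne', hkj.ne, hkj.ne', hij.ne, hij.ne', hik.not_gt, hkj.not_gt, hik.le, hkj.le, -Finset.sum_ite_eq]
  simp only [rpow_eq_exp]
  ring_nf
  simp only [exp_rules]
  ring_nf

lemma step_downB_downB (hik : i < k) (h : k.val + 1 = j.val) :
    IsStep ((q ^ (-1 / 2 : ℝ) : ℝ) : 𝕜) (qPow q fun n => -nLeg k n / 2)
      (downB 𝕜 q k j) (downB 𝕜 q i k) (downB 𝕜 q i j) := by
  have hkj : k < j := Fin.lt_def.mpr (by omega)
  have hij := hik.trans hkj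
  refine IsMono.ext_add (q := q) inferInstance inferInstance inferInstance (by abel) (by abel)
    fun z => ?_
  simp [Ioo_succ_eq_empty h, sum_Ioo_succ hik h, Finset.sum_add_distrib, Finset.sum_sub_distrib, sum_single_mode,
    hik.ne, hik.ne', hkj.ne, hkj.ne', hij.ne, hij.ne', hik.not_gt, hkj.not_gt, hik.le, hkj.le, -Finset.sum_ite_eq]
  simp only [rpow_eq_exp]
  ring_nf
  simp only [exp_rules]
  ring_nf
  simp only [qNum_one_add']
  ring_nf
  simp only [exp_rules]
  ring_nf

lemma step_downA_downC (hm : m ∈ Finset.Ioo i k) (h : k.val + 1 = j.val) :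
    IsStep ((q ^ (-1 / 2 : ℝ) : ℝ) : 𝕜) (qPow q fun n => -nLeg k n / 2)
      (downA 𝕜 q k j) (downC 𝕜 q i m k) (downC 𝕜 q i m j) := by
  obtain ⟨him, hmk⟩ := Finset.mem_Ioo.mp hm
  have hik := him.trans hmk
  have hkj : k < j := Fin.lt_def.mpr (by omega)
  have hij := hik.trans hkj
  have hmj := hmk.trans hkj
  refine IsMono.ext_add (q := q) inferInstance inferInstance inferInstance (by abel) (by abel)
    fun z => ?_
  simp [Ioo_succ_eq_empty h, sum_Ioo_succ hik h, sum_Ioo_succ hmk h,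
    him.ne, him.ne', hmk.ne, hmk.ne', hmj.ne, hmj.ne', him.not_gt, hmk.not_gt, hmj.not_gt, him.le, hmk.le,
    Finset.sum_add_distrib, Finset.sum_sub_distrib, sum_single_mode,
    hik.ne, hik.ne', hkj.ne, hkj.ne', hij.ne, hij.ne', hik.not_gt, hkj.not_gt, hik.le, hkj.le, -Finset.sum_ite_eq]
  simp only [rpow_eq_exp]
  ring_nf
  simp only [exp_rules]
  ring_nf
  simp only [qNum_one_add']
  ring_nf
  simp only [exp_rules]
  ring_nf

lemma step_downB_downC (hm : m ∈ Finset.Ioo i k) (h : k.val + 1 = j.val) :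
    IsStep ((q ^ (-1 / 2 : ℝ) : ℝ) : 𝕜) (qPow q fun n => -nLeg k n / 2)
      (downB 𝕜 q k j) (downC 𝕜 q i m k) 0 := by
  obtain ⟨him, hmk⟩ := Finset.mem_Ioo.mp hm
  have hik := him.trans hmk
  have hkj : k < j := Fin.lt_def.mpr (by omega)
  have hij := hik.trans hkj
  have hmj := hmk.trans hkj
  refine IsStep.of_mul_eq (A := Op 𝕜 N) ?_
  refine IsMono.ext (q := q) inferInstance inferInstance (by abel) fun z => ?_
  simp [Ioo_succ_eq_empty h, sum_Ioo_succ hik h, sum_Ioo_succ hmk h,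
    him.ne, him.ne', hmk.ne, hmk.ne', hmj.ne, hmj.ne', him.not_gt, hmk.not_gt, hmj.not_gt, him.le, hmk.le,
    Finset.sum_add_distrib, Finset.sum_sub_distrib, sum_single_mode,
    hik.ne, hik.ne', hkj.ne, hkj.ne', hij.ne, hij.ne', hik.not_gt, hkj.not_gt, hik.le, hkj.le, -Finset.sum_ite_eq]
  simp only [rpow_eq_exp]
  ring_nf
  simp only [exp_rules]
  ring_nf

lemma qPow_sq (g : Occ N → ℝ) : (qPow q (fun n => g n / 4) ^ 2 : Op 𝕜 N) =
    qPow q fun n => g n / 2 := by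
  rw [sq, qPow_mul_qPow hq.out]
  congr 1; funext n; ring

/-- Of the six kinds of products two vanish, two reproduce the first two terms, one extends the old
third-term summands to j, and one adds the summand of the leg k. -/
lemma frakE_step_raise (hik : i < k) (h : k.val + 1 = j.val) : (frakE q i j : Op 𝕜 N) =
    qPow q (fun n => nLeg k n / 4) ^ 2 * (frakE q i k * frakE q k j -
      ((q ^ (1 / 2 : ℝ) : ℝ) : 𝕜) • (frakE q k j * frakE q i k)) := by
  have hij : i < j := hik.trans (Fin.lt_def.mpr (by omega))
  rw [qPow_sq, frakE_raise h, frakE_eq_up hik, frakE_eq_up hij, sum_Ioo_succ hik h]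
  refine Eq.trans ?_ (IsStep.eq (A := Op 𝕜 N) (IsStep.add_left (IsStep.add_left
    (IsStep.add_right (step_upA_upA hik h) (step_upA_upB hik h))
    (IsStep.add_right (step_upB_upA hik h) (step_upB_upB hik h)))
    (IsStep.smul_left _ (IsStep.sum_left fun m hm =>
      IsStep.add_right (step_upC_upA hm h) (step_upC_upB hm h)))))
  simp only [zero_add]
  rw [smul_add]
  abel

lemma frakE_step_lower (hik : i < k) (h : k.val + 1 = j.val) : (frakE q j i : Op 𝕜 N) =
    qPow q (fun n => -nLeg k n / 4) ^ 2 * (frakE q j k * frakE q k i -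
      ((q ^ (-1 / 2 : ℝ) : ℝ) : 𝕜) • (frakE q k i * frakE q j k)) := by
  have hij : i < j := hik.trans (Fin.lt_def.mpr (by omega))
  rw [qPow_sq (fun n => -nLeg k n), frakE_lower h, frakE_eq_down hik, frakE_eq_down hij,
    sum_Ioo_succ hik h]
  refine Eq.trans ?_ (IsStep.eq (A := Op 𝕜 N) (IsStep.add_right (IsStep.add_right
    (IsStep.add_left (step_downA_downA hik h) (step_downB_downA hik h))
    (IsStep.add_left (step_downA_downB hik h) (step_downB_downB hik h)))
    (IsStep.smul_right _ (IsStep.sum_right fun m hm =>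
      IsStep.add_left (step_downA_downC hm h) (step_downB_downC hm h)))))
  simp only [zero_add, add_zero]
  rw [smul_add]
  abel

end
end QIntertwiner

end

noncomputable section

namespace QIntertwiner

variable {𝕜 : Type*} [RCLike 𝕜] {N : ℕ} {q : ℝ}

/-! ### The representations of `U_q(u(N))` -/

/-- The operators by which the generators of `U_q(u(N))` act on the Fock space. -/
def genOp (𝕜 : Type*) [RCLike 𝕜] (q : ℝ) {N : ℕ} : UqGen N → Op 𝕜 N
  | .E i j => frakE q i j
  | .K i => qPow q fun n => nLeg i n / 4
  | .Kinv i => qPow q fun n => -nLeg i n / 4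

lemma lift_fE (i j : Fin N) : FreeAlgebra.lift 𝕜 (genOp 𝕜 q) (fE i j) = frakE q i j :=
  FreeAlgebra.lift_ι_apply _ _

lemma lift_fK (i : Fin N) :
    FreeAlgebra.lift 𝕜 (genOp 𝕜 q) (fK i) = qPow q fun n => nLeg i n / 4 :=
  FreeAlgebra.lift_ι_apply _ _

lemma lift_fKinv (i : Fin N) :
    FreeAlgebra.lift 𝕜 (genOp 𝕜 q) (fKinv i) = qPow q fun n => -nLeg i n / 4 :=
  FreeAlgebra.lift_ι_apply _ _

lemma diag_comm (g h : Occ N → ℝ) : (diag g * diag h - diag h * diag g : Op 𝕜 N) = 0 := by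
  have e : (fun n => g n * h n) = fun n => h n * g n := funext fun n => mul_comm _ _
  rw [diag_mul_diag, diag_mul_diag, e]
  exact op_sub_self _

lemma qPow_mul_qPow_neg (hq : 0 < q) {g h : Occ N → ℝ} (e : ∀ n, g n + h n = 0) :
    (qPow q g * qPow q h : Op 𝕜 N) = 1 := by
  rw [qPow_mul_qPow hq, ← qPow_zero (q := q)]
  exact congrArg _ (funext e)

section
variable [hq : Fact (0 < q)] [hq1 : Fact (q ≠ 1)]

lemma lift_eq_of_uqRel {x y : FreeAlgebra 𝕜 (UqGen N)} (h : UqRel 𝕜 q N x y) :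
    FreeAlgebra.lift 𝕜 (genOp 𝕜 q) x = FreeAlgebra.lift 𝕜 (genOp 𝕜 q) y := by
  cases h <;>
    simp only [map_sub, map_add, map_mul, map_pow, map_smul, map_one, map_zero, lift_fE, lift_fK,
      lift_fKinv, fBracket]
  case cartan_comm i j => rw [frakE_self, frakE_self, diag_comm]
  case cartan_K_comm i j => rw [frakE_self]; exact diag_comm _ _
  case K_comm i j => exact diag_comm _ _
  case K_Kinv i => exact qPow_mul_qPow_neg hq.out fun n => by ring
  case Kinv_K i => exact qPow_mul_qPow_neg hq.out fun n => by ring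
  case cartan_raise i j k h => rw [frakE_self]; exact diag_mul_raise i h
  case cartan_lower i j k h => rw [frakE_self]; exact diag_mul_lower i h
  case K_raise i j k h => exact qPow_mul_raise i h
  case K_lower i j k h => exact qPow_mul_lower i h
  case raise_lower i i' h => exact frakE_bracket h
  case raise_lower_ne i i' j j' hi hj hij => exact raise_lower_commute hi hj hij
  case raise_far i i' j j' hi hj hij => exact raise_commute hi hj hij
  case lower_far i i' j j' hi hj hij => exact lower_commute hi hj hij
  case serre_raise i i' j j' hi hj hij =>
    exact hij.elim (serre_raise_right hi hj) (serre_raise_left hi hj)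
  case serre_lower i i' j j' hi hj hij =>
    exact hij.elim (serre_lower_right hi hj) (serre_lower_left hi hj)
  case raise_step i k j hik hkj => exact frakE_step_raise hik hkj
  case lower_step i k j hik hkj => exact frakE_step_lower hik hkj

/-- The representation of `U_q(u(N))` on the Fock space. -/
def fockRep (𝕜 : Type*) [RCLike 𝕜] (q : ℝ) [Fact (0 < q)] [Fact (q ≠ 1)] (N : ℕ) :
    Uq 𝕜 q N →ₐ[𝕜] Op 𝕜 N :=
  RingQuot.liftAlgHom 𝕜 ⟨FreeAlgebra.lift 𝕜 (genOp 𝕜 q), fun _ _ h => lift_eq_of_uqRel h⟩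

lemma fockRep_mk (x : FreeAlgebra 𝕜 (UqGen N)) :
    fockRep 𝕜 q N (RingQuot.mkAlgHom 𝕜 (UqRel 𝕜 q N) x) = FreeAlgebra.lift 𝕜 (genOp 𝕜 q) x :=
  RingQuot.liftAlgHom_mkAlgHom_apply _ _ _ x

lemma fockRep_uqE (i j : Fin N) : fockRep 𝕜 q N (uqE 𝕜 q i j) = frakE q i j := by
  rw [uqE, fockRep_mk, lift_fE]

lemma fockRep_uqK (i : Fin N) :
    fockRep 𝕜 q N (uqK 𝕜 q i) = qPow q fun n => nLeg i n / 4 := by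
  rw [uqK, fockRep_mk, lift_fK]

/-! ### The intertwiner space is invariant -/

/-- Each J_± moves a quantum between the two modes of one leg. -/
lemma nLeg_commute_tot (l : Fin N) :
    (diag (nLeg l) * totJp q : Op 𝕜 N) = totJp q * diag (nLeg l) ∧
    (diag (nLeg l) * totJm q : Op 𝕜 N) = totJm q * diag (nLeg l) := by
  constructor
  · rw [totJp, Finset.mul_sum, Finset.sum_mul]
    refine Finset.sum_congr rfl fun i _ => ?_
    refine IsMono.ext (q := q) inferInstance inferInstance (by abel) fun z => ?_
    simp [Pi.single_apply, Prod.ext_iff]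
    ring_nf
  · rw [totJm, Finset.mul_sum, Finset.sum_mul]
    refine Finset.sum_congr rfl fun i _ => ?_
    refine IsMono.ext (q := q) inferInstance inferInstance (by abel) fun z => ?_
    simp [Pi.single_apply, Prod.ext_iff]
    ring_nf

/-- Functions of the `N_{a_l} + N_{b_l}` preserve the intertwiner space. -/
lemma diag_mem_intertwiners {g : Occ N → ℝ} (hg : ∀ n m, (∀ l, nLeg l n = nLeg l m) → g n = g m)
    {v : Fock 𝕜 N} (hv : v ∈ intertwiners 𝕜 q N) : (diag g : Op 𝕜 N) v ∈ intertwiners 𝕜 q N := by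
  have hz : (totJz * diag g : Op 𝕜 N) = diag g * totJz := by
    rw [totJz, diag_mul_diag, diag_mul_diag]
    simp only [mul_comm]
  exact mem_intertwiners_of_commute hz
    (diag_commute_of_commute hg fun l => (nLeg_commute_tot l).1).symm
    (diag_commute_of_commute hg fun l => (nLeg_commute_tot l).2).symm hv

lemma qPow_mem_intertwiners {g : Occ N → ℝ} (hg : ∀ n m, (∀ l, nLeg l n = nLeg l m) → g n = g m)
    {v : Fock 𝕜 N} (hv : v ∈ intertwiners 𝕜 q N) :
    (qPow q g : Op 𝕜 N) v ∈ intertwiners 𝕜 q N :=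
  diag_mem_intertwiners (fun n m h => by rw [hg n m h]) hv

lemma mem_of_qPow_mul_mul_qPow {g h : Occ N → ℝ} {A B : Op 𝕜 N}
    (hg : ∀ n m, (∀ l, nLeg l n = nLeg l m) → g n = g m)
    (hh : ∀ n m, (∀ l, nLeg l n = nLeg l m) → h n = h m)
    (hB : ∀ v ∈ intertwiners 𝕜 q N, B v ∈ intertwiners 𝕜 q N) (e : B = qPow q g * A * qPow q h)
    {v : Fock 𝕜 N} (hv : v ∈ intertwiners 𝕜 q N) : A v ∈ intertwiners 𝕜 q N := by
  have e1 : A = qPow q (fun n => -g n) * B * qPow q (fun n => -h n) := by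
    have h1 : (qPow q (fun n => -g n) * qPow q g : Op 𝕜 N) = 1 :=
      qPow_mul_qPow_neg hq.out fun n => by ring
    have h2 : (qPow q h * qPow q (fun n => -h n) : Op 𝕜 N) = 1 :=
      qPow_mul_qPow_neg hq.out fun n => by ring
    rw [e, ← mul_assoc, ← mul_assoc, h1, one_mul, mul_assoc, h2, mul_one]
  rw [e1]
  exact qPow_mem_intertwiners (fun n m h => by rw [hg n m h])
    (hB _ (qPow_mem_intertwiners (fun n m h => by rw [hh n m h]) hv))

/-- Invariance is known for E_{ij}; the change of variables is inverted by powers of q in the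
numbers N_{a_l} + N_{b_l}, which preserve the intertwiner space. -/
lemma frakE_mem_intertwiners (i j : Fin N) {v : Fock 𝕜 N} (hv : v ∈ intertwiners 𝕜 q N) :
    (frakE q i j : Op 𝕜 N) v ∈ intertwiners 𝕜 q N := by
  rcases lt_trichotomy i j with h | rfl | h
  -- For i < j there is no factor on the right, hence the exponent 0.
  · refine mem_of_qPow_mul_mul_qPow (h := fun _ => 0)
      (g := fun n => (-(∑ l ∈ Finset.Ioo i j, nLeg l n) + nLeg j n) / 4)
      (fun n m hnm => by simp only [hnm]) (fun _ _ _ => rfl)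
      (fun v hv => scriptE_mem_intertwiners i j hv) ?_ hv
    rw [qPow_zero, mul_one, scriptE_lt_eq h]
  · rw [frakE_self]
    exact diag_mem_intertwiners (fun n m h => h i) hv
  · exact mem_of_qPow_mul_mul_qPow (fun n m hnm => by simp only [hnm])
      (fun n m hnm => by simp only [hnm])
      (fun v hv => scriptE_mem_intertwiners i j hv) (scriptE_gt_eq h) hv

lemma fockRep_mem_intertwiners (x : Uq 𝕜 q N) {v : Fock 𝕜 N} (hv : v ∈ intertwiners 𝕜 q N) :
    fockRep 𝕜 q N x v ∈ intertwiners 𝕜 q N := by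
  obtain ⟨y, rfl⟩ := RingQuot.mkAlgHom_surjective 𝕜 (UqRel 𝕜 q N) x
  rw [fockRep_mk]
  induction y using FreeAlgebra.induction generalizing v with
  | grade0 r =>
    rw [AlgHom.commutes, Module.algebraMap_end_apply]
    exact Submodule.smul_mem _ r hv
  | grade1 g =>
    rw [FreeAlgebra.lift_ι_apply]
    cases g with
    | E i j => exact frakE_mem_intertwiners i j hv
    | K i => exact qPow_mem_intertwiners (fun n m h => by rw [h i]) hv
    | Kinv i => exact qPow_mem_intertwiners (fun n m h => by rw [h i]) hv
  | mul a b ha hb =>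
    rw [map_mul]
    exact ha (hb hv)
  | add a b ha hb =>
    rw [map_add]
    exact Submodule.add_mem _ (ha hv) (hb hv)

/-- The representation of `U_q(u(N))` on the intertwiner space. -/
def intertwinerRep (𝕜 : Type*) [RCLike 𝕜] (q : ℝ) [Fact (0 < q)] [Fact (q ≠ 1)] (N : ℕ) :
    Uq 𝕜 q N →ₐ[𝕜] Module.End 𝕜 (intertwiners 𝕜 q N) where
  toFun x := (fockRep 𝕜 q N x).restrict fun _ hv => fockRep_mem_intertwiners x hv
  map_one' := by ext; simp
  map_mul' x y := by ext; simp
  map_zero' := by ext; simp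
  map_add' x y := by ext; simp
  commutes' r := by ext; simp [Module.algebraMap_end_apply]

end
end QIntertwiner

end

/-! ### Assembly of the theorem -/

theorem mainTheorem1 {𝕜 : Type*} [RCLike 𝕜] (q : ℝ) (hq : 0 < q) (hq1 : q ≠ 1) (N : ℕ) :
    -- the `R`-matrices that enter the braiding are invertible
    (∀ m s : Fin N, s < m → IsUnit (rMatrix q m s : Op 𝕜 N)) ∧
    -- the operators are `U_q(su(2))`-invariant and preserve the intertwiner space
    (∀ i j : Fin N, IsInvariant q (scriptE q i j : Op 𝕜 N) ∧
      ∀ v ∈ intertwiners 𝕜 q N, (scriptE q i j : Op 𝕜 N) v ∈ intertwiners 𝕜 q N) ∧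
    -- the change of variables
    (∀ i : Fin N, (scriptE q i i : Op 𝕜 N) =
      ((q ^ (-1 / 2 : ℝ) : ℝ) : 𝕜) •
        (qPow q (fun n => nLeg i n / 2) * diag (fun n => qNum q (nLeg i n)))) ∧
    (∀ i j : Fin N, i < j → (scriptE q i j : Op 𝕜 N) =
      qPow q (fun n => (-(∑ l ∈ Finset.Ioo i j, nLeg l n) + nLeg j n) / 4) * frakE q i j) ∧
    (∀ i j : Fin N, i < j → (scriptE q j i : Op 𝕜 N) =
      qPow q (fun n => (2 * nLeg i n + ∑ l ∈ Finset.Ioo i j, nLeg l n) / 4) * frakE q j i *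
        qPow q (fun n => nLeg j n / 4)) ∧
    -- the `𝔈_{ij}` realize `U_q(u(N))` on the Fock space
    (∃ π : Uq 𝕜 q N →ₐ[𝕜] Op 𝕜 N,
      (∀ i j : Fin N, π (uqE 𝕜 q i j) = frakE q i j) ∧
      ∀ i : Fin N, π (uqK 𝕜 q i) = qPow q (fun n => nLeg i n / 4)) ∧
    -- and, by restriction, on the intertwiner space
    (∃ ρ : Uq 𝕜 q N →ₐ[𝕜] Module.End 𝕜 (intertwiners 𝕜 q N),
      (∀ (i j : Fin N) (v : intertwiners 𝕜 q N),
        (ρ (uqE 𝕜 q i j) v : Fock 𝕜 N) = (frakE q i j : Op 𝕜 N) v) ∧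
      ∀ (i : Fin N) (v : intertwiners 𝕜 q N),
        (ρ (uqK 𝕜 q i) v : Fock 𝕜 N) =
          (qPow q (fun n => nLeg i n / 4) : Op 𝕜 N) (v : Fock 𝕜 N)) := by
  -- The instances of `IsMono` take the hypotheses on q from the class system.
  haveI : Fact (0 < q) := ⟨hq⟩
  haveI : Fact (q ≠ 1) := ⟨hq1⟩
  refine ⟨fun m s h => isUnit_rMatrix h.ne, fun i j => ⟨isInvariant_scriptE i j,
    fun v hv => scriptE_mem_intertwiners i j hv⟩, scriptE_self_eq, fun i j h => scriptE_lt_eq h,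
    fun i j h => scriptE_gt_eq h, ⟨fockRep 𝕜 q N, fockRep_uqE, fockRep_uqK⟩,
    ⟨intertwinerRep 𝕜 q N, fun i j v => ?_, fun i v => ?_⟩⟩
  · rw [← fockRep_uqE]; rfl
  · rw [← fockRep_uqK]; rfl
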